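/- **Setting.** Let $\theta\ge 1$ be an integer and let $\Sigma\subseteq\mathbb R$ be a non-empty closed set that is a union of non-degenerate compact intervals, with $\Sigma\subseteq[0,\infty)$ if $\theta$ is even. Let $p(n)\ge 1$ be integers with $p(n)/n\to\kappa\in(0,\infty)$, and let $w_n\ge 0$ be continuous functions on $\Sigma$. Write $\mathcal N(f)$ for the set of zeros of $f$ in $\Sigma$. Assume: (a1) There is a continuous $w:\Sigma\to[0,\infty)$ such that $\mathcal N(w)$ is finite; $\mathcal N(w_n)\subseteq\mathcal N(w)$ for all large $n$; $w_n\to w$ uniformly on compact subsets of $\Sigma$ and $\log w_n\to\log w$ uniformly on compact subsets of $\Sigma\setminus\mathcal N(w)$; and $\log w$ is Lipschitz on compact subsets of $\Sigma\setminus\mathcal N(w)$. (a2) There are $n_0\in\mathbb N$ and $\epsilon>0$ such that $|x|^{(\theta+1)(\kappa+\epsilon)}\sup_{n\ge n_0}w_n(x)\to 0$ as $|x|\to\infty$, $x\in\Sigma$ (an empty condition if $\Sigma$ is bounded). Let $Q_n$ be the law on $\Sigma^{p(n)}$ with Lebesgue density $$q_n(x)=\frac1{Z_n}\prod_{i=1}^{p(n)}w_n(x_i)^n\prod_{1\le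 i<j\le p(n)}|x_i-x_j|\,|x_i^\theta-x_j^\theta| ,$$ let $L_n(x)=\frac1{p(n)}\sum_{j=1}^{p(n)}\delta_{x_j}$, and let $\mathcal M_1(\Sigma)$ be the space of Borel probability measures on $\Sigma$ with the weak topology. For $\mu\in\mathcal M_1(\Sigma)$ put $$J(\mu)=\iint\Big\{\tfrac{\kappa^2}2\big(\log|x^\theta-y^\theta|^{-1}+\log|x-y|^{-1}\big)-\tfrac\kappa2\big(\log w(x)+\log w(y)\big)\Big\}\,\mu(dx)\,\mu(dy)\in(-\infty,\infty],$$ where the integrand is $+\infty$ if $x=y$, $w(x)=0$ or $w(y)=0$, and let $I(\mu)=J(\mu)-\inf_{\mathcal M_1(\Sigma)}J$. **Claim.** 1. For all large $n$, $Q_n$ is a well-defined probability measure ($0<Z_n<\infty$). 2. (Strong law.) If $I$ has a unique minimiser $\mu^*$, then for random vectors $X^{(n)}$ defined on a common probability space such that $X^{(n)}$ has law $Q_n$ for all large $n$ (with an arbitrary joint distribution), almost surely $L_n(X^{(n)})\to\mu^*$ weakly. 3. Let $A\subseteq\mathcal M_1(\Sigma)$ be closed with $A\cap\{I=0\}=\emptyset$.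 If $\inf_AI<\infty$, then $Q_n(L_n\in A)\le\exp(-n^2\inf_AI/2)$ for all large $n$. If $\inf_AI=\infty$, then for every real $M$, $Q_n(L_n\in A)\le\exp(-n^2M)$ for all large $n$. (No uniqueness of the minimiser is assumed here.) 4. (Disordered bosons.) Let $\alpha\in\{0,1,2,\dots\}$ and, for $n\ge1$, let $X^{(n)}$ be random vectors on a common probability space, where $X^{(n)}$ has on $[0,\infty)^n$ a density proportional to $\prod_{i}x_i^\alpha e^{-nx_i}\prod_{i<j}|x_i-x_j|\,|x_i^2-x_j^2|$. Then, almost surely, $\frac1n\sum_{i=1}^n\delta_{X^{(n)}_i}$ converges weakly to the probability measure with density $$\varrho_\infty(t)=\frac1{2\pi}\,(t/b)^{-1/3}\Big(\big(1+\sqrt{1-t^2/b^2}\big)^{1/3}-\big(1-\sqrt{1-t^2/b^2}\big)^{1/3}\Big)$$ for $0<t\le b:=3\sqrt3$ and $\varrho_\infty(t)=0$ otherwise. -/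

import Mathlib

open MeasureTheory ProbabilityTheory Filter Topology
open scoped ENNReal

noncomputable section

namespace Biorthogonal

/-- The unnormalised joint density of `m` particles with one-particle weight `W`:
`∏ᵢ W (xᵢ) ∏_{i<j} |xᵢ - xⱼ| |xᵢ ^ θ - xⱼ ^ θ|`. -/
def weightProduct (θ m : ℕ) (W : ℝ → ℝ) (x : Fin m → ℝ) : ℝ :=
  (∏ i, W (x i)) * ∏ i, ∏ j ∈ Finset.Ioi i, |x i - x j| * |x i ^ θ - x j ^ θ|

/-- Lebesgue measure on `S ^ m`, where `S ⊆ ℝ` carries the restriction of Lebesgue measure. -/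
def referenceMeasure (S : Set ℝ) (m : ℕ) : Measure (Fin m → S) :=
  Measure.pi fun _ => (volume : Measure ℝ).comap ((↑) : S → ℝ)

/-- The finite-particle measure before normalisation, `Z • Q`, on `S ^ m`. -/
def unnormalizedLaw (S : Set ℝ) (θ m : ℕ) (W : ℝ → ℝ) : Measure (Fin m → S) :=
  (referenceMeasure S m).withDensity fun x =>
    ENNReal.ofReal (weightProduct θ m W fun i => (x i : ℝ))

/-- The partition function. -/
def partitionFunction (S : Set ℝ) (θ m : ℕ) (W : ℝ → ℝ) : ℝ≥0∞ :=
  unnormalizedLaw S θ m W Set.univ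

/-- The law of `m` particles in `S` with density
`Z⁻¹ ∏ᵢ W (xᵢ) ∏_{i<j} |xᵢ - xⱼ| |xᵢ ^ θ - xⱼ ^ θ|`. -/
def particleLaw (S : Set ℝ) (θ m : ℕ) (W : ℝ → ℝ) : Measure (Fin m → S) :=
  (partitionFunction S θ m W)⁻¹ • unnormalizedLaw S θ m W

/-- The law `Q_n` of the `p n` particles of the ensemble with varying weights `w_n ^ n`. -/
def ensembleLaw (S : Set ℝ) (θ : ℕ) (p : ℕ → ℕ) (wn : ℕ → ℝ → ℝ) (n : ℕ) :
    Measure (Fin (p n) → S) :=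
  particleLaw S θ (p n) fun t => wn n t ^ n

/-- The empirical measure `m⁻¹ ∑ⱼ δ_{xⱼ}` of `m ≥ 1` points of `S`. -/
def empiricalMeasure {S : Set ℝ} {m : ℕ} [NeZero m] (x : Fin m → S) : ProbabilityMeasure S :=
  ⟨(m : ℝ≥0∞)⁻¹ • ∑ j, Measure.dirac (x j), ⟨by
    simp [ENNReal.inv_mul_cancel (Nat.cast_ne_zero.2 (NeZero.ne m)) (ENNReal.natCast_ne_top m)]⟩⟩

/-- The set of zeros of `f` in `S`. -/
def zeroSet (S : Set ℝ) (f : ℝ → ℝ) : Set ℝ := {x ∈ S | f x = 0}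

/-- Condition (a1) on the weights `wn` and the limiting weight `w`.
Only the values on `S` matter. -/
structure ConditionA1 (S : Set ℝ) (wn : ℕ → ℝ → ℝ) (w : ℝ → ℝ) : Prop where
  continuousOn : ContinuousOn w S
  nonneg : ∀ x ∈ S, 0 ≤ w x
  finite_zeroSet : (zeroSet S w).Finite
  zeroSet_subset : ∀ᶠ n in atTop, zeroSet S (wn n) ⊆ zeroSet S w
  tendsto_weight : ∀ K ⊆ S, IsCompact K → TendstoUniformlyOn wn w atTop K
  tendsto_log : ∀ K ⊆ S \ zeroSet S w, IsCompact K →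
    TendstoUniformlyOn (fun n x => Real.log (wn n x)) (fun x => Real.log (w x)) atTop K
  lipschitz_log : ∀ K ⊆ S \ zeroSet S w, IsCompact K →
    ∃ C, LipschitzOnWith C (fun x => Real.log (w x)) K

/-- Condition (a2): `|x| ^ ((θ + 1) (κ + ε)) sup_{n ≥ n₀} w_n x → 0` as `|x| → ∞` in `S`
(an empty condition if `S` is bounded). -/
def ConditionA2 (S : Set ℝ) (θ : ℕ) (κ : ℝ) (wn : ℕ → ℝ → ℝ) : Prop :=
  ∃ n₀ : ℕ, ∃ ε : ℝ, 0 < ε ∧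
    Tendsto (fun x : ℝ => ENNReal.ofReal (|x| ^ (((θ : ℝ) + 1) * (κ + ε))) *
        ⨆ n, ⨆ (_ : n₀ ≤ n), ENNReal.ofReal (wn n x))
      (Bornology.cobounded ℝ ⊓ 𝓟 S) (𝓝 0)

open scoped Classical in
/-- The symmetrised integrand of the rate function,
`(κ² / 2) (log |x ^ θ - y ^ θ|⁻¹ + log |x - y|⁻¹) - (κ / 2) (log w x + log w y)`,
equal to `+∞` on the diagonal and where `w x = 0` or `w y = 0`. -/
def interaction (θ : ℕ) (κ : ℝ) (w : ℝ → ℝ) (x y : ℝ) : EReal :=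
  if x ^ θ = y ^ θ ∨ w x = 0 ∨ w y = 0 then ⊤
  else ((κ ^ 2 / 2 * (Real.log |x ^ θ - y ^ θ|⁻¹ + Real.log |x - y|⁻¹)
    - κ / 2 * (Real.log (w x) + Real.log (w y)) : ℝ) : EReal)

/-- The integral of an extended-real function: integral of the positive part minus integral of
the negative part (the latter is finite for functions that are bounded below and finite
measures). -/
def eintegral {α : Type*} [MeasurableSpace α] (μ : Measure α) (f : α → EReal) : EReal :=
  ((∫⁻ a, (f a).toENNReal ∂μ : ℝ≥0∞) : EReal) - ((∫⁻ a, (-f a).toENNReal ∂μ : ℝ≥0∞) : EReal)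

/-- The energy
`(κ² / 2) ∬ (log |x ^ θ - y ^ θ|⁻¹ + log |x - y|⁻¹) dμ dμ - κ ∫ log w dμ`. -/
def energy (S : Set ℝ) (θ : ℕ) (κ : ℝ) (w : ℝ → ℝ) (μ : ProbabilityMeasure S) : EReal :=
  eintegral ((μ : Measure S).prod (μ : Measure S)) fun z => interaction θ κ w z.1 z.2

/-- The rate function `I`: the energy plus the constant `c = -inf energy`. -/
def rate (S : Set ℝ) (θ : ℕ) (κ : ℝ) (w : ℝ → ℝ) (μ : ProbabilityMeasure S) : EReal :=
  energy S θ κ w μ + -(⨅ ν : ProbabilityMeasure S, energy S θ κ w ν)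

/-- The law of the `n` characteristic frequencies of the disordered boson model with `τ = n`:
density proportional to `∏ᵢ xᵢ ^ α exp (-n xᵢ) ∏_{i<j} |xᵢ - xⱼ| |xᵢ² - xⱼ²|` on `[0, ∞) ^ n`. -/
def bosonLaw (α n : ℕ) : Measure (Fin n → Set.Ici (0 : ℝ)) :=
  particleLaw (Set.Ici 0) 2 n fun t => t ^ α * Real.exp (-(n * t))

/-- The right end point `b = 3 √3` of the limiting spectrum of the boson model. -/
def bosonEdge : ℝ := 3 * √3

open scoped Classical in
/-- The limiting density of the characteristic frequencies in the boson model. -/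
def bosonDensity (t : ℝ) : ℝ :=
  if 0 < t ∧ t ≤ bosonEdge then
    1 / (2 * Real.pi) * (t / bosonEdge) ^ (-(1 / 3 : ℝ)) *
      ((1 + √(1 - t ^ 2 / bosonEdge ^ 2)) ^ (1 / 3 : ℝ) -
        (1 - √(1 - t ^ 2 / bosonEdge ^ 2)) ^ (1 / 3 : ℝ))
  else 0

end Biorthogonal

end

noncomputable section
namespace Biorthogonal

/-! ### Integrals of extended-real functions as limits -/

/-! The density of `Q_n` is exp(-n² · energy of the empirical measure) up to factors of size
exp(o(n²)), so everything follows from an upper bound for the unnormalised mass of {L_n ∈ A} and a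
lower bound for the partition function. Conditions (a1) and (a2) enter only through
`AdmissibleWeights`, which also covers the boson weights.

Upper bound. Dividing each pair factor by powers of 1 + |x| and 1 + |y| gives `chord`, with values
in [0, 1]; the powers are absorbed in the one-particle weight, which becomes `tilted` and vanishes
at infinity. Cutting off the singularities gives bounded continuous kernels increasing to the
interaction, so `truncEnergy` is weakly continuous and increases to the energy. Bounded truncated
energy forces tightness, and a compactness argument (`exists_lt_truncEnergy`) shows that if the
energy exceeds a on a closed set, then one truncated energy exceeds a there with a uniform margin.
The density is then bounded pointwise (`weightProduct_le`).

Lower bound. Take a measure of almost minimal energy, condition it to a region away from the zeros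
of the weight, from 0 and from infinity (`exists_innerSet_energy_lt`), and smear it along short
intervals inside S so that its density is bounded; both operations cost arbitrarily little energy.
Jensen's inequality under the product of this law bounds the partition function below
(`ofReal_exp_le_partitionFunction`). The two bounds give the exponential estimates, and
Borel–Cantelli gives the strong law for any joint distribution.

Bosons. Here θ = 2, κ = 1, w = exp(-t). The candidate minimiser is the law of b T / cosh V, with T
uniform on (0, 1] and V independent with density proportional to cosh(v/3)/cosh v. The logarithmic
potential of 1 / cosh V has a closed form, obtained by differentiating an analytic function in the
strip |Re φ| < π and solving with triple-angle formulas (`mixLog_eq`). Averaging over T yields the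
Euler–Lagrange condition with effective field x, with equality on (0, b] and inequality beyond
(`bosonPotential`). The logarithmic kernel is positive definite, being a superposition of Gaussians
(`logEnergy_diff_nonneg`); applied to the laws of x and of x², this makes the candidate the only
minimiser (`eq_bosonMeasure`). -/

lemma tendsto_toENNReal {f : ℕ → ℝ} {a : EReal} (h : Tendsto (fun k => (f k : EReal)) atTop (𝓝 a)) :
    Tendsto (fun k => ENNReal.ofReal (f k)) atTop (𝓝 a.toENNReal) := by
  induction a with
  | bot =>
    rw [EReal.tendsto_coe_nhds_bot_iff] at h
    rw [EReal.toENNReal_bot]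
    refine tendsto_const_nhds.congr' ?_
    filter_upwards [h.eventually_le_atBot 0] with k hk
    rw [ENNReal.ofReal_of_nonpos hk]
  | top =>
    rw [EReal.tendsto_coe_nhds_top_iff] at h
    rw [EReal.toENNReal_top]
    exact ENNReal.tendsto_ofReal_atTop.comp h
  | coe a =>
    rw [EReal.tendsto_coe] at h
    rw [EReal.real_coe_toENNReal]
    exact ENNReal.tendsto_ofReal h

/-- Monotone convergence for `eintegral`. -/
lemma tendsto_integral_eintegral {α : Type*} [MeasurableSpace α] (π : Measure α)
    [IsProbabilityMeasure π] {K : ℕ → α → ℝ} {f : α → EReal} {c : ℝ}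
    (hm : ∀ k, Measurable (K k)) (hi : ∀ k, Integrable (K k) π) (hmono : ∀ a, Monotone fun k => K k a)
    (hlow : ∀ k a, -c ≤ K k a) (hf : ∀ a, Tendsto (fun k => (K k a : EReal)) atTop (𝓝 (f a))) :
    Tendsto (fun k => ((∫ a, K k a ∂π : ℝ) : EReal)) atTop (𝓝 (eintegral π f)) := by
  have hpos : Tendsto (fun k => ∫⁻ a, ENNReal.ofReal (K k a) ∂π) atTop
      (𝓝 (∫⁻ a, (f a).toENNReal ∂π)) := by
    refine lintegral_tendsto_of_tendsto_of_monotone (fun k => (hm k).ennreal_ofReal.aemeasurable)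
      (ae_of_all _ fun a k l hkl => ENNReal.ofReal_le_ofReal (hmono a hkl))
      (ae_of_all _ fun a => tendsto_toENNReal (hf a))
  have hneg : Tendsto (fun k => ∫⁻ a, ENNReal.ofReal (-K k a) ∂π) atTop
      (𝓝 (∫⁻ a, (-f a).toENNReal ∂π)) := by
    refine tendsto_lintegral_of_dominated_convergence (fun _ => ENNReal.ofReal c)
      (fun k => (hm k).neg.ennreal_ofReal)
      (fun k => ae_of_all _ fun a => ENNReal.ofReal_le_ofReal (by linarith [hlow k a]))
      (by simp) (ae_of_all _ fun a => tendsto_toENNReal ?_)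
    simp only [EReal.coe_neg]
    exact (continuous_neg.tendsto (f a)).comp (hf a)
  -- The uniform lower bound keeps the negative part finite, so the difference in `eintegral` is
  -- never ⊤ - ⊤ and addition is continuous at the limit.
  have hfin : ∫⁻ a, (-f a).toENNReal ∂π ≠ ⊤ := by
    refine ne_top_of_le_ne_top (b := ENNReal.ofReal c) (by simp) (le_of_tendsto' hneg fun k => ?_)
    calc ∫⁻ a, ENNReal.ofReal (-K k a) ∂π ≤ ∫⁻ _, ENNReal.ofReal c ∂π :=
          lintegral_mono fun a => ENNReal.ofReal_le_ofReal (by linarith [hlow k a])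
      _ = _ := by simp
  have heq : ∀ k, ((∫ a, K k a ∂π : ℝ) : EReal) = ((∫⁻ a, ENNReal.ofReal (K k a) ∂π : ℝ≥0∞) : EReal)
      - ((∫⁻ a, ENNReal.ofReal (-K k a) ∂π : ℝ≥0∞) : EReal) := by
    intro k
    rw [integral_eq_lintegral_pos_part_sub_lintegral_neg_part (hi k), EReal.coe_sub,
      EReal.coe_ennreal_toReal, EReal.coe_ennreal_toReal]
    · exact (hi k).neg.lintegral_lt_top.ne
    · exact (hi k).lintegral_lt_top.ne
  simp_rw [heq, eintegral, sub_eq_add_neg]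
  have h1 := (continuous_coe_ennreal_ereal.tendsto _).comp hpos
  have h2 := (continuous_neg.tendsto _).comp ((continuous_coe_ennreal_ereal.tendsto _).comp hneg)
  have hne : -((∫⁻ a, (-f a).toENNReal ∂π : ℝ≥0∞) : EReal) ≠ ⊥ := by
    rw [ne_eq, EReal.neg_eq_bot_iff]
    simpa using hfin
  have hne' : -((∫⁻ a, (-f a).toENNReal ∂π : ℝ≥0∞) : EReal) ≠ ⊤ := by
    rw [ne_eq, EReal.neg_eq_top_iff]
    simp
  exact (EReal.continuousAt_add (Or.inr hne) (Or.inr hne')).tendsto.comp (h1.prodMk_nhds h2)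

/-! ### The chordal factor and the truncated kernels -/

/-- The interaction `|x - y| |x ^ θ - y ^ θ|`, normalised to take values in `[0, 1]`. -/
def chord (θ : ℕ) (x y : ℝ) : ℝ :=
  |x - y| * |x ^ θ - y ^ θ| / ((1 + |x|) ^ (θ + 1) * (1 + |y|) ^ (θ + 1))

/-- Each of m particles lies in m - 1 pairs, so extracting these powers puts (1 + |x|) ^ ((θ + 1)(m
- 1)) on the one-particle weight. For m ≈ κ n this is roughly the n-th power of the prefactor in
`tilted`. -/
lemma abs_sub_mul_abs_pow_sub (θ : ℕ) (x y : ℝ) :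
    |x - y| * |x ^ θ - y ^ θ| = (1 + |x|) ^ (θ + 1) * (1 + |y|) ^ (θ + 1) * chord θ x y := by
  rw [chord, mul_div_cancel₀]
  positivity

lemma chord_nonneg (θ : ℕ) (x y : ℝ) : 0 ≤ chord θ x y := by
  rw [chord]; positivity

lemma chord_comm (θ : ℕ) (x y : ℝ) : chord θ x y = chord θ y x := by
  rw [chord, chord, abs_sub_comm x y, abs_sub_comm (x ^ θ), mul_comm ((1 + |x|) ^ (θ + 1))]

lemma chord_self (θ : ℕ) (x : ℝ) : chord θ x x = 0 := by
  simp [chord]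

lemma chord_eq_zero_iff {θ : ℕ} {x y : ℝ} : chord θ x y = 0 ↔ x ^ θ = y ^ θ := by
  have h : ((1 + |x|) ^ (θ + 1) * (1 + |y|) ^ (θ + 1)) ≠ 0 := by positivity
  rw [chord, div_eq_zero_iff, or_iff_left h, mul_eq_zero, abs_eq_zero, abs_eq_zero, sub_eq_zero,
    sub_eq_zero]
  exact ⟨fun h => h.elim (fun h => by rw [h]) id, Or.inr⟩

lemma continuous_chord (θ : ℕ) : Continuous fun z : ℝ × ℝ => chord θ z.1 z.2 := by
  unfold chord
  refine Continuous.div (by fun_prop) (by fun_prop) fun z => by positivity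

lemma chord_le_one {θ : ℕ} (hθ : 1 ≤ θ) (x y : ℝ) : chord θ x y ≤ 1 := by
  have hx := abs_nonneg x
  have hy := abs_nonneg y
  have h1 : |x - y| ≤ (1 + |x|) * (1 + |y|) := by
    have := abs_sub x y
    nlinarith
  have h2 : |x ^ θ - y ^ θ| ≤ (1 + |x|) ^ θ * (1 + |y|) ^ θ := by
    -- Superadditivity of t ↦ t ^ θ on [0, ∞), which is where θ ≥ 1 is needed.
    have h3 : ∀ t : ℝ, 0 ≤ t → 1 + t ^ θ ≤ (1 + t) ^ θ := fun t ht => by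
      simpa using pow_add_pow_le (zero_le_one) ht (by lia : θ ≠ 0)
    have h4 := h3 _ hx
    have h5 := h3 _ hy
    have h6 := abs_sub (x ^ θ) (y ^ θ)
    rw [abs_pow, abs_pow] at h6
    have h7 : 0 ≤ |x| ^ θ := by positivity
    have h8 : 0 ≤ |y| ^ θ := by positivity
    calc _ ≤ (1 + |x| ^ θ) * (1 + |y| ^ θ) := by nlinarith
      _ ≤ _ := by gcongr
  rw [chord, div_le_one (by positivity)]
  calc _ ≤ ((1 + |x|) * (1 + |y|)) * ((1 + |x|) ^ θ * (1 + |y|) ^ θ) := by gcongr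
    _ = _ := by ring

/-- The weight `(1 + |x|) ^ ((θ + 1) κ) w x`. -/
def tilted (θ : ℕ) (κ : ℝ) (w : ℝ → ℝ) (x : ℝ) : ℝ := (1 + |x|) ^ (((θ : ℝ) + 1) * κ) * w x

lemma tilted_nonneg {θ : ℕ} {κ : ℝ} {w : ℝ → ℝ} {x : ℝ} (h : 0 ≤ w x) : 0 ≤ tilted θ κ w x := by
  rw [tilted]; positivity

lemma tilted_pos {θ : ℕ} {κ : ℝ} {w : ℝ → ℝ} {x : ℝ} (h : 0 < w x) : 0 < tilted θ κ w x := by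
  rw [tilted]; positivity

lemma log_tilted {θ : ℕ} {κ : ℝ} {w : ℝ → ℝ} {x : ℝ} (h : 0 < w x) :
    Real.log (tilted θ κ w x) = ((θ : ℝ) + 1) * κ * Real.log (1 + |x|) + Real.log (w x) := by
  rw [tilted, Real.log_mul (by positivity) h.ne', Real.log_rpow (by positivity)]

lemma continuousOn_tilted {S : Set ℝ} {θ : ℕ} {κ : ℝ} {w : ℝ → ℝ} (h : ContinuousOn w S) :
    ContinuousOn (tilted θ κ w) S := by
  unfold tilted
  refine ContinuousOn.mul (Continuous.continuousOn ?_) h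
  exact Continuous.rpow_const (by fun_prop) fun x => Or.inl (by positivity)

/-- The kernel `(κ² / 2) min (-log chord) k - (κ / 2) (log (u x + 1/(k+1)) + log (u y + 1/(k+1)))`,
`u` being the tilted weight; it increases to the interaction. -/
def kernel (θ : ℕ) (κ : ℝ) (w : ℝ → ℝ) (k : ℕ) (x y : ℝ) : ℝ :=
  κ ^ 2 / 2 * -Real.log (max (chord θ x y) (Real.exp (-k)))
    - κ / 2 * (Real.log (tilted θ κ w x + 1 / ((k : ℝ) + 1))
      + Real.log (tilted θ κ w y + 1 / ((k : ℝ) + 1)))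

/-- The interaction, as a real number, away from its singularities. -/
def realInteraction (θ : ℕ) (κ : ℝ) (w : ℝ → ℝ) (x y : ℝ) : ℝ :=
  κ ^ 2 / 2 * (Real.log |x ^ θ - y ^ θ|⁻¹ + Real.log |x - y|⁻¹)
    - κ / 2 * (Real.log (w x) + Real.log (w y))

/-- The multiples of log (1 + |x|) from `chord` and from `tilted` are both (κ²/2)(θ + 1) and cancel.
What remains separates a nonnegative pair term from a weight term that is bounded above. -/
lemma realInteraction_eq {θ : ℕ} {κ : ℝ} {w : ℝ → ℝ} {x y : ℝ} (h : x ^ θ ≠ y ^ θ) (hx : 0 < w x)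
    (hy : 0 < w y) : realInteraction θ κ w x y = κ ^ 2 / 2 * -Real.log (chord θ x y)
      - κ / 2 * (Real.log (tilted θ κ w x) + Real.log (tilted θ κ w y)) := by
  have hxy : x ≠ y := fun h' => h (by rw [h'])
  have h1 : |x - y| ≠ 0 := abs_ne_zero.2 (sub_ne_zero.2 hxy)
  have h2 : |x ^ θ - y ^ θ| ≠ 0 := abs_ne_zero.2 (sub_ne_zero.2 h)
  rw [realInteraction, log_tilted hx, log_tilted hy, chord, Real.log_div (by positivity)
    (by positivity), Real.log_mul h1 h2, Real.log_mul (by positivity) (by positivity),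
    Real.log_pow, Real.log_pow, Real.log_inv, Real.log_inv]
  push_cast
  ring

lemma log_max_le_zero {θ : ℕ} (hθ : 1 ≤ θ) (x y : ℝ) (k : ℕ) :
    Real.log (max (chord θ x y) (Real.exp (-k))) ≤ 0 :=
  Real.log_nonpos (le_max_of_le_left (chord_nonneg θ x y)) (max_le (chord_le_one hθ x y)
    (Real.exp_le_one_iff.2 (by simp)))

lemma neg_le_log_max (θ : ℕ) (x y : ℝ) (k : ℕ) :
    -(k : ℝ) ≤ Real.log (max (chord θ x y) (Real.exp (-k))) := by
  rw [Real.le_log_iff_exp_le (lt_max_of_lt_right (Real.exp_pos _))]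
  exact le_max_right _ _

lemma log_shift_le {u B : ℝ} (hu : 0 ≤ u) (hB : u ≤ B) (k : ℕ) :
    Real.log (u + 1 / ((k : ℝ) + 1)) ≤ Real.log (B + 1) := by
  have : 1 / ((k : ℝ) + 1) ≤ 1 := by
    rw [div_le_one (by positivity)]; simp
  exact Real.log_le_log (by positivity) (by linarith)

lemma le_log_shift {u : ℝ} (hu : 0 ≤ u) (k : ℕ) :
    -Real.log ((k : ℝ) + 1) ≤ Real.log (u + 1 / ((k : ℝ) + 1)) := by
  rw [← Real.log_inv, inv_eq_one_div]
  exact Real.log_le_log (by positivity) (by linarith)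

section

variable {S : Set ℝ} {θ : ℕ} {κ : ℝ} {w : ℝ → ℝ} {B : ℝ}

/-- The bound does not depend on k; this uniformity is what monotone convergence requires. -/
lemma neg_le_kernel (hθ : 1 ≤ θ) (hκ : 0 < κ) {x y : ℝ} (hx : 0 ≤ w x) (hy : 0 ≤ w y)
    (hBx : tilted θ κ w x ≤ B) (hBy : tilted θ κ w y ≤ B) (k : ℕ) :
    -(κ * Real.log (B + 1)) ≤ kernel θ κ w k x y := by
  have h1 := log_max_le_zero hθ x y k
  have h2 := log_shift_le (tilted_nonneg hx) hBx k
  have h3 := log_shift_le (tilted_nonneg hy) hBy k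
  have h4 : 0 ≤ κ ^ 2 / 2 * -Real.log (max (chord θ x y) (Real.exp (-k))) :=
    mul_nonneg (by positivity) (by linarith)
  have h5 : κ / 2 * (Real.log (tilted θ κ w x + 1 / ((k : ℝ) + 1))
      + Real.log (tilted θ κ w y + 1 / ((k : ℝ) + 1))) ≤ κ / 2 * (2 * Real.log (B + 1)) := by
    gcongr; linarith
  rw [kernel]
  linarith

/-- This bound does depend on k; it serves only to make each truncated kernel bounded, so that its
integral is weakly continuous. -/
lemma kernel_le (hκ : 0 < κ) {x y : ℝ} (hx : 0 ≤ w x) (hy : 0 ≤ w y) (k : ℕ) :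
    kernel θ κ w k x y ≤ κ ^ 2 / 2 * k + κ * Real.log ((k : ℝ) + 1) := by
  have h1 := neg_le_log_max θ x y k
  have h2 := le_log_shift (tilted_nonneg (θ := θ) (κ := κ) hx) k
  have h3 := le_log_shift (tilted_nonneg (θ := θ) (κ := κ) hy) k
  have h4 : κ ^ 2 / 2 * -Real.log (max (chord θ x y) (Real.exp (-k))) ≤ κ ^ 2 / 2 * k := by
    gcongr; linarith
  have h5 : κ / 2 * -(2 * Real.log ((k : ℝ) + 1)) ≤ κ / 2 * (Real.log (tilted θ κ w x + 1 / ((k : ℝ) + 1))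
      + Real.log (tilted θ κ w y + 1 / ((k : ℝ) + 1))) := by
    gcongr; linarith
  rw [kernel]
  linarith

lemma kernel_mono (hκ : 0 < κ) {x y : ℝ} (hx : 0 ≤ w x) (hy : 0 ≤ w y) :
    Monotone fun k => kernel θ κ w k x y := by
  intro k l hkl
  have hkl' : (k : ℝ) ≤ l := by exact_mod_cast hkl
  have ux := tilted_nonneg (θ := θ) (κ := κ) hx
  have uy := tilted_nonneg (θ := θ) (κ := κ) hy
  simp only [kernel]
  gcongr

lemma tendsto_kernel (hθ : 1 ≤ θ) (hκ : 0 < κ) {x y : ℝ} (hx : 0 ≤ w x) (hy : 0 ≤ w y)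
    (hBx : tilted θ κ w x ≤ B) (hBy : tilted θ κ w y ≤ B) :
    Tendsto (fun k => (kernel θ κ w k x y : EReal)) atTop (𝓝 (interaction θ κ w x y)) := by
  have ux := tilted_nonneg (θ := θ) (κ := κ) hx
  have uy := tilted_nonneg (θ := θ) (κ := κ) hy
  have hinv : Tendsto (fun k : ℕ => 1 / ((k : ℝ) + 1)) atTop (𝓝 0) :=
    tendsto_one_div_add_atTop_nhds_zero_nat
  have hlogtop : Tendsto (fun k : ℕ => Real.log ((k : ℝ) + 1)) atTop atTop :=
    Real.tendsto_log_atTop.comp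
      (tendsto_atTop_add_const_right _ _ tendsto_natCast_atTop_atTop)
  rw [interaction]
  split_ifs with h
  · rw [EReal.tendsto_coe_nhds_top_iff]
    rcases h with h | h | h
    · refine tendsto_atTop_mono (f := fun k : ℕ => κ ^ 2 / 2 * (k : ℝ) - κ * Real.log (B + 1)) ?_ ?_
      · intro k
        have h2 := log_shift_le ux hBx k
        have h3 := log_shift_le uy hBy k
        have h5 : κ / 2 * (Real.log (tilted θ κ w x + 1 / ((k : ℝ) + 1))
          + Real.log (tilted θ κ w y + 1 / ((k : ℝ) + 1))) ≤ κ / 2 * (2 * Real.log (B + 1)) := by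
          gcongr; linarith
        rw [kernel, chord_eq_zero_iff.2 h, max_eq_right (Real.exp_pos _).le, Real.log_exp, neg_neg]
        linarith
      · exact tendsto_atTop_add_const_right _ _
          ((tendsto_natCast_atTop_atTop).const_mul_atTop (by positivity))
    -- At a zero of `w` the tilted weight vanishes, and its regularised logarithm is exactly -log (k
    -- + 1), which supplies the divergence.
    · refine tendsto_atTop_mono
        (f := fun k : ℕ => κ / 2 * Real.log ((k : ℝ) + 1) - κ / 2 * Real.log (B + 1)) ?_ ?_
      · intro k
        have h1 := log_max_le_zero hθ x y k
        have h3 := log_shift_le uy hBy k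
        have h4 : 0 ≤ κ ^ 2 / 2 * -Real.log (max (chord θ x y) (Real.exp (-k))) :=
          mul_nonneg (by positivity) (by linarith)
        have h5 : κ / 2 * Real.log (tilted θ κ w y + 1 / ((k : ℝ) + 1))
          ≤ κ / 2 * Real.log (B + 1) := by gcongr
        have h6 : tilted θ κ w x = 0 := by rw [tilted, h, mul_zero]
        rw [kernel, h6, zero_add, one_div, Real.log_inv, ← one_div]
        linarith
      · exact tendsto_atTop_add_const_right _ _ (hlogtop.const_mul_atTop (by positivity))
    · refine tendsto_atTop_mono
        (f := fun k : ℕ => κ / 2 * Real.log ((k : ℝ) + 1) - κ / 2 * Real.log (B + 1)) ?_ ?_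
      · intro k
        have h1 := log_max_le_zero hθ x y k
        have h3 := log_shift_le ux hBx k
        have h4 : 0 ≤ κ ^ 2 / 2 * -Real.log (max (chord θ x y) (Real.exp (-k))) :=
          mul_nonneg (by positivity) (by linarith)
        have h5 : κ / 2 * Real.log (tilted θ κ w x + 1 / ((k : ℝ) + 1))
          ≤ κ / 2 * Real.log (B + 1) := by gcongr
        have h6 : tilted θ κ w y = 0 := by rw [tilted, h, mul_zero]
        rw [kernel, h6, zero_add, one_div ((k : ℝ) + 1), Real.log_inv, ← one_div]
        linarith
      · exact tendsto_atTop_add_const_right _ _ (hlogtop.const_mul_atTop (by positivity))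
  · push Not at h
    have hx' := lt_of_le_of_ne hx h.2.1.symm
    have hy' := lt_of_le_of_ne hy h.2.2.symm
    rw [EReal.tendsto_coe]
    have := realInteraction_eq (κ := κ) h.1 hx' hy'
    rw [realInteraction] at this
    rw [this]
    have hc : 0 < chord θ x y := lt_of_le_of_ne (chord_nonneg θ x y)
      fun h' => h.1 (chord_eq_zero_iff.1 h'.symm)
    unfold kernel
    have hexp : Tendsto (fun k : ℕ => Real.exp (-(k : ℝ))) atTop (𝓝 0) :=
      Real.tendsto_exp_neg_atTop_nhds_zero.comp tendsto_natCast_atTop_atTop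
    have hmax : Tendsto (fun k : ℕ => Real.log (max (chord θ x y) (Real.exp (-(k : ℝ))))) atTop
        (𝓝 (Real.log (chord θ x y))) := by
      have := (tendsto_const_nhds (x := chord θ x y)).max hexp
      rw [max_eq_left hc.le] at this
      exact this.log hc.ne'
    have hl : ∀ t, 0 < t → Tendsto (fun k : ℕ => Real.log (t + 1 / ((k : ℝ) + 1))) atTop
        (𝓝 (Real.log t)) := fun t ht => by
      have := (tendsto_const_nhds (x := t)).add hinv
      rw [add_zero] at this
      exact this.log ht.ne'
    exact (hmax.neg.const_mul _).sub
      (((hl _ (tilted_pos hx')).add (hl _ (tilted_pos hy'))).const_mul _)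

lemma continuous_kernel (hc : ContinuousOn w S) (hw : ∀ x ∈ S, 0 ≤ w x) (k : ℕ) :
    Continuous fun z : S × S => kernel θ κ w k z.1 z.2 := by
  have hu : Continuous fun x : S => tilted θ κ w x := (continuousOn_tilted hc).domRestrict
  have hch : Continuous fun z : S × S => chord θ z.1 z.2 :=
    (continuous_chord θ).comp
      ((continuous_subtype_val.comp continuous_fst).prodMk (continuous_subtype_val.comp continuous_snd))
  have hlog : Continuous fun x : S => Real.log (tilted θ κ w x + 1 / ((k : ℝ) + 1)) :=
    (hu.add continuous_const).log fun x => by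
      have := tilted_nonneg (θ := θ) (κ := κ) (hw x x.2)
      exact (add_pos_of_nonneg_of_pos this (by positivity)).ne'
  unfold kernel
  refine Continuous.sub (continuous_const.mul (Continuous.neg ?_)) (continuous_const.mul
    ((hlog.comp continuous_fst).add (hlog.comp continuous_snd)))
  exact (hch.max continuous_const).log fun z => (lt_max_of_lt_right (Real.exp_pos _)).ne'

/-- The energy with respect to the truncated kernels. -/
def truncEnergy (S : Set ℝ) (θ : ℕ) (κ : ℝ) (w : ℝ → ℝ) (k : ℕ) (μ : ProbabilityMeasure S) : ℝ :=
  ∫ z : S × S, kernel θ κ w k z.1 z.2 ∂((μ : Measure S).prod (μ : Measure S))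

lemma abs_kernel_le (hθ : 1 ≤ θ) (hκ : 0 < κ) {x y : ℝ} (hx : 0 ≤ w x) (hy : 0 ≤ w y)
    (hBx : tilted θ κ w x ≤ B) (hBy : tilted θ κ w y ≤ B) (k : ℕ) :
    |kernel θ κ w k x y| ≤ κ ^ 2 / 2 * k + κ * Real.log ((k : ℝ) + 1) + κ * Real.log (B + 1) := by
  have h1 := neg_le_kernel hθ hκ hx hy hBx hBy k
  have h2 := kernel_le (θ := θ) hκ hx hy k
  have h3 : 0 ≤ Real.log (B + 1) := Real.log_nonneg (by
    linarith [tilted_nonneg (θ := θ) (κ := κ) hx])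
  have h4 : 0 ≤ Real.log ((k : ℝ) + 1) := Real.log_nonneg (by simp)
  have h5 : 0 ≤ κ * Real.log (B + 1) := by positivity
  have h6 : 0 ≤ κ ^ 2 / 2 * k + κ * Real.log ((k : ℝ) + 1) := by positivity
  rw [abs_le]
  constructor <;> linarith

/-- The kernel is bounded and continuous on S × S, and μ ↦ μ ⊗ μ is weakly continuous. -/
lemma continuous_truncEnergy (hθ : 1 ≤ θ) (hκ : 0 < κ) (hc : ContinuousOn w S)
    (hw : ∀ x ∈ S, 0 ≤ w x) (hB : ∀ x ∈ S, tilted θ κ w x ≤ B) (k : ℕ) :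
    Continuous (truncEnergy S θ κ w k) := by
  let f : BoundedContinuousFunction (S × S) ℝ := BoundedContinuousFunction.ofNormedAddCommGroup
    (fun z => kernel θ κ w k z.1 z.2) (continuous_kernel hc hw k) _ fun z => by
      rw [Real.norm_eq_abs]
      exact abs_kernel_le hθ hκ (hw _ z.1.2) (hw _ z.2.2) (hB _ z.1.2) (hB _ z.2.2) k
  have h1 := ProbabilityMeasure.continuous_integral_boundedContinuousFunction f
  have h2 : Continuous fun μ : ProbabilityMeasure S => μ.prod μ :=
    ProbabilityMeasure.continuous_prod.comp (continuous_id.prodMk continuous_id)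
  exact h1.comp h2

lemma integrable_kernel (hθ : 1 ≤ θ) (hκ : 0 < κ) (hc : ContinuousOn w S)
    (hw : ∀ x ∈ S, 0 ≤ w x) (hB : ∀ x ∈ S, tilted θ κ w x ≤ B) (k : ℕ) (π : Measure (S × S))
    [IsFiniteMeasure π] : Integrable (fun z : S × S => kernel θ κ w k z.1 z.2) π := by
  refine Integrable.of_bound (continuous_kernel hc hw k).aestronglyMeasurable
    (κ ^ 2 / 2 * k + κ * Real.log ((k : ℝ) + 1) + κ * Real.log (B + 1)) (ae_of_all _ fun z => ?_)
  rw [Real.norm_eq_abs]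
  exact abs_kernel_le hθ hκ (hw _ z.1.2) (hw _ z.2.2) (hB _ z.1.2) (hB _ z.2.2) k

lemma tendsto_truncEnergy (hθ : 1 ≤ θ) (hκ : 0 < κ) (hc : ContinuousOn w S)
    (hw : ∀ x ∈ S, 0 ≤ w x) (hB : ∀ x ∈ S, tilted θ κ w x ≤ B) (μ : ProbabilityMeasure S) :
    Tendsto (fun k => (truncEnergy S θ κ w k μ : EReal)) atTop (𝓝 (energy S θ κ w μ)) := by
  exact tendsto_integral_eintegral ((μ : Measure S).prod (μ : Measure S))
    (K := fun k z => kernel θ κ w k z.1 z.2) (f := fun z => interaction θ κ w z.1 z.2)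
    (c := κ * Real.log (B + 1)) (fun k => (continuous_kernel hc hw k).measurable)
    (fun k => integrable_kernel hθ hκ hc hw hB k _)
    (fun z => kernel_mono hκ (hw _ z.1.2) (hw _ z.2.2))
    (fun k z => neg_le_kernel hθ hκ (hw _ z.1.2) (hw _ z.2.2) (hB _ z.1.2) (hB _ z.2.2) k)
    (fun z => tendsto_kernel hθ hκ (hw _ z.1.2) (hw _ z.2.2) (hB _ z.1.2) (hB _ z.2.2))

lemma truncEnergy_mono (hθ : 1 ≤ θ) (hκ : 0 < κ) (hc : ContinuousOn w S)
    (hw : ∀ x ∈ S, 0 ≤ w x) (hB : ∀ x ∈ S, tilted θ κ w x ≤ B) (μ : ProbabilityMeasure S) :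
    Monotone fun k => truncEnergy S θ κ w k μ := fun k l hkl =>
  integral_mono (integrable_kernel hθ hκ hc hw hB k _) (integrable_kernel hθ hκ hc hw hB l _)
    fun z => kernel_mono hκ (hw _ z.1.2) (hw _ z.2.2) hkl

/-- The energy is the supremum of the truncated energies, so its sublevel sets are intersections of
weakly closed sets. This plays the role of lower semicontinuity. -/
lemma energy_le_iff (hθ : 1 ≤ θ) (hκ : 0 < κ) (hc : ContinuousOn w S)
    (hw : ∀ x ∈ S, 0 ≤ w x) (hB : ∀ x ∈ S, tilted θ κ w x ≤ B) {μ : ProbabilityMeasure S} {a : ℝ} :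
    energy S θ κ w μ ≤ a ↔ ∀ k, truncEnergy S θ κ w k μ ≤ a := by
  have ht := tendsto_truncEnergy hθ hκ hc hw hB μ
  refine ⟨fun h k => ?_, fun h => le_of_tendsto' ht fun k => by exact_mod_cast h k⟩
  have hm : Monotone fun k => (truncEnergy S θ κ w k μ : EReal) := fun k l hkl =>
    EReal.coe_le_coe_iff.2 (truncEnergy_mono hθ hκ hc hw hB μ hkl)
  exact_mod_cast (hm.ge_of_tendsto ht k).trans h

lemma neg_le_energy (hθ : 1 ≤ θ) (hκ : 0 < κ) (hc : ContinuousOn w S)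
    (hw : ∀ x ∈ S, 0 ≤ w x) (hB : ∀ x ∈ S, tilted θ κ w x ≤ B) (μ : ProbabilityMeasure S) :
    ((-(κ * Real.log (B + 1)) : ℝ) : EReal) ≤ energy S θ κ w μ := by
  refine ge_of_tendsto' (tendsto_truncEnergy hθ hκ hc hw hB μ) fun k => ?_
  rw [EReal.coe_le_coe_iff]
  have := integral_mono (integrable_const (-(κ * Real.log (B + 1))))
    (integrable_kernel hθ hκ hc hw hB k ((μ : Measure S).prod (μ : Measure S)))
    fun z => neg_le_kernel hθ hκ (hw _ z.1.2) (hw _ z.2.2) (hB _ z.1.2) (hB _ z.2.2) k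
  rw [truncEnergy]
  simpa using this

end

end Biorthogonal
end

/-! ### Admissible weights, tightness from bounded energy, and the pointwise density bound. -/

noncomputable section
namespace Biorthogonal

/-- Weights `W n` (the `n`-th powers of the varying weights, up to lower order factors) which are
asymptotically governed by the limiting weight `w` in the way needed for large deviations. -/
structure AdmissibleWeights (S : Set ℝ) (θ : ℕ) (κ : ℝ) (p : ℕ → ℕ) (W : ℕ → ℝ → ℝ)
    (w : ℝ → ℝ) : Prop where
  continuousOn : ContinuousOn w S
  nonneg : ∀ x ∈ S, 0 ≤ w x
  vanishing : ∀ δ : ℝ, 0 < δ → ∃ R : ℝ, ∀ x ∈ S, R < |x| → tilted θ κ w x ≤ δ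
  weight_nonneg : ∀ n, ∀ x ∈ S, 0 ≤ W n x
  -- The surplus exponent 2 leaves a factor (1 + |x|) ^ (-2) per particle, which makes the
  -- dominating function integrable.
  upper : ∀ δ : ℝ, 0 < δ → ∀ᶠ n : ℕ in atTop, ∀ x ∈ S,
    (1 + |x|) ^ ((θ + 1) * (p n - 1) + 2) * W n x ≤ (tilted θ κ w x + δ) ^ n
  -- `F` may be larger than the zero set of `w`: in the boson model `w` never vanishes, but the
  -- factor x ^ α may vanish at 0.
  lower : ∃ F : Set ℝ, F.Finite ∧ (∀ x ∈ S \ F, 0 < w x) ∧ ∀ K ⊆ S \ F, IsCompact K →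
    ∀ δ : ℝ, 0 < δ → ∀ᶠ n : ℕ in atTop, ∀ x ∈ K, (w x * Real.exp (-δ)) ^ n ≤ W n x

section

variable {S : Set ℝ} {θ : ℕ} {κ : ℝ} {w : ℝ → ℝ} {B : ℝ}

lemma exists_tilted_le (hS : IsClosed S) (hc : ContinuousOn w S)
    (hv : ∀ δ : ℝ, 0 < δ → ∃ R : ℝ, ∀ x ∈ S, R < |x| → tilted θ κ w x ≤ δ) :
    ∃ B : ℝ, 0 < B ∧ ∀ x ∈ S, tilted θ κ w x ≤ B := by
  obtain ⟨R, hR⟩ := hv 1 one_pos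
  have hK : IsCompact (S ∩ Metric.closedBall 0 R) := (isCompact_closedBall 0 R).inter_left hS
  obtain ⟨C, hC⟩ := hK.bddAbove_image
    ((continuousOn_tilted (θ := θ) (κ := κ) hc).mono Set.inter_subset_left)
  refine ⟨max C 1, by positivity, fun x hx => ?_⟩
  by_cases h : R < |x|
  · exact (hR x hx h).trans (le_max_right _ _)
  · refine (hC ⟨x, ⟨hx, ?_⟩, rfl⟩).trans (le_max_left _ _)
    simpa using h

lemma isCompact_abs_le (hS : IsClosed S) (R : ℝ) : IsCompact {x : S | |(x : ℝ)| ≤ R} := by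
  have := hS.isClosedEmbedding_subtypeVal.isCompact_preimage (isCompact_closedBall (0 : ℝ) R)
  convert this using 1
  ext x; simp

/-- If |x| > R, the tilted weight at x is so small that kernel + b is at least G for every y. As
kernel + b is nonnegative with integral at most a + b, Markov's inequality bounds the mass of {|x| >
R}. -/
lemma exists_measureReal_abs_gt_le (hθ : 1 ≤ θ) (hκ : 0 < κ) (hc : ContinuousOn w S)
    (hw : ∀ x ∈ S, 0 ≤ w x) (hB : ∀ x ∈ S, tilted θ κ w x ≤ B)
    (hv : ∀ δ : ℝ, 0 < δ → ∃ R : ℝ, ∀ x ∈ S, R < |x| → tilted θ κ w x ≤ δ)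
    (a : ℝ) {ε : ℝ} (hε : 0 < ε) : ∃ (R : ℝ) (k₀ : ℕ), ∀ k ≥ k₀, ∀ μ : ProbabilityMeasure S,
      truncEnergy S θ κ w k μ ≤ a → (μ : Measure S).real {x | R < |(x : ℝ)|} ≤ ε := by
  set b := κ * Real.log (B + 1) with hb
  set G : ℝ := (|a + b| + 1) / ε with hG
  have hGpos : 0 < G := by positivity
  -- Chosen so that log (2 η) = log (B + 1) - 2 G / κ. The tilted weight and the regularisation
  -- 1/(k+1) are each made at most η, and the kernel at (x, y) is then at least G - b.
  set η : ℝ := Real.exp (Real.log (B + 1) - 2 * G / κ) / 2 with hη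
  have hηpos : 0 < η := by positivity
  obtain ⟨R, hR⟩ := hv η hηpos
  obtain ⟨k₀, hk₀⟩ := exists_nat_one_div_lt hηpos
  refine ⟨R, k₀, fun k hk μ hμ => ?_⟩
  have hkη : 1 / ((k : ℝ) + 1) ≤ η := by
    refine le_trans ?_ hk₀.le
    have : (k₀ : ℝ) ≤ k := by exact_mod_cast hk
    gcongr
  set π := (μ : Measure S).prod (μ : Measure S)
  have hint := integrable_kernel hθ hκ hc hw hB k π
  have hlow : ∀ z : S × S, 0 ≤ kernel θ κ w k z.1 z.2 + b := fun z => by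
    linarith [neg_le_kernel hθ hκ (hw _ z.1.2) (hw _ z.2.2) (hB _ z.1.2) (hB _ z.2.2) k]
  have hmarkov := mul_meas_ge_le_integral_of_nonneg (ae_of_all π hlow)
    (hint.add (integrable_const b)) G
  have hI : ∫ z, (kernel θ κ w k z.1 z.2 + b) ∂π ≤ a + b := by
    rw [integral_add hint (integrable_const b)]
    simpa [truncEnergy] using hμ
  have hsub : {x : S | R < |(x : ℝ)|} ×ˢ Set.univ ⊆ {z : S × S | G ≤ kernel θ κ w k z.1 z.2 + b} := by
    rintro ⟨x, y⟩ ⟨hx, -⟩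
    simp only [Set.mem_ofPred_eq] at hx ⊢
    have h1 := log_max_le_zero hθ x y k
    have h4 : 0 ≤ κ ^ 2 / 2 * -Real.log (max (chord θ x y) (Real.exp (-k))) :=
      mul_nonneg (by positivity) (by linarith)
    have ux := tilted_nonneg (θ := θ) (κ := κ) (hw x x.2)
    have h3 := log_shift_le (tilted_nonneg (hw y y.2)) (hB y y.2) k
    have h2 : Real.log (tilted θ κ w x + 1 / ((k : ℝ) + 1)) ≤ Real.log (B + 1) - 2 * G / κ := by
      rw [Real.log_le_iff_le_exp (add_pos_of_nonneg_of_pos ux (by positivity))]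
      have := hR x x.2 hx
      have h5 : Real.exp (Real.log (B + 1) - 2 * G / κ) = 2 * η := by rw [hη]; ring
      rw [h5]; linarith
    have h5 : κ / 2 * (Real.log (tilted θ κ w x + 1 / ((k : ℝ) + 1))
        + Real.log (tilted θ κ w y + 1 / ((k : ℝ) + 1)))
        ≤ κ / 2 * (2 * Real.log (B + 1) - 2 * G / κ) := by
      gcongr; linarith
    have h6 : κ / 2 * (2 * Real.log (B + 1) - 2 * G / κ) = b - G := by
      rw [hb]; field_simp
    rw [kernel]
    linarith
  have hπ : (μ : Measure S).real {x | R < |(x : ℝ)|}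
      ≤ π.real {z : S × S | G ≤ kernel θ κ w k z.1 z.2 + b} := by
    calc _ = π.real ({x : S | R < |(x : ℝ)|} ×ˢ Set.univ) := by
          simp [π, measureReal_prod_prod]
      _ ≤ _ := measureReal_mono hsub
  have h7 : G * (μ : Measure S).real {x | R < |(x : ℝ)|} ≤ a + b :=
    (mul_le_mul_of_nonneg_left hπ hGpos.le).trans (hmarkov.trans hI)
  have h8 : G * ε = |a + b| + 1 := by rw [hG]; field_simp
  by_contra hcon
  push Not at hcon
  have := mul_lt_mul_of_pos_left hcon hGpos
  linarith [le_abs_self (a + b)]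

/-- On a closed set on which the energy exceeds `a`, some truncated energy exceeds `a` by a
definite amount. -/
lemma exists_lt_truncEnergy (hS : IsClosed S) (hθ : 1 ≤ θ) (hκ : 0 < κ) (hc : ContinuousOn w S)
    (hw : ∀ x ∈ S, 0 ≤ w x) (hB : ∀ x ∈ S, tilted θ κ w x ≤ B)
    (hv : ∀ δ : ℝ, 0 < δ → ∃ R : ℝ, ∀ x ∈ S, R < |x| → tilted θ κ w x ≤ δ)
    {A : Set (ProbabilityMeasure S)} (hA : IsClosed A) {a : ℝ}
    (h : ∀ μ ∈ A, ¬ energy S θ κ w μ ≤ a) :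
    ∃ k : ℕ, ∀ μ ∈ A, a + 1 / ((k : ℝ) + 1) < truncEnergy S θ κ w k μ := by
  -- A sequence of violators has bounded truncated energies with growing truncation level, hence is
  -- tight. A cluster point then lies in A and has all truncated energies at most a, contradicting
  -- the hypothesis on A.
  by_contra! hcon
  choose μ hμA hμ using hcon
  have hle : ∀ k, truncEnergy S θ κ w k (μ k) ≤ a + 1 := fun k => by
    refine (hμ k).trans ?_
    have : 1 / ((k : ℝ) + 1) ≤ 1 := by rw [div_le_one (by positivity)]; simp
    linarith
  have htight : IsTightMeasureSet {((ν : ProbabilityMeasure S) : Measure S) | ν ∈ Set.range μ} := by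
    rw [isTightMeasureSet_iff_exists_isCompact_measure_compl_le]
    intro ε hε
    obtain ⟨e, he, heε⟩ : ∃ e : ℝ, 0 < e ∧ ENNReal.ofReal e ≤ ε := by
      by_cases h : ε = ⊤
      · exact ⟨1, one_pos, by simp [h]⟩
      · exact ⟨ε.toReal, ENNReal.toReal_pos hε.ne' h, by rw [ENNReal.ofReal_toReal h]⟩
    obtain ⟨R, k₀, hR⟩ := exists_measureReal_abs_gt_le hθ hκ hc hw hB hv (a + 1) he
    -- The uniform tail bound holds only for k ≥ k₀; the finitely many earlier measures are tight
    -- one by one.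
    have hsingle : ∀ k, ∃ r : ℝ, (μ k : Measure S).real {x | r < |(x : ℝ)|} ≤ e := by
      intro k
      have hanti : Antitone fun r : ℕ => {x : S | (r : ℝ) < |(x : ℝ)|} := fun r s hrs x hx =>
        (show (r : ℝ) ≤ s by exact_mod_cast hrs).trans_lt hx
      have hlim := tendsto_measure_iInter_atTop (μ := (μ k : Measure S))
        (s := fun r : ℕ => {x : S | (r : ℝ) < |(x : ℝ)|})
        (fun r => (measurableSet_lt measurable_const (by fun_prop)).nullMeasurableSet) hanti
        ⟨0, measure_ne_top _ _⟩
      have hempty : ⋂ r : ℕ, {x : S | (r : ℝ) < |(x : ℝ)|} = ∅ := by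
        rw [Set.eq_empty_iff_forall_notMem]
        intro x hx
        obtain ⟨r, hr⟩ := exists_nat_gt |(x : ℝ)|
        have := Set.mem_iInter.1 hx r
        exact absurd this (not_lt.2 hr.le)
      rw [hempty, measure_empty] at hlim
      have := (hlim.eventually (gt_mem_nhds (ENNReal.ofReal_pos.2 he))).exists
      obtain ⟨r, hr⟩ := this
      refine ⟨r, ?_⟩
      have h2 := ENNReal.toReal_mono (by simp) hr.le
      rwa [ENNReal.toReal_ofReal he.le] at h2
    choose r hr using hsingle
    obtain ⟨M, hM⟩ := ((Finset.range k₀).image r).exists_le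
    refine ⟨{x : S | |(x : ℝ)| ≤ max R M}, isCompact_abs_le hS _, ?_⟩
    rintro _ ⟨_, ⟨k, rfl⟩, rfl⟩
    refine le_trans ?_ heε
    rw [← ENNReal.ofReal_toReal (measure_ne_top (μ k : Measure S) _)]
    refine ENNReal.ofReal_le_ofReal ?_
    have hcompl : ∀ t ≤ max R M, {x : S | |(x : ℝ)| ≤ max R M}ᶜ ⊆ {x : S | t < |(x : ℝ)|} :=
      fun t ht x hx => lt_of_le_of_lt ht (not_le.1 hx)
    by_cases hk : k₀ ≤ k
    · exact (measureReal_mono (hcompl R (le_max_left _ _))).trans (hR k hk _ (hle k))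
    · refine (measureReal_mono (hcompl (r k) ?_)).trans (hr k)
      exact (hM _ (Finset.mem_image_of_mem _ (Finset.mem_range.2 (not_le.1 hk)))).trans
        (le_max_right _ _)
  have hcomp := isCompact_closure_of_isTightMeasureSet htight
  -- These sets decrease in j because truncated energies increase with the level while the margin
  -- 1/(j+1) decreases; by compactness they have a common point.
  let C : ℕ → Set (ProbabilityMeasure S) := fun j =>
    closure (Set.range μ) ∩ (A ∩ {ν | truncEnergy S θ κ w j ν ≤ a + 1 / ((j : ℝ) + 1)})
  have hclosed : ∀ j, IsClosed (A ∩ {ν | truncEnergy S θ κ w j ν ≤ a + 1 / ((j : ℝ) + 1)}) :=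
    fun j => hA.inter (isClosed_le (continuous_truncEnergy hθ hκ hc hw hB j) continuous_const)
  obtain ⟨ν, hν⟩ := IsCompact.nonempty_iInter_of_sequence_nonempty_isCompact_isClosed C
    (fun j ν hν => ⟨hν.1, hν.2.1, (truncEnergy_mono hθ hκ hc hw hB ν (Nat.le_succ j)).trans
      (hν.2.2.trans (by push_cast; gcongr; linarith))⟩)
    (fun j => ⟨μ j, subset_closure ⟨j, rfl⟩, hμA j, hμ j⟩)
    (hcomp.inter_right (hclosed 0)) (fun j => isClosed_closure.inter (hclosed j))
  rw [Set.mem_iInter] at hν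
  refine h ν (hν 0).2.1 ((energy_le_iff hθ hκ hc hw hB).2 fun i => ?_)
  have hlim : Tendsto (fun j : ℕ => a + 1 / ((j : ℝ) + 1)) atTop (𝓝 (a + 0)) :=
    tendsto_const_nhds.add tendsto_one_div_add_atTop_nhds_zero_nat
  rw [add_zero] at hlim
  refine ge_of_tendsto hlim ?_
  filter_upwards [eventually_ge_atTop i] with j hj
  exact (truncEnergy_mono hθ hκ hc hw hB ν hj).trans (hν j).2.2

/-! ### The density in terms of the truncated energy -/

lemma prod_Ioi_mul_eq {m : ℕ} (a : Fin m → ℝ) :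
    ∏ i, ∏ j ∈ Finset.Ioi i, a i * a j = ∏ i, a i ^ (m - 1) := by
  have := Finset.prod_prod_Ioi_mul_eq_prod_prod_off_diag fun _ i : Fin m => a i
  rw [this]
  refine Finset.prod_congr rfl fun i _ => ?_
  rw [Finset.prod_const, Finset.card_compl, Finset.card_singleton, Fintype.card_fin]

lemma sum_Ioi_eq {m : ℕ} (f : Fin m → Fin m → ℝ) (hf : ∀ i j, f i j = f j i) :
    ∑ i, ∑ j ∈ Finset.Ioi i, f i j = (∑ i, ∑ j, f i j - ∑ i, f i i) / 2 := by
  have h := Finset.sum_sum_Ioi_add_eq_sum_sum_off_diag fun j i : Fin m => f j i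
  have h1 : ∑ i, ∑ j ∈ Finset.Ioi i, (f j i + f i j) = 2 * ∑ i, ∑ j ∈ Finset.Ioi i, f i j := by
    simp_rw [Finset.mul_sum]
    refine Finset.sum_congr rfl fun i _ => Finset.sum_congr rfl fun j _ => ?_
    rw [hf j i]; ring
  have h2 : ∑ i, ∑ j ∈ ({i}ᶜ : Finset (Fin m)), f j i = ∑ i, ∑ j, f i j - ∑ i, f i i := by
    rw [← Finset.sum_sub_distrib]
    refine Finset.sum_congr rfl fun i _ => ?_
    rw [← Finset.sum_compl_add_sum {i} (fun j => f i j)]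
    simp only [Finset.sum_singleton, add_sub_cancel_right]
    exact Finset.sum_congr rfl fun j _ => hf j i
  rw [← h2, ← h, h1]; ring

/-- Each pair factor is replaced by its truncation from above, turning the density into the
exponential of a functional of the empirical measure, while the surplus exponent 2 is kept as an
integrable product. -/
lemma weightProduct_le {m n k : ℕ} {W : ℝ → ℝ} (hw : ∀ x ∈ S, 0 ≤ w x)
    (hW : ∀ x ∈ S, 0 ≤ W x)
    (hup : ∀ x ∈ S, (1 + |x|) ^ ((θ + 1) * (m - 1) + 2) * W x
      ≤ (tilted θ κ w x + 1 / ((k : ℝ) + 1)) ^ n) (x : Fin m → S) :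
    weightProduct θ m W (fun i => (x i : ℝ)) ≤ (∏ i, ((1 + |(x i : ℝ)|) ^ 2)⁻¹) *
      Real.exp ((∑ i, ∑ j, Real.log (max (chord θ (x i) (x j)) (Real.exp (-k))) + m * k) / 2
        + n * ∑ i, Real.log (tilted θ κ w (x i) + 1 / ((k : ℝ) + 1))) := by
  have hpair : ∏ i, ∏ j ∈ Finset.Ioi i, |(x i : ℝ) - x j| * |(x i : ℝ) ^ θ - (x j : ℝ) ^ θ|
      = (∏ i, ((1 + |(x i : ℝ)|) ^ (θ + 1)) ^ (m - 1))
        * ∏ i, ∏ j ∈ Finset.Ioi i, chord θ (x i) (x j) := by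
    rw [← prod_Ioi_mul_eq, ← Finset.prod_mul_distrib]
    refine Finset.prod_congr rfl fun i _ => ?_
    rw [← Finset.prod_mul_distrib]
    exact Finset.prod_congr rfl fun j _ => abs_sub_mul_abs_pow_sub _ _ _
  have hchord : ∏ i, ∏ j ∈ Finset.Ioi i, chord θ (x i) (x j) ≤
      Real.exp ((∑ i, ∑ j, Real.log (max (chord θ (x i) (x j)) (Real.exp (-k))) + m * k) / 2) := by
    -- Passing from pairs i < j to the full double sum adds the diagonal, where `chord` is 0 and the
    -- truncated logarithm is -k; the term m * k compensates for its m entries.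
    have h1 : ∑ i, ∑ j ∈ Finset.Ioi i, Real.log (max (chord θ (x i) (x j)) (Real.exp (-k)))
        = (∑ i, ∑ j, Real.log (max (chord θ (x i) (x j)) (Real.exp (-k))) + m * k) / 2 := by
      rw [sum_Ioi_eq _ fun i j => by rw [chord_comm]]
      simp [chord_self, (Real.exp_pos _).le]
    rw [← h1, Real.exp_sum]
    refine Finset.prod_le_prod (fun i _ => Finset.prod_nonneg fun j _ => chord_nonneg _ _ _)
      fun i _ => ?_
    rw [Real.exp_sum]
    refine Finset.prod_le_prod (fun j _ => chord_nonneg _ _ _) fun j _ => ?_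
    rw [Real.exp_log (lt_max_of_lt_right (Real.exp_pos _))]
    exact le_max_left _ _
  have hone : ∀ i, W (x i) * ((1 + |(x i : ℝ)|) ^ (θ + 1)) ^ (m - 1) ≤ ((1 + |(x i : ℝ)|) ^ 2)⁻¹ *
      Real.exp (n * Real.log (tilted θ κ w (x i) + 1 / ((k : ℝ) + 1))) := by
    intro i
    have hu : 0 < tilted θ κ w (x i) + 1 / ((k : ℝ) + 1) :=
      add_pos_of_nonneg_of_pos (tilted_nonneg (hw _ (x i).2)) (by positivity)
    rw [← Real.log_pow, Real.exp_log (by positivity), inv_mul_eq_div, le_div_iff₀ (by positivity)]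
    refine le_trans (le_of_eq ?_) (hup _ (x i).2)
    rw [← pow_mul, pow_add]; ring
  calc weightProduct θ m W (fun i => (x i : ℝ))
      = (∏ i, W (x i) * ((1 + |(x i : ℝ)|) ^ (θ + 1)) ^ (m - 1))
          * ∏ i, ∏ j ∈ Finset.Ioi i, chord θ (x i) (x j) := by
        rw [weightProduct, hpair, Finset.prod_mul_distrib, mul_assoc]
    _ ≤ (∏ i, ((1 + |(x i : ℝ)|) ^ 2)⁻¹ *
          Real.exp (n * Real.log (tilted θ κ w (x i) + 1 / ((k : ℝ) + 1)))) * _ := by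
        refine mul_le_mul ?_ hchord (Finset.prod_nonneg fun i _ => Finset.prod_nonneg fun j _ =>
          chord_nonneg _ _ _) (by positivity)
        exact Finset.prod_le_prod (fun i _ => mul_nonneg (hW _ (x i).2) (by positivity))
          fun i _ => hone i
    _ = _ := by
        rw [Finset.prod_mul_distrib, ← Real.exp_sum, mul_assoc, ← Real.exp_add, Finset.mul_sum,
          add_comm]

lemma integral_empirical {m : ℕ} [NeZero m] (x : Fin m → S) (f : S → ℝ) :
    ∫ y, f y ∂(empiricalMeasure x : Measure S) = (m : ℝ)⁻¹ * ∑ i, f (x i) := by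
  have : (empiricalMeasure x : Measure S) = (m : ℝ≥0∞)⁻¹ • ∑ j, Measure.dirac (x j) := rfl
  rw [this, integral_smul_measure, integral_finsetSum_measure]
  · simp
  · intro i _
    exact integrable_dirac (by simp)

lemma truncEnergy_empirical (hθ : 1 ≤ θ) (hκ : 0 < κ) (hc : ContinuousOn w S)
    (hw : ∀ x ∈ S, 0 ≤ w x) (hB : ∀ x ∈ S, tilted θ κ w x ≤ B) {m k : ℕ} [NeZero m]
    (x : Fin m → S) : truncEnergy S θ κ w k (empiricalMeasure x) =
      κ ^ 2 / 2 * -((m : ℝ)⁻¹ ^ 2 *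
        ∑ i, ∑ j, Real.log (max (chord θ (x i) (x j)) (Real.exp (-k))))
      - κ * ((m : ℝ)⁻¹ * ∑ i, Real.log (tilted θ κ w (x i) + 1 / ((k : ℝ) + 1))) := by
  have hm : (m : ℝ) ≠ 0 := by exact_mod_cast NeZero.ne m
  rw [truncEnergy, integral_prod _ (integrable_kernel hθ hκ hc hw hB k _)]
  simp only [integral_empirical]
  simp only [kernel, Finset.sum_sub_distrib, ← Finset.mul_sum, Finset.sum_add_distrib,
    Finset.sum_neg_distrib, Finset.sum_const, Finset.card_univ, Fintype.card_fin, nsmul_eq_mul]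
  generalize ∑ i, ∑ j, Real.log (max (chord θ (x i) (x j)) (Real.exp (-k))) = D
  generalize ∑ i, Real.log (tilted θ κ w (x i) + 1 / ((k : ℝ) + 1)) = L
  field_simp
  ring

lemma sigmaFinite_comap_coe (hS : MeasurableSet S) :
    SigmaFinite ((volume : Measure ℝ).comap ((↑) : S → ℝ)) := by
  refine SigmaFinite.of_map _ measurable_subtype_coe.aemeasurable ?_
  rw [(MeasurableEmbedding.subtype_coe hS).map_comap]
  infer_instance

/-- The integral factorises. A bound exponential in m suffices, since it is negligible on the scale
exp(n²). -/
lemma lintegral_prod_inv_le (hS : IsClosed S) : ∃ C : ℝ, 1 ≤ C ∧ ∀ m : ℕ,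
    ∫⁻ x : Fin m → S, ENNReal.ofReal (∏ i, ((1 + |(x i : ℝ)|) ^ 2)⁻¹) ∂(referenceMeasure S m)
      ≤ ENNReal.ofReal (C ^ m) := by
  have := sigmaFinite_comap_coe hS.measurableSet
  set l := (volume : Measure ℝ).comap ((↑) : S → ℝ)
  have hint : Integrable (fun x : S => ((1 + |(x : ℝ)|) ^ 2)⁻¹) l := by
    have h1 : Integrable (fun x : ℝ => ((1 + |x|) ^ 2)⁻¹) := by
      have := integrable_one_add_norm (E := ℝ) (μ := volume) (r := 2) (by simp)
      refine this.congr (ae_of_all _ fun x => ?_)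
      simp only [Real.norm_eq_abs]
      rw [Real.rpow_neg (by positivity)]
      norm_cast
    have h2 : Integrable (fun x : ℝ => ((1 + |x|) ^ 2)⁻¹) (l.map (↑)) := by
      rw [(MeasurableEmbedding.subtype_coe hS.measurableSet).map_comap]
      exact h1.restrict
    exact (integrable_map_measure h2.aestronglyMeasurable measurable_subtype_coe.aemeasurable).1 h2
  refine ⟨max 1 (∫ x : S, ((1 + |(x : ℝ)|) ^ 2)⁻¹ ∂l), le_max_left _ _, fun m => ?_⟩
  rw [referenceMeasure, ← ofReal_integral_eq_lintegral_ofReal]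
  · refine ENNReal.ofReal_le_ofReal ?_
    rw [integral_fintype_prod_eq_prod (𝕜 := ℝ) (fun (_ : Fin m) (y : S) => ((1 + |(y : ℝ)|) ^ 2)⁻¹)]
    rw [Finset.prod_const, Finset.card_univ, Fintype.card_fin]
    refine pow_le_pow_left₀ (integral_nonneg fun x => by positivity) (le_max_right _ _) _
  · exact Integrable.fintype_prod fun _ => hint
  · exact ae_of_all _ fun x => Finset.prod_nonneg fun i _ => by positivity

end

end Biorthogonal
end

/-! ### The large deviation upper bound for the unnormalised law. -/

noncomputable section
namespace Biorthogonal

section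

variable {S : Set ℝ} {θ : ℕ} {κ : ℝ} {w : ℝ → ℝ} {B : ℝ}

/-- The event {L_n ∈ A} is enlarged to a superlevel set of the truncated energy, so only this
functional has to be measurable, not the map to empirical measures. -/
lemma measurable_truncEnergy_empirical (hθ : 1 ≤ θ) (hκ : 0 < κ) (hc : ContinuousOn w S)
    (hw : ∀ x ∈ S, 0 ≤ w x) (hB : ∀ x ∈ S, tilted θ κ w x ≤ B) {m k : ℕ} [NeZero m] :
    Measurable fun x : Fin m → S => truncEnergy S θ κ w k (empiricalMeasure x) := by
  have h : (fun x : Fin m → S => truncEnergy S θ κ w k (empiricalMeasure x)) = fun x =>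
      (m : ℝ)⁻¹ * ∑ i, (m : ℝ)⁻¹ * ∑ j, kernel θ κ w k (x i) (x j) := by
    ext x
    rw [truncEnergy, integral_prod _ (integrable_kernel hθ hκ hc hw hB k _)]
    simp only [integral_empirical]
  rw [h]
  have hpair : ∀ i j : Fin m, Measurable fun x : Fin m → S => kernel θ κ w k (x i) (x j) :=
    fun i j => Measurable.comp (g := fun z : S × S => kernel θ κ w k z.1 z.2)
      (f := fun x : Fin m → S => (x i, x j)) (continuous_kernel hc hw k).measurable
      ((measurable_pi_apply i).prodMk (measurable_pi_apply j))
  generalize kernel θ κ w k = q at hpair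
  exact (Finset.measurable_fun_sum _ fun i _ =>
    (Finset.measurable_fun_sum _ fun j _ => hpair i j).const_mul _).const_mul _

/-- Here D is the double sum of truncated log-chords, L the sum of log-weights and I the truncated
energy. Normalising D by m² and L by m makes both bounded, so replacing m/n by κ costs only the
bracketed error. -/
lemma exponent_le {m n k : ℕ} (hm : m ≠ 0) (hn : n ≠ 0) {Λ D L I : ℝ}
    (hD : D ≤ 0) (hD' : -((m : ℝ) ^ 2 * k) ≤ D) (hL : |L| ≤ m * Λ)
    (hI : I = κ ^ 2 / 2 * -((m : ℝ)⁻¹ ^ 2 * D) - κ * ((m : ℝ)⁻¹ * L)) :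
    (D + m * k) / 2 + n * L ≤ (n : ℝ) ^ 2 * (-I + (k / 2 * |((m : ℝ) / n) ^ 2 - κ ^ 2|
      + Λ * |(m : ℝ) / n - κ| + (m : ℝ) / n * k / 2 * (1 / n))) := by
  have hm' : (0 : ℝ) < m := by positivity
  have hn' : (0 : ℝ) < n := by positivity
  set s := (m : ℝ)⁻¹ ^ 2 * D with hs
  set l := (m : ℝ)⁻¹ * L with hl
  set r := (m : ℝ) / n with hr
  have hmr : (m : ℝ) = r * n := by rw [hr]; field_simp
  have hDs : D = (r * n) ^ 2 * s := by rw [hs, ← hmr]; field_simp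
  have hLl : L = (r * n) * l := by rw [hl, ← hmr]; field_simp
  have hs0 : |s| ≤ k := by
    have : s ≤ 0 := mul_nonpos_of_nonneg_of_nonpos (by positivity) hD
    rw [abs_of_nonpos this, hs, inv_pow, inv_mul_eq_div, ← neg_div, div_le_iff₀ (by positivity)]
    linarith
  have hl0 : |l| ≤ Λ := by
    rw [hl, abs_mul, abs_of_pos (inv_pos.2 hm'), inv_mul_eq_div, div_le_iff₀ hm']
    linarith
  have e1 : s * (r ^ 2 - κ ^ 2) ≤ k * |r ^ 2 - κ ^ 2| :=
    (le_abs_self _).trans (by rw [abs_mul]; gcongr)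
  have e2 : l * (r - κ) ≤ Λ * |r - κ| :=
    (le_abs_self _).trans (by rw [abs_mul]; gcongr)
  have e3 : (D + m * k) / 2 + n * L = (n : ℝ) ^ 2 * (-I + (s * (r ^ 2 - κ ^ 2) / 2 + l * (r - κ)
      + r * k / 2 * (1 / n))) := by
    rw [hI, hDs, hLl, hmr]; field_simp; ring
  rw [e3]
  gcongr
  linarith

/-- The large deviation upper bound, before normalisation. -/
theorem AdmissibleWeights.eventually_unnormalizedLaw_le {p : ℕ → ℕ} [∀ n, NeZero (p n)]
    {W : ℕ → ℝ → ℝ} (h : AdmissibleWeights S θ κ p W w) (hS : IsClosed S) (hθ : 1 ≤ θ)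
    (hκ : 0 < κ) (hp : Tendsto (fun n : ℕ => (p n : ℝ) / n) atTop (𝓝 κ))
    {A : Set (ProbabilityMeasure S)} (hA : IsClosed A) {a : ℝ}
    (hAa : ∀ μ ∈ A, ¬ energy S θ κ w μ ≤ a) :
    ∃ a' > a, ∀ᶠ n : ℕ in atTop, unnormalizedLaw S θ (p n) (W n) {x | empiricalMeasure x ∈ A}
      ≤ ENNReal.ofReal (Real.exp (-((n : ℝ) ^ 2 * a'))) := by
  have hc := h.continuousOn
  have hw := h.nonneg
  obtain ⟨B, hBpos, hB⟩ := exists_tilted_le hS hc h.vanishing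
  obtain ⟨k, hk⟩ := exists_lt_truncEnergy hS hθ hκ hc hw hB h.vanishing hA hAa
  obtain ⟨C, hC1, hC⟩ := lintegral_prod_inv_le hS
  set g : ℝ := 1 / ((k : ℝ) + 1) with hg
  have hgpos : 0 < g := by positivity
  set Λ : ℝ := Real.log ((k : ℝ) + 1) + Real.log (B + 1) with hΛ
  -- Half of the margin g is kept; the other half absorbs the deviation of p n / n from κ, the
  -- diagonal terms and the constant C ^ p n.
  refine ⟨a + g / 2, by linarith, ?_⟩
  have hn0 : Tendsto (fun n : ℕ => 1 / (n : ℝ)) atTop (𝓝 0) := tendsto_one_div_atTop_nhds_zero_nat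
  have herr : Tendsto (fun n : ℕ => (k / 2 * |((p n : ℝ) / n) ^ 2 - κ ^ 2|
      + Λ * |(p n : ℝ) / n - κ| + (p n : ℝ) / n * k / 2 * (1 / n))
      + (p n : ℝ) / n * Real.log C * (1 / n)) atTop (𝓝 0) := by
    have t1 := ((hp.pow 2).sub_const (κ ^ 2)).abs.const_mul ((k : ℝ) / 2)
    have t2 := (hp.sub_const κ).abs.const_mul Λ
    have t3 := ((hp.mul_const (k : ℝ)).div_const 2).mul hn0
    have t4 := (hp.mul_const (Real.log C)).mul hn0
    have := ((t1.add t2).add t3).add t4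
    simpa using this
  filter_upwards [herr.eventually (gt_mem_nhds (half_pos hgpos)), h.upper g hgpos,
    eventually_ge_atTop 1] with n hn hup hn1
  have hm0 : p n ≠ 0 := NeZero.ne _
  have hnne : n ≠ 0 := by lia
  have hsub : {x : Fin (p n) → S | empiricalMeasure x ∈ A} ⊆
      {x | a + g < truncEnergy S θ κ w k (empiricalMeasure x)} := fun x hx => hk _ hx
  have hmeas : MeasurableSet {x : Fin (p n) → S | a + g < truncEnergy S θ κ w k (empiricalMeasure x)} :=
    measurableSet_lt measurable_const (measurable_truncEnergy_empirical hθ hκ hc hw hB)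
  refine (measure_mono hsub).trans ?_
  rw [unnormalizedLaw, withDensity_apply _ hmeas]
  set err := k / 2 * |((p n : ℝ) / n) ^ 2 - κ ^ 2|
      + Λ * |(p n : ℝ) / n - κ| + (p n : ℝ) / n * k / 2 * (1 / n) with herr'
  have hpoint : ∀ x ∈ {x : Fin (p n) → S | a + g < truncEnergy S θ κ w k (empiricalMeasure x)},
      ENNReal.ofReal (weightProduct θ (p n) (W n) fun i => (x i : ℝ)) ≤
        ENNReal.ofReal (∏ i, ((1 + |(x i : ℝ)|) ^ 2)⁻¹) *
          ENNReal.ofReal (Real.exp ((n : ℝ) ^ 2 * (-(a + g) + err))) := by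
    intro x hx
    rw [← ENNReal.ofReal_mul (Finset.prod_nonneg fun i _ => by positivity)]
    refine ENNReal.ofReal_le_ofReal ((weightProduct_le hw (h.weight_nonneg n) hup x).trans ?_)
    refine mul_le_mul_of_nonneg_left (Real.exp_le_exp.2 ?_)
      (Finset.prod_nonneg fun i _ => by positivity)
    have hlog : ∀ i, |Real.log (tilted θ κ w (x i) + 1 / ((k : ℝ) + 1))| ≤ Λ := fun i => by
      have h1 := log_shift_le (tilted_nonneg (hw _ (x i).2)) (hB _ (x i).2) k
      have h2 := le_log_shift (tilted_nonneg (θ := θ) (κ := κ) (hw _ (x i).2)) k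
      have h3 : 0 ≤ Real.log (B + 1) := Real.log_nonneg (by linarith)
      have h4 : 0 ≤ Real.log ((k : ℝ) + 1) := Real.log_nonneg (by simp)
      rw [abs_le]; constructor <;> linarith
    refine (exponent_le (κ := κ) hm0 hnne (Λ := Λ) ?_ ?_ ?_
      (truncEnergy_empirical hθ hκ hc hw hB x (k := k))).trans ?_
    · exact Finset.sum_nonpos fun i _ => Finset.sum_nonpos fun j _ => log_max_le_zero hθ _ _ _
    · have : ∑ i : Fin (p n), ∑ j : Fin (p n), -(k : ℝ) ≤
          ∑ i, ∑ j, Real.log (max (chord θ (x i) (x j)) (Real.exp (-k))) :=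
        Finset.sum_le_sum fun i _ => Finset.sum_le_sum fun j _ => neg_le_log_max _ _ _ _
      refine le_trans (le_of_eq ?_) this
      simp; ring
    · refine (Finset.abs_sum_le_sum_abs _ _).trans ((Finset.sum_le_sum fun i _ => hlog i).trans ?_)
      simp
    · have : a + g < truncEnergy S θ κ w k (empiricalMeasure x) := hx
      gcongr
  refine (setLIntegral_mono' hmeas hpoint).trans ?_
  refine (setLIntegral_le_lintegral _ _).trans ?_
  rw [lintegral_mul_const' _ _ (by simp)]
  refine (mul_le_mul_left (hC (p n)) _).trans ?_
  rw [← ENNReal.ofReal_mul (by positivity)]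
  refine ENNReal.ofReal_le_ofReal ?_
  have hClog : C ^ p n = Real.exp ((n : ℝ) ^ 2 * ((p n : ℝ) / n * Real.log C * (1 / n))) := by
    rw [← Real.rpow_natCast, Real.rpow_def_of_pos (by linarith)]
    congr 1; field_simp
  rw [hClog, ← Real.exp_add, ← mul_add]
  refine Real.exp_le_exp.2 ?_
  have hn2 : (0 : ℝ) < (n : ℝ) ^ 2 := by positivity
  rw [← mul_neg]
  refine mul_le_mul_of_nonneg_left ?_ hn2.le
  linarith

end

end Biorthogonal
end

noncomputable section
namespace Biorthogonal

/-! ### Averages of the logarithm over intervals -/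

/-- This quantity minus 1 is the integral of log |t| over [a, a + 1]. For a ≥ 0 it is nonnegative, a
≤ -1 follows by reflection, and when the interval straddles 0 the bound b log b ≥ b - 1 is applied
on both sides. -/
lemma neg_one_le_mul_log_sub (a : ℝ) :
    -1 ≤ (a + 1) * Real.log (a + 1) - a * Real.log a := by
  have key : ∀ b : ℝ, 0 ≤ b → 0 ≤ (b + 1) * Real.log (b + 1) - b * Real.log b := by
    intro b hb
    have h1 : 0 ≤ Real.log (b + 1) := Real.log_nonneg (by linarith)
    rcases hb.eq_or_lt with rfl | hb
    · simp
    · have h2 : Real.log b ≤ Real.log (b + 1) := Real.log_le_log hb (by linarith)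
      nlinarith
  rcases le_or_gt 0 a with h | h
  · linarith [key a h]
  rcases le_or_gt a (-1) with h' | h'
  · have := key (-a - 1) (by linarith)
    have e1 : Real.log (-a - 1) = Real.log (a + 1) := by rw [← Real.log_neg_eq_log]; ring_nf
    have e2 : Real.log (-a - 1 + 1) = Real.log a := by rw [← Real.log_neg_eq_log]; ring_nf
    rw [e1, e2] at this
    linarith
  · have h1 : ∀ b : ℝ, 0 < b → b - 1 ≤ b * Real.log b := fun b hb => by
      have := Real.one_sub_inv_le_log_of_pos hb
      have h2 := mul_le_mul_of_nonneg_left this hb.le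
      rwa [mul_sub, mul_one, mul_inv_cancel₀ hb.ne'] at h2
    have h2 := h1 (a + 1) (by linarith)
    have h3 := h1 (-a) (by linarith)
    rw [Real.log_neg_eq_log] at h3
    linarith

lemma intervalIntegrable_log_abs (a s : ℝ) (b c : ℝ) :
    IntervalIntegrable (fun v => Real.log |a + s * v|) volume b c := by
  simp only [Real.log_abs]
  rcases eq_or_ne s 0 with rfl | hs
  · simp
  · have := (intervalIntegral.intervalIntegrable_log' (a := a + s * b) (b := a + s * c))
    have h2 := (this.comp_add_left a).comp_mul_left (c := s)
    simpa [hs] using h2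

lemma integral_neg_log_add_le (a : ℝ) : ∫ v in (0 : ℝ)..1, -Real.log |a + v| ≤ 2 := by
  have h := intervalIntegral.integral_comp_add_left (a := 0) (b := 1) Real.log a
  simp only [Real.log_abs, intervalIntegral.integral_neg]
  rw [h, integral_log, add_zero]
  linarith [neg_one_le_mul_log_sub a]

/-- Factoring out t reduces to the unit scale; the sign s disappears under the absolute value. -/
lemma integral_neg_log_add_mul_le (c : ℝ) {t s : ℝ} (ht : 0 < t) (hs : |s| = 1) :
    ∫ v in (0 : ℝ)..1, -Real.log |c + t * s * v| ≤ -Real.log t + 2 := by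
  have hs2 : s * s = 1 := by rw [← abs_mul_abs_self, hs, one_mul]
  have h1 : ∀ v : ℝ, |s * c / t + v| ≠ 0 →
      -Real.log |c + t * s * v| = -Real.log t + -Real.log |s * c / t + v| := by
    intro v hv
    have : c + t * s * v = s * (t * (s * c / t + v)) := by
      field_simp; linear_combination -c * hs2
    rw [this, abs_mul, abs_mul, hs, one_mul, abs_of_pos ht, Real.log_mul ht.ne' hv]
    ring
  have h2 : ∫ v in (0 : ℝ)..1, -Real.log |c + t * s * v| =
      ∫ v in (0 : ℝ)..1, (-Real.log t + -Real.log |s * c / t + v|) := by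
    refine intervalIntegral.integral_congr_ae ?_
    have : ∀ᵐ v : ℝ, v ≠ -(s * c / t) := by
      simp [ae_iff, measure_singleton]
    filter_upwards [this] with v hv _
    refine h1 v (abs_ne_zero.2 fun h => hv (by linarith))
  rw [h2, intervalIntegral.integral_add (by simp)]
  · have := integral_neg_log_add_le (s * c / t)
    simp only [intervalIntegral.integral_const, sub_zero, one_smul]
    linarith
  · have := intervalIntegrable_log_abs (s * c / t) 1 0 1
    simp only [one_mul] at this
    exact this.neg

/-- Averaging the logarithmic kernel over a short interval raises it by a bounded amount,
which is small away from the singularity. -/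
lemma integral_neg_log_shift_le {z d t s r : ℝ} (hz : z ≠ 0) (ht : 0 < t) (hs : |s| = 1)
    (hd : |d| ≤ t) (htr : 4 * t ≤ r) :
    ∫ v in (0 : ℝ)..1, -Real.log |z + d + t * s * v| ≤
      -Real.log |z| + (if |z| < r then 2 + Real.log 4 else 4 * t / r) := by
  have hz' : 0 < |z| := abs_pos.2 hz
  have hlow : ∀ v ∈ Set.Icc (0 : ℝ) 1, |z| - 2 * t ≤ |z + d + t * s * v| := by
    intro v hv
    have h1 : |t * s * v| ≤ t := by
      rw [abs_mul, abs_mul, hs, abs_of_pos ht, abs_of_nonneg hv.1]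
      nlinarith [hv.2]
    have h2 : |z| ≤ |z + d + t * s * v| + |d| + |t * s * v| := by
      have e : z = (z + d + t * s * v) - d - t * s * v := by ring
      calc |z| = |(z + d + t * s * v) - d - t * s * v| := by rw [← e]
        _ ≤ _ := (abs_sub _ _).trans (by gcongr; exact abs_sub _ _)
    linarith
  have hint : IntervalIntegrable (fun v => -Real.log |z + d + t * s * v|) volume 0 1 :=
    (intervalIntegrable_log_abs _ _ _ _).neg
  have hbound : ∀ b : ℝ, (∀ v ∈ Set.Icc (0 : ℝ) 1, -Real.log |z + d + t * s * v| ≤ b) →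
      ∫ v in (0 : ℝ)..1, -Real.log |z + d + t * s * v| ≤ b := by
    intro b hb
    have := intervalIntegral.integral_mono_on zero_le_one hint (by simp) hb
    simpa using this
  have hlog4 : Real.log 2 ≤ 2 + Real.log 4 := by
    have := Real.log_le_log (by norm_num : (0 : ℝ) < 2) (by norm_num : (2 : ℝ) ≤ 4)
    linarith
  split_ifs with h
  -- If |z| ≥ 4 t, the shifted argument keeps modulus at least |z| / 2. Otherwise the averaged bound
  -- -log t + 2 applies, and log t > log |z| - log 4.
  · rcases le_or_gt (4 * t) |z| with h4 | h4
    · refine hbound _ fun v hv => ?_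
      have h1 := hlow v hv
      have h2 : Real.log (|z| / 2) ≤ Real.log |z + d + t * s * v| :=
        Real.log_le_log (by positivity) (by linarith)
      rw [Real.log_div hz'.ne' two_ne_zero] at h2
      linarith
    · refine (integral_neg_log_add_mul_le _ ht hs).trans ?_
      have h2 : Real.log (|z| / 4) ≤ Real.log t := Real.log_le_log (by positivity) (by linarith)
      rw [Real.log_div hz'.ne' (by norm_num)] at h2
      linarith
  · push Not at h
    have hr : 0 < r := by linarith
    refine hbound _ fun v hv => ?_
    have h1 := hlow v hv
    have h3 : 2 * t / r ≤ 1 / 2 := by rw [div_le_iff₀ hr]; linarith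
    have h5 : 2 * t ≤ |z| * (2 * t / r) := by
      rw [← mul_div_assoc, le_div_iff₀ hr]
      nlinarith
    have h2 : Real.log (|z| * (1 - 2 * t / r)) ≤ Real.log |z + d + t * s * v| :=
      Real.log_le_log (mul_pos hz' (by linarith)) (by linarith)
    rw [Real.log_mul hz'.ne' (by linarith)] at h2
    have h6 := Real.one_sub_inv_le_log_of_pos (by linarith : 0 < 1 - 2 * t / r)
    have h7 : (1 - 2 * t / r)⁻¹ ≤ 1 + 2 * (2 * t / r) := by
      rw [inv_le_iff_one_le_mul₀ (by linarith)]
      have : 0 ≤ 2 * t / r := by positivity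
      nlinarith
    have h8 : 4 * t / r = 2 * (2 * t / r) := by ring
    rw [h8]; linarith

/-! ### Logarithmic energy of measures with bounded density -/

/-- By translation invariance the inner integral is at most C times the integral of |log |t|| over
[-2R, 2R], uniformly in the outer variable. -/
lemma integrable_log_abs_sub_of_le {ν : Measure ℝ} [IsProbabilityMeasure ν] {C : ℝ≥0∞} (hC : C ≠ ⊤)
    (hν : ν ≤ C • volume) {R : ℝ} (hR : ∀ᵐ x ∂ν, |x| ≤ R) :
    Integrable (fun z : ℝ × ℝ => Real.log |z.1 - z.2|) (ν.prod ν) := by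
  have hR0 : 0 ≤ R := by
    obtain ⟨x, hx⟩ := hR.exists
    exact (abs_nonneg x).trans hx
  have hmeas : Measurable fun z : ℝ × ℝ => Real.log |z.1 - z.2| := by fun_prop
  refine ⟨hmeas.aestronglyMeasurable, ?_⟩
  set l : ℝ → ℝ≥0∞ := fun t => (Set.Icc (-(2 * R)) (2 * R)).indicator (fun t => ‖Real.log |t|‖ₑ) t with hl
  have hlm : Measurable l := Measurable.indicator (by fun_prop) measurableSet_Icc
  have hlfin : ∫⁻ t, l t < ⊤ := by
    rw [hl, lintegral_indicator measurableSet_Icc]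
    have h1 : IntervalIntegrable (fun t => Real.log |t|) volume (-(2 * R)) (2 * R) := by
      simp
    have h2 := (intervalIntegrable_iff_integrableOn_Icc_of_le (by linarith)).1 h1
    exact h2.2
  have hbound : ∀ x, ∫⁻ y, l (x - y) ∂ν ≤ C * ∫⁻ t, l t := by
    intro x
    calc ∫⁻ y, l (x - y) ∂ν ≤ ∫⁻ y, l (x - y) ∂(C • volume) := lintegral_mono' hν le_rfl
      _ = C * ∫⁻ y, l (x - y) := by rw [lintegral_smul_measure, smul_eq_mul]
      _ = _ := by rw [lintegral_sub_left_eq_self l x]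
  have hae : ∀ᵐ z ∂ν.prod ν, ‖Real.log |z.1 - z.2|‖ₑ = l (z.1 - z.2) := by
    have h1 : ∀ᵐ z ∂ν.prod ν, |z.1| ≤ R := Measure.quasiMeasurePreserving_fst.ae hR
    have h2 : ∀ᵐ z ∂ν.prod ν, |z.2| ≤ R := Measure.quasiMeasurePreserving_snd.ae hR
    filter_upwards [h1, h2] with z h1 h2
    rw [hl]
    simp only
    rw [Set.indicator_of_mem]
    rw [abs_le] at h1 h2
    constructor <;> linarith
  rw [HasFiniteIntegral, lintegral_congr_ae hae, lintegral_prod _ (by fun_prop)]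
  refine (lintegral_mono fun x => hbound x).trans_lt ?_
  rw [lintegral_const, measure_univ, mul_one]
  exact ENNReal.mul_lt_top hC.lt_top hlfin

/-! ### Smearing a measure along short intervals -/

/-- The displacement `(x, u) ↦ x + t σ(x) u`. -/
def displace (σ : ℝ → ℝ) (t : ℝ) (z : ℝ × ℝ) : ℝ := z.1 + t * σ z.1 * z.2

/-- The law of `x + t σ(x) u`, with `x` distributed according to `ν` and `u` uniform on `[0, 1]`. -/
def smear (ν : Measure ℝ) (σ : ℝ → ℝ) (t : ℝ) : Measure ℝ :=
  (ν.prod (volume.restrict (Set.Icc (0 : ℝ) 1))).map (displace σ t)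

lemma measurable_displace {σ : ℝ → ℝ} (hσ : Measurable σ) (t : ℝ) : Measurable (displace σ t) := by
  unfold displace; fun_prop

lemma ae_smear {ν : Measure ℝ} {σ : ℝ → ℝ} {t : ℝ} (hσ : Measurable σ) {q r : ℝ → Prop} (hr : MeasurableSet {x | r x}) (hq : ∀ᵐ x ∂ν, q x)
    (h : ∀ x, q x → ∀ u ∈ Set.Icc (0 : ℝ) 1, r (x + t * σ x * u)) : ∀ᵐ x ∂smear ν σ t, r x := by
  rw [smear, ae_map_iff (measurable_displace hσ t).aemeasurable hr]
  have h1 : ∀ᵐ z ∂ν.prod (volume.restrict (Set.Icc (0 : ℝ) 1)), q z.1 :=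
    Measure.quasiMeasurePreserving_fst.ae hq
  have h2 : ∀ᵐ z ∂ν.prod (volume.restrict (Set.Icc (0 : ℝ) 1)), z.2 ∈ Set.Icc (0 : ℝ) 1 :=
    Measure.quasiMeasurePreserving_snd.ae (ae_restrict_mem measurableSet_Icc)
  filter_upwards [h1, h2] with z h1 h2
  exact h z.1 h1 z.2 h2

section

variable {ν : Measure ℝ} [IsProbabilityMeasure ν] {σ : ℝ → ℝ} {t : ℝ}

instance isProbabilityMeasure_restrict_unit :
    IsProbabilityMeasure ((volume : Measure ℝ).restrict (Set.Icc (0 : ℝ) 1)) := ⟨by simp⟩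

lemma isProbabilityMeasure_smear (hσ : Measurable σ) : IsProbabilityMeasure (smear ν σ t) :=
  Measure.isProbabilityMeasure_map (measurable_displace hσ t).aemeasurable

/-- Given x, the displaced point is uniform on an interval of length t, so its density is at most
1/t. -/
lemma smear_le (hσ : Measurable σ) (hσ1 : ∀ x, |σ x| = 1) (ht : 0 < t) :
    smear ν σ t ≤ ENNReal.ofReal (1 / t) • volume := by
  refine Measure.le_iff.2 fun s hs => ?_
  rw [smear, Measure.map_apply (measurable_displace hσ t) hs,
    Measure.prod_apply (measurable_displace hσ t hs)]
  have : ∀ x, (volume.restrict (Set.Icc (0 : ℝ) 1)) (Prod.mk x ⁻¹' (displace σ t ⁻¹' s))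
      ≤ ENNReal.ofReal (1 / t) * volume s := by
    intro x
    refine (Measure.restrict_apply_le _ _).trans ?_
    have h0 : t * σ x ≠ 0 := mul_ne_zero ht.ne' fun h => by
      have := hσ1 x; rw [h] at this; simp at this
    have e : Prod.mk x ⁻¹' (displace σ t ⁻¹' s) = (fun u => t * σ x * u) ⁻¹' ((fun y => x + y) ⁻¹' s) := by
      ext u; simp [displace]
    rw [e, Real.volume_preimage_mul_left h0, measure_preimage_add]
    rw [abs_inv, abs_mul, hσ1, mul_one, abs_of_pos ht, one_div]
  calc _ ≤ ∫⁻ _, ENNReal.ofReal (1 / t) * volume s ∂ν := lintegral_mono this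
    _ = _ := by simp

lemma abs_displace_sub_le (hσ1 : ∀ x, |σ x| = 1) (ht : 0 ≤ t) {x u : ℝ} (hu : u ∈ Set.Icc (0 : ℝ) 1) :
    |t * σ x * u| ≤ t := by
  rw [abs_mul, abs_mul, hσ1, abs_of_nonneg ht, abs_of_nonneg hu.1, mul_one]
  exact mul_le_of_le_one_right ht hu.2

/-- Smearing raises the logarithmic energy by an arbitrarily small amount. -/
lemma exists_integral_neg_log_smear_le (hσ : Measurable σ) (hσ1 : ∀ x, |σ x| = 1) {R : ℝ}
    (hR : ∀ᵐ x ∂ν, |x| ≤ R) (hdiag : ∀ᵐ z ∂ν.prod ν, z.1 ≠ z.2)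
    (hint : Integrable (fun z : ℝ × ℝ => Real.log |z.1 - z.2|) (ν.prod ν)) {ε : ℝ} (hε : 0 < ε) :
    ∃ t₀ > 0, ∀ t, 0 < t → t ≤ t₀ →
      ∫ z, -Real.log |z.1 - z.2| ∂(smear ν σ t).prod (smear ν σ t) ≤
        ∫ z, -Real.log |z.1 - z.2| ∂ν.prod ν + ε := by
  set C₀ : ℝ := 2 + Real.log 4 with hC₀
  have hC₀pos : 0 < C₀ := by have := Real.log_nonneg (by norm_num : (1 : ℝ) ≤ 4); linarith
  -- The diagonal is null, so strips around it have small mass; only there does averaging cost the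
  -- fixed amount C₀ rather than 4 t / r.
  have hlim : Tendsto (fun n : ℕ => (ν.prod ν).real {z : ℝ × ℝ | |z.1 - z.2| < 1 / ((n : ℝ) + 1)})
      atTop (𝓝 0) := by
    have hanti : Antitone fun n : ℕ => {z : ℝ × ℝ | |z.1 - z.2| < 1 / ((n : ℝ) + 1)} :=
      fun n m hnm z hz => lt_of_lt_of_le (show |z.1 - z.2| < 1 / ((m : ℝ) + 1) from hz)
        (by have : (n : ℝ) ≤ m := by exact_mod_cast hnm
            gcongr)
    have h1 := tendsto_measure_iInter_atTop (μ := ν.prod ν)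
      (s := fun n : ℕ => {z : ℝ × ℝ | |z.1 - z.2| < 1 / ((n : ℝ) + 1)})
      (fun n => (measurableSet_lt (by fun_prop) measurable_const).nullMeasurableSet) hanti
      ⟨0, measure_ne_top _ _⟩
    have h2 : (ν.prod ν) (⋂ n : ℕ, {z : ℝ × ℝ | |z.1 - z.2| < 1 / ((n : ℝ) + 1)}) = 0 := by
      refine measure_mono_null (fun z hz => ?_) hdiag
      rw [Set.mem_iInter] at hz
      simp only [Set.mem_compl_iff, Set.mem_ofPred_eq, not_not]
      by_contra hne
      obtain ⟨n, hn⟩ := exists_nat_one_div_lt (abs_pos.2 (sub_ne_zero.2 hne))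
      exact absurd (hz n) (not_lt.2 hn.le)
    rw [h2] at h1
    exact (ENNReal.tendsto_toReal ENNReal.zero_ne_top).comp h1
  obtain ⟨n, hn⟩ := (hlim.eventually (gt_mem_nhds (by positivity : 0 < ε / (2 * C₀)))).exists
  set r : ℝ := 1 / ((n : ℝ) + 1) with hr
  have hrpos : 0 < r := by positivity
  refine ⟨min (r / 4) (r * ε / 8), by positivity, fun t ht htt => ?_⟩
  have ht4 : 4 * t ≤ r := by linarith [htt.trans (min_le_left _ _)]
  have hterr : 4 * t / r ≤ ε / 2 := by
    rw [div_le_iff₀ hrpos]; linarith [htt.trans (min_le_right _ _)]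
  set P := ν.prod (volume.restrict (Set.Icc (0 : ℝ) 1)) with hP
  have hT := measurable_displace hσ t
  have hprob := isProbabilityMeasure_smear (ν := ν) (t := t) hσ
  have hsR : ∀ᵐ x ∂smear ν σ t, |x| ≤ R + t :=
    ae_smear hσ (measurableSet_le (by fun_prop) measurable_const) hR fun x hx u hu =>
      (abs_add_le _ _).trans (add_le_add hx (abs_displace_sub_le hσ1 ht.le hu))
  have hsint := integrable_log_abs_sub_of_le (by simp) (smear_le (ν := ν) hσ hσ1 ht) hsR
  have hmap : (smear ν σ t).prod (smear ν σ t) = (P.prod P).map (Prod.map (displace σ t) (displace σ t)) := by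
    rw [smear, Measure.map_prod_map _ _ hT hT]
  have hTT : Measurable (Prod.map (displace σ t) (displace σ t)) := hT.prodMap hT
  have hlm : Measurable fun z : ℝ × ℝ => Real.log |z.1 - z.2| := by fun_prop
  rw [hmap] at hsint ⊢
  rw [integral_map hTT.aemeasurable (f := fun z : ℝ × ℝ => -Real.log |z.1 - z.2|)
    hlm.neg.aestronglyMeasurable]
  have hsint' := (integrable_map_measure hlm.aestronglyMeasurable hTT.aemeasurable).1 hsint
  set E : ℝ × ℝ → ℝ := fun z => if |z.1 - z.2| < r then C₀ else 4 * t / r with hE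
  have hEm : Measurable E := Measurable.ite (measurableSet_lt (by fun_prop) measurable_const)
    measurable_const measurable_const
  have hEint : Integrable E (ν.prod ν) := by
    refine Integrable.of_bound hEm.aestronglyMeasurable (C₀ + 4 * t / r) (ae_of_all _ fun z => ?_)
    have : 0 ≤ 4 * t / r := by positivity
    rw [hE, Real.norm_eq_abs]
    simp only
    split_ifs
    · rw [abs_of_pos hC₀pos]; linarith
    · rw [abs_of_nonneg this]; linarith
  -- the majorant `-log |x - y| + E` lives on the first coordinates
  set M : ℝ × ℝ → ℝ := fun z => -Real.log |z.1 - z.2| + E z with hM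
  have hMint : Integrable M (ν.prod ν) := hint.neg.add hEint
  have hMm : Measurable M := hlm.neg.add hEm
  have hfst : MeasurePreserving (Prod.fst : ℝ × ℝ → ℝ) P ν := measurePreserving_fst
  have hfst2 : MeasurePreserving (Prod.map Prod.fst Prod.fst : (ℝ × ℝ) × (ℝ × ℝ) → ℝ × ℝ)
      (P.prod P) (ν.prod ν) := hfst.prod hfst
  have hMint2 : Integrable (fun z : (ℝ × ℝ) × (ℝ × ℝ) => M (z.1.1, z.2.1)) (P.prod P) :=
    hfst2.integrable_comp_of_integrable hMint
  have hMeq : ∫ z : (ℝ × ℝ) × (ℝ × ℝ), M (z.1.1, z.2.1) ∂P.prod P = ∫ z, M z ∂ν.prod ν := by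
    rw [← hfst2.map_eq, integral_map hfst2.measurable.aemeasurable hMm.aestronglyMeasurable]
    rfl
  have hcomp : ∫ z : (ℝ × ℝ) × (ℝ × ℝ), -Real.log |displace σ t z.1 - displace σ t z.2| ∂P.prod P
      ≤ ∫ z : (ℝ × ℝ) × (ℝ × ℝ), M (z.1.1, z.2.1) ∂P.prod P := by
    have hi1 : Integrable (fun z : (ℝ × ℝ) × (ℝ × ℝ) =>
      -Real.log |displace σ t z.1 - displace σ t z.2|) (P.prod P) := hsint'.neg
    -- With the first displaced point and the base point y of the second fixed, it suffices to
    -- average over the displacement of y: the logarithm is compared with its value at z.1 - y, and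
    -- the displacement of z.1 enters as the bounded shift d.
    rw [integral_prod _ hi1, integral_prod _ hMint2]
    refine integral_mono_ae hi1.integral_prod_left hMint2.integral_prod_left ?_
    have hd1 : ∀ᵐ z ∂P, ∀ᵐ y ∂ν, z.1 ≠ y := by
      have := Measure.ae_ae_of_ae_prod hdiag
      exact Measure.quasiMeasurePreserving_fst.ae this
    have hu1 : ∀ᵐ z ∂P, z.2 ∈ Set.Icc (0 : ℝ) 1 :=
      Measure.quasiMeasurePreserving_snd.ae (ae_restrict_mem measurableSet_Icc)
    filter_upwards [hi1.prod_right_ae, hMint2.prod_right_ae, hd1, hu1] with z hz1 hz2 hz3 hz4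
    rw [integral_prod _ hz1, integral_prod _ hz2]
    refine integral_mono_ae hz1.integral_prod_left hz2.integral_prod_left ?_
    filter_upwards [hz3] with y hy
    simp only [integral_const, smul_eq_mul, probReal_univ, one_mul]
    have hne : z.1 - y ≠ 0 := sub_ne_zero.2 hy
    have hs : |-σ y| = 1 := by rw [abs_neg, hσ1]
    have := integral_neg_log_shift_le hne ht hs (abs_displace_sub_le hσ1 ht.le (x := z.1) hz4) ht4
    rw [intervalIntegral.integral_of_le zero_le_one, ← integral_Icc_eq_integral_Ioc] at this
    refine le_trans (le_of_eq ?_) this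
    refine integral_congr_ae (ae_of_all _ fun v => ?_)
    simp only [displace]
    congr 3
    ring
  refine hcomp.trans ?_
  have hsplit : ∫ z, M z ∂ν.prod ν = ∫ z, -Real.log |z.1 - z.2| ∂ν.prod ν + ∫ z, E z ∂ν.prod ν :=
    integral_add hint.neg hEint
  rw [hMeq, hsplit]
  refine add_le_add le_rfl ?_
  have hE2 : ∀ z, E z ≤ ({z : ℝ × ℝ | |z.1 - z.2| < r}).indicator (fun _ => C₀) z + ε / 2 := by
    intro z
    rw [hE]
    simp only [Set.indicator, Set.mem_ofPred_eq]
    split_ifs <;> linarith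
  have hsetm : MeasurableSet {z : ℝ × ℝ | |z.1 - z.2| < r} :=
    measurableSet_lt (by fun_prop) measurable_const
  have hI : Integrable (({z : ℝ × ℝ | |z.1 - z.2| < r}).indicator fun _ => C₀) (ν.prod ν) :=
    (integrable_const C₀).indicator hsetm
  calc ∫ z, E z ∂ν.prod ν ≤ ∫ z, (({z : ℝ × ℝ | |z.1 - z.2| < r}).indicator (fun _ => C₀) z + ε / 2)
        ∂ν.prod ν := integral_mono hEint (hI.add (integrable_const _)) hE2
    _ = (ν.prod ν).real {z : ℝ × ℝ | |z.1 - z.2| < r} * C₀ + ε / 2 := by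
        rw [integral_add hI (integrable_const _), integral_indicator hsetm]
        simp
    _ ≤ ε / (2 * C₀) * C₀ + ε / 2 := by gcongr
    _ = ε := by field_simp; ring

end

end Biorthogonal
end

noncomputable section
namespace Biorthogonal

/-! ### Jensen's lower bound for the partition function -/

lemma ofReal_integral_le_lintegral {α : Type*} [MeasurableSpace α] {μ : Measure α} {f : α → ℝ}
    (hf : Integrable f μ) : ENNReal.ofReal (∫ x, f x ∂μ) ≤ ∫⁻ x, ENNReal.ofReal (f x) ∂μ := by
  calc ENNReal.ofReal (∫ x, f x ∂μ) ≤ ENNReal.ofReal (∫ x, max (f x) 0 ∂μ) :=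
        ENNReal.ofReal_le_ofReal (integral_mono hf hf.pos_part fun x => le_max_left _ _)
    _ = ∫⁻ x, ENNReal.ofReal (max (f x) 0) ∂μ :=
        ofReal_integral_eq_lintegral_ofReal hf.pos_part (ae_of_all _ fun x => le_max_right _ _)
    _ = _ := by simp [ENNReal.ofReal_max]

/-- Jensen's inequality for the exponential function. -/
lemma ofReal_exp_integral_le {α : Type*} [MeasurableSpace α] {μ : Measure α} [IsProbabilityMeasure μ]
    {f : α → ℝ} (hf : Integrable f μ) :
    ENNReal.ofReal (Real.exp (∫ x, f x ∂μ)) ≤ ∫⁻ x, ENNReal.ofReal (Real.exp (f x)) ∂μ := by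
  set c := ∫ x, f x ∂μ with hc
  -- The tangent line to exp at the mean c lies below exp and has integral exactly exp c.
  have hint : Integrable (fun x => Real.exp c * (1 + (f x - c))) μ :=
    (((integrable_const 1).add (hf.sub (integrable_const c)))).const_mul _
  have h1 : ∫ x, Real.exp c * (1 + (f x - c)) ∂μ = Real.exp c := by
    have h2 : Integrable (fun x => f x - c) μ := hf.sub (integrable_const c)
    rw [integral_const_mul, integral_add (integrable_const 1) h2,
      integral_sub hf (integrable_const c), ← hc]
    simp
  rw [← h1]
  refine (ofReal_integral_le_lintegral hint).trans (lintegral_mono fun x => ?_)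
  refine ENNReal.ofReal_le_ofReal ?_
  have := Real.add_one_le_exp (f x - c)
  calc _ ≤ Real.exp c * Real.exp (f x - c) := by gcongr; linarith
    _ = _ := by rw [← Real.exp_add]; ring_nf

lemma pi_le_smul_pi {α : Type*} [MeasurableSpace α] {m : ℕ} {ν l : Measure α} [SigmaFinite ν]
    [SigmaFinite l] {C : ℝ≥0∞} (hC : C ≠ ⊤) (hC0 : C ≠ 0) (h : ν ≤ C • l) :
    Measure.pi (fun _ : Fin m => ν) ≤ C ^ m • Measure.pi (fun _ : Fin m => l) := by
  have hCm : C ^ m ≠ ⊤ := ENNReal.pow_ne_top hC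
  have hCm0 : C ^ m ≠ 0 := pow_ne_zero _ hC0
  -- `OuterMeasure.pi` is the largest outer measure bounded by the box volumes, so domination has to
  -- be checked on boxes only.
  have key : ((C ^ m)⁻¹ • Measure.pi (fun _ : Fin m => ν)).toOuterMeasure ≤
      OuterMeasure.pi fun _ : Fin m => l.toOuterMeasure := by
    rw [OuterMeasure.le_pi]
    intro s _
    change (C ^ m)⁻¹ * Measure.pi (fun _ : Fin m => ν) (Set.univ.pi s) ≤ ∏ i, l (s i)
    rw [Measure.pi_pi]
    have : ∏ i, ν (s i) ≤ C ^ m * ∏ i, l (s i) := by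
      calc ∏ i, ν (s i) ≤ ∏ i, C * l (s i) := Finset.prod_le_prod' fun i _ => h _
        _ = _ := by rw [Finset.prod_mul_distrib]; simp
    calc _ ≤ (C ^ m)⁻¹ * (C ^ m * ∏ i, l (s i)) := by gcongr
      _ = _ := by rw [← mul_assoc, ENNReal.inv_mul_cancel hCm0 hCm, one_mul]
  refine Measure.le_iff.2 fun s hs => ?_
  have h1 := key s
  change (C ^ m)⁻¹ * Measure.pi (fun _ : Fin m => ν) s ≤ _ at h1
  have h2 : Measure.pi (fun _ : Fin m => l) s = OuterMeasure.pi (fun _ => l.toOuterMeasure) s := by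
    rw [Measure.pi, toMeasure_apply _ _ hs]
  rw [Measure.smul_apply, h2, smul_eq_mul]
  calc _ = C ^ m * ((C ^ m)⁻¹ * Measure.pi (fun _ : Fin m => ν) s) := by
        rw [← mul_assoc, ENNReal.mul_inv_cancel hCm0 hCm, one_mul]
    _ ≤ _ := by gcongr

lemma measurePreserving_pair {α : Type*} [MeasurableSpace α] {m : ℕ} (ν : Measure α)
    [IsProbabilityMeasure ν] {i j : Fin m} (hij : i ≠ j) :
    MeasurePreserving (fun x : Fin m → α => (x i, x j)) (Measure.pi fun _ => ν) (ν.prod ν) := by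
  have h := (iIndepFun_pi (μ := fun _ : Fin m => ν) (X := fun _ => id)
    (fun _ => aemeasurable_id)).indepFun hij
  have h2 := (indepFun_iff_map_prod_eq_prod_map_map (measurable_pi_apply i).aemeasurable
    (measurable_pi_apply j).aemeasurable).1 h
  refine ⟨by fun_prop, ?_⟩
  refine h2.trans ?_
  congr 1
  · exact (measurePreserving_eval (fun _ : Fin m => ν) i).map_eq
  · exact (measurePreserving_eval (fun _ : Fin m => ν) j).map_eq

/-- The particles are taken independent with law ν. Domination of ν by C times Lebesgue measure
costs C ^ m, and Jensen moves the expectation into the exponent, where only the one- and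
two-particle marginals appear: m single terms and m (m - 1) / 2 pairs. -/
lemma ofReal_exp_le_partitionFunction {S : Set ℝ} (hS : MeasurableSet S) {θ m : ℕ} {W : ℝ → ℝ}
    {ν : Measure S}
    [IsProbabilityMeasure ν] {C : ℝ≥0∞} (hC : C ≠ ⊤) (hC0 : C ≠ 0)
    (hν : ν ≤ C • (volume : Measure ℝ).comap ((↑) : S → ℝ)) {g : S → ℝ} (hg : Integrable g ν)
    (hgW : ∀ᵐ x ∂ν, Real.exp (g x) ≤ W x)
    (hpair : ∀ᵐ z ∂ν.prod ν, (z.1 : ℝ) ^ θ ≠ (z.2 : ℝ) ^ θ)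
    (hℓ : Integrable (fun z : S × S => Real.log (|(z.1 : ℝ) - z.2| * |(z.1 : ℝ) ^ θ - (z.2 : ℝ) ^ θ|))
      (ν.prod ν)) :
    ENNReal.ofReal (Real.exp (m * ∫ x, g x ∂ν + (m * (m - 1) / 2 : ℝ) *
        ∫ z : S × S, Real.log (|(z.1 : ℝ) - z.2| * |(z.1 : ℝ) ^ θ - (z.2 : ℝ) ^ θ|) ∂ν.prod ν))
      ≤ C ^ m * partitionFunction S θ m W := by
  have := sigmaFinite_comap_coe hS
  set l := (volume : Measure ℝ).comap ((↑) : S → ℝ)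
  set ℓ : S × S → ℝ := fun z =>
    Real.log (|(z.1 : ℝ) - z.2| * |(z.1 : ℝ) ^ θ - (z.2 : ℝ) ^ θ|) with hℓdef
  set π := Measure.pi fun _ : Fin m => ν with hπ
  have hone : ∀ i : Fin m, MeasurePreserving (fun x : Fin m → S => x i) π ν :=
    fun i => measurePreserving_eval (fun _ : Fin m => ν) i
  have hgi : ∀ i : Fin m, Integrable (fun x : Fin m → S => g (x i)) π := fun i =>
    (hone i).integrable_comp_of_integrable hg
  have hgi' : ∀ i : Fin m, ∫ x : Fin m → S, g (x i) ∂π = ∫ x, g x ∂ν := fun i => by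
    rw [← (hone i).map_eq, integral_map (hone i).measurable.aemeasurable]
    rw [(hone i).map_eq]; exact hg.1
  have hli : ∀ i, ∀ j ∈ Finset.Ioi i, Integrable (fun x : Fin m → S => ℓ (x i, x j)) π :=
    fun i j hj => (measurePreserving_pair ν (Finset.mem_Ioi.1 hj).ne).integrable_comp_of_integrable hℓ
  have hli' : ∀ i, ∀ j ∈ Finset.Ioi i, ∫ x : Fin m → S, ℓ (x i, x j) ∂π = ∫ z, ℓ z ∂ν.prod ν := by
    intro i j hj
    have hp := measurePreserving_pair ν (Finset.mem_Ioi.1 hj).ne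
    rw [← hp.map_eq, integral_map hp.measurable.aemeasurable]
    rw [hp.map_eq]; exact hℓ.1
  set f : (Fin m → S) → ℝ := fun x => ∑ i, g (x i) + ∑ i, ∑ j ∈ Finset.Ioi i, ℓ (x i, x j) with hf
  have hf1 : Integrable (fun x : Fin m → S => ∑ i, g (x i)) π := integrable_finsetSum _ fun i _ => hgi i
  have hf2 : Integrable (fun x : Fin m → S => ∑ i, ∑ j ∈ Finset.Ioi i, ℓ (x i, x j)) π :=
    integrable_finsetSum _ fun i _ => integrable_finsetSum _ fun j hj => hli i j hj
  have hfint : ∫ x, f x ∂π = m * ∫ x, g x ∂ν + (m * (m - 1) / 2 : ℝ) * ∫ z, ℓ z ∂ν.prod ν := by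
    have hcard : ∑ i : Fin m, ∑ j ∈ Finset.Ioi i, (1 : ℝ) = m * (m - 1) / 2 := by
      rw [sum_Ioi_eq (fun _ _ => (1 : ℝ)) fun _ _ => rfl]
      simp; ring
    rw [hf, integral_add hf1 hf2, integral_finsetSum _ fun i _ => hgi i, integral_finsetSum _
      fun i _ => integrable_finsetSum _ fun j hj => hli i j hj, ← hcard, Finset.sum_mul]
    congr 1
    · simp [hgi']
    · refine Finset.sum_congr rfl fun i _ => ?_
      rw [integral_finsetSum _ fun j hj => hli i j hj, Finset.sum_mul]
      exact Finset.sum_congr rfl fun j hj => by rw [hli' i j hj, one_mul]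
  have hae : ∀ᵐ x ∂π, Real.exp (f x) ≤ weightProduct θ m W fun i => (x i : ℝ) := by
    have h1 : ∀ᵐ x ∂π, ∀ i : Fin m, Real.exp (g (x i)) ≤ W (x i) :=
      ae_all_iff.2 fun i => (hone i).quasiMeasurePreserving.ae hgW
    have h2 : ∀ᵐ x ∂π, ∀ i j : Fin m, i ≠ j → (x i : ℝ) ^ θ ≠ (x j : ℝ) ^ θ := by
      refine ae_all_iff.2 fun i => ae_all_iff.2 fun j => ?_
      by_cases hij : i = j
      · exact ae_of_all _ fun x h => absurd hij h
      · filter_upwards [(measurePreserving_pair ν hij).quasiMeasurePreserving.ae hpair] with x hx _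
        exact hx
    filter_upwards [h1, h2] with x h1 h2
    rw [hf, weightProduct, Real.exp_add, Real.exp_sum, Real.exp_sum]
    refine mul_le_mul (Finset.prod_le_prod (fun i _ => (Real.exp_pos _).le) fun i _ => h1 i)
      (Finset.prod_le_prod (fun i _ => (Real.exp_pos _).le) fun i _ => ?_)
      (Finset.prod_nonneg fun i _ => (Real.exp_pos _).le)
      (Finset.prod_nonneg fun i _ => (Real.exp_pos _).le.trans (h1 i))
    rw [Real.exp_sum]
    refine Finset.prod_le_prod (fun j _ => (Real.exp_pos _).le) fun j hj => ?_
    have h3 := h2 i j (Finset.mem_Ioi.1 hj).ne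
    have h4 : (x i : ℝ) ≠ x j := fun h => h3 (by rw [h])
    have h5 : 0 < |(x i : ℝ) - x j| := abs_pos.2 (sub_ne_zero.2 h4)
    have h6 : 0 < |(x i : ℝ) ^ θ - (x j : ℝ) ^ θ| := abs_pos.2 (sub_ne_zero.2 h3)
    rw [hℓdef]
    exact (Real.exp_log (by positivity)).le
  rw [← hfint]
  calc _ ≤ ∫⁻ x, ENNReal.ofReal (Real.exp (f x)) ∂π := ofReal_exp_integral_le (hf1.add hf2)
    _ ≤ ∫⁻ x, ENNReal.ofReal (weightProduct θ m W fun i => (x i : ℝ)) ∂π :=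
        lintegral_mono_ae (hae.mono fun x hx => ENNReal.ofReal_le_ofReal hx)
    _ ≤ ∫⁻ x, ENNReal.ofReal (weightProduct θ m W fun i => (x i : ℝ))
          ∂(C ^ m • Measure.pi fun _ : Fin m => l) :=
        lintegral_mono' (pi_le_smul_pi hC hC0 hν) le_rfl
    _ = _ := by
        rw [lintegral_smul_measure, smul_eq_mul, partitionFunction, unnormalizedLaw,
          withDensity_apply _ MeasurableSet.univ, Measure.restrict_univ, referenceMeasure]

/-! ### Measures of finite energy -/

section

variable {S : Set ℝ} {θ : ℕ} {κ : ℝ} {w : ℝ → ℝ} {B : ℝ}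

/-- A measure of finite energy does not charge the singularities of the interaction, which is
integrable. -/
lemma integrable_realInteraction_of_energy_le (hθ : 1 ≤ θ) (hκ : 0 < κ) (hc : ContinuousOn w S)
    (hw : ∀ x ∈ S, 0 ≤ w x) (hB : ∀ x ∈ S, tilted θ κ w x ≤ B) {μ : ProbabilityMeasure S} {a : ℝ}
    (hμ : energy S θ κ w μ ≤ a) :
    (∀ᵐ z ∂(μ : Measure S).prod (μ : Measure S),
        (z.1 : ℝ) ^ θ ≠ (z.2 : ℝ) ^ θ ∧ 0 < w z.1 ∧ 0 < w z.2) ∧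
      Integrable (fun z : S × S => realInteraction θ κ w z.1 z.2)
        ((μ : Measure S).prod (μ : Measure S)) ∧
      ∫ z : S × S, realInteraction θ κ w z.1 z.2 ∂(μ : Measure S).prod (μ : Measure S) ≤ a := by
  set π := (μ : Measure S).prod (μ : Measure S) with hπ
  set c := κ * Real.log (B + 1) with hcdef
  have hlow : ∀ k (z : S × S), 0 ≤ kernel θ κ w k z.1 z.2 + c := fun k z => by
    linarith [neg_le_kernel hθ hκ (hw _ z.1.2) (hw _ z.2.2) (hB _ z.1.2) (hB _ z.2.2) k]
  have hkm : ∀ k, Measurable fun z : S × S => kernel θ κ w k z.1 z.2 := fun k =>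
    (continuous_kernel hc hw k).measurable
  have hlimE : ∀ z : S × S, Tendsto (fun k => ((kernel θ κ w k z.1 z.2 + c : ℝ) : EReal)) atTop
      (𝓝 (interaction θ κ w z.1 z.2 + (c : EReal))) := fun z => by
    have h1 := tendsto_kernel hθ hκ (hw _ z.1.2) (hw _ z.2.2) (hB _ z.1.2) (hB _ z.2.2)
    simp only [EReal.coe_add]
    exact (EReal.continuousAt_add (Or.inr (EReal.coe_ne_bot c))
      (Or.inr (EReal.coe_ne_top c))).tendsto.comp (h1.prodMk_nhds tendsto_const_nhds)
  set G : S × S → ℝ≥0∞ := fun z => (interaction θ κ w z.1 z.2 + (c : EReal)).toENNReal with hG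
  have hGlim : ∀ z, Tendsto (fun k => ENNReal.ofReal (kernel θ κ w k z.1 z.2 + c)) atTop (𝓝 (G z)) :=
    fun z => tendsto_toENNReal (hlimE z)
  have hGm : Measurable G := measurable_of_tendsto_metrizable
    (fun k => ((hkm k).add_const c).ennreal_ofReal) (tendsto_pi_nhds.2 hGlim)
  have hGle : ∫⁻ z, G z ∂π ≤ ENNReal.ofReal (a + c) := by
    have ht : Tendsto (fun k => ∫⁻ z, ENNReal.ofReal (kernel θ κ w k z.1 z.2 + c) ∂π) atTop
        (𝓝 (∫⁻ z, G z ∂π)) := lintegral_tendsto_of_tendsto_of_monotone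
      (fun k => ((hkm k).add_const c).ennreal_ofReal.aemeasurable)
      (ae_of_all _ fun z k l hkl => ENNReal.ofReal_le_ofReal (by
        have := kernel_mono (θ := θ) hκ (hw _ z.1.2) (hw _ z.2.2) hkl
        simp only at this
        linarith)) (ae_of_all _ hGlim)
    refine le_of_tendsto' ht fun k => ?_
    have hint := integrable_kernel hθ hκ hc hw hB k π
    have hint2 : Integrable (fun z : S × S => kernel θ κ w k z.1 z.2 + c) π :=
      hint.add (integrable_const c)
    rw [← ofReal_integral_eq_lintegral_ofReal hint2 (ae_of_all _ (hlow k))]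
    refine ENNReal.ofReal_le_ofReal ?_
    rw [integral_add hint (integrable_const c)]
    have := (energy_le_iff hθ hκ hc hw hB).1 hμ k
    rw [truncEnergy] at this
    simpa using this
  have hac : 0 ≤ a + c := by
    have h1 := (neg_le_energy hθ hκ hc hw hB μ).trans hμ
    rw [EReal.coe_le_coe_iff] at h1
    linarith
  -- A function with finite `lintegral` is finite almost everywhere, whereas the interaction is ⊤ on
  -- the singular set.
  have hgood : ∀ᵐ z ∂π, (z.1 : ℝ) ^ θ ≠ (z.2 : ℝ) ^ θ ∧ 0 < w z.1 ∧ 0 < w z.2 := by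
    filter_upwards [ae_lt_top hGm (hGle.trans_lt ENNReal.ofReal_lt_top).ne] with z hz
    by_contra hcon
    have : interaction θ κ w z.1 z.2 = ⊤ := by
      rw [interaction, if_pos]
      by_contra h
      push Not at h
      exact hcon ⟨h.1, lt_of_le_of_ne (hw _ z.1.2) h.2.1.symm, lt_of_le_of_ne (hw _ z.2.2) h.2.2.symm⟩
    rw [hG] at hz
    simp [this] at hz
  have hint_eq : ∀ z : S × S, ((z.1 : ℝ) ^ θ ≠ (z.2 : ℝ) ^ θ ∧ 0 < w z.1 ∧ 0 < w z.2) →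
      interaction θ κ w z.1 z.2 = (realInteraction θ κ w z.1 z.2 : EReal) := fun z hz => by
    rw [interaction, if_neg (by
      rintro (h | h | h)
      exacts [hz.1 h, hz.2.1.ne' h, hz.2.2.ne' h])]
    rfl
  have hreal : ∀ z : S × S, ((z.1 : ℝ) ^ θ ≠ (z.2 : ℝ) ^ θ ∧ 0 < w z.1 ∧ 0 < w z.2) →
      Tendsto (fun k => kernel θ κ w k z.1 z.2 + c) atTop (𝓝 (realInteraction θ κ w z.1 z.2 + c)) :=
    fun z hz => by
      have := hlimE z
      rw [hint_eq z hz, ← EReal.coe_add, EReal.tendsto_coe] at this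
      exact this
  have hnn : ∀ᵐ z ∂π, 0 ≤ realInteraction θ κ w z.1 z.2 + c := by
    filter_upwards [hgood] with z hz
    exact ge_of_tendsto' (hreal z hz) fun k => hlow k z
  have hlint : ∫⁻ z, ENNReal.ofReal (realInteraction θ κ w z.1 z.2 + c) ∂π ≤ ENNReal.ofReal (a + c) := by
    refine le_trans (le_of_eq (lintegral_congr_ae ?_)) hGle
    filter_upwards [hgood] with z hz
    rw [hG]
    simp only
    rw [hint_eq z hz, ← EReal.coe_add, EReal.real_coe_toENNReal]
  have hint : Integrable (fun z : S × S => realInteraction θ κ w z.1 z.2 + c) π := by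
    refine ⟨aestronglyMeasurable_of_tendsto_ae atTop
      (fun k => ((hkm k).add_const c).aestronglyMeasurable) (hgood.mono hreal), ?_⟩
    rw [hasFiniteIntegral_iff_ofReal hnn]
    exact hlint.trans_lt ENNReal.ofReal_lt_top
  have hint' : Integrable (fun z : S × S => realInteraction θ κ w z.1 z.2) π := by
    refine (hint.sub (integrable_const c)).congr (ae_of_all _ fun z => ?_)
    simp
  refine ⟨hgood, hint', ?_⟩
  have h1 : ∫ z : S × S, (realInteraction θ κ w z.1 z.2 + c) ∂π ≤ a + c := by
    rw [← ENNReal.ofReal_le_ofReal_iff hac, ofReal_integral_eq_lintegral_ofReal hint hnn]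
    exact hlint
  rw [integral_add hint' (integrable_const c)] at h1
  simpa using h1

/-- The energy is the integral of the interaction when the latter is integrable. -/
lemma energy_le_of_integrable (hθ : 1 ≤ θ) (hκ : 0 < κ) (hc : ContinuousOn w S)
    (hw : ∀ x ∈ S, 0 ≤ w x) (hB : ∀ x ∈ S, tilted θ κ w x ≤ B) {μ : ProbabilityMeasure S}
    (hgood : ∀ᵐ z ∂(μ : Measure S).prod (μ : Measure S),
        (z.1 : ℝ) ^ θ ≠ (z.2 : ℝ) ^ θ ∧ 0 < w z.1 ∧ 0 < w z.2)
    (hint : Integrable (fun z : S × S => realInteraction θ κ w z.1 z.2)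
        ((μ : Measure S).prod (μ : Measure S))) :
    energy S θ κ w μ ≤
      ((∫ z : S × S, realInteraction θ κ w z.1 z.2 ∂(μ : Measure S).prod (μ : Measure S) : ℝ) : EReal) := by
  rw [energy_le_iff hθ hκ hc hw hB]
  intro k
  refine integral_mono_ae (integrable_kernel hθ hκ hc hw hB k _) hint ?_
  filter_upwards [hgood] with z hz
  have hm : Monotone fun k => (kernel θ κ w k z.1 z.2 : EReal) := fun k l hkl =>
    EReal.coe_le_coe_iff.2 (kernel_mono hκ (hw _ z.1.2) (hw _ z.2.2) hkl)
  have h1 := hm.ge_of_tendsto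
    (tendsto_kernel hθ hκ (hw _ z.1.2) (hw _ z.2.2) (hB _ z.1.2) (hB _ z.2.2)) k
  rw [interaction, if_neg (by
      rintro (h | h | h)
      exacts [hz.1 h, hz.2.1.ne' h, hz.2.2.ne' h])] at h1
  exact EReal.coe_le_coe_iff.1 h1

end

end Biorthogonal
end

noncomputable section
namespace Biorthogonal

/-! ### Approximation by measures with bounded density -/

/-- The interaction minus `κ²` times the logarithmic kernel. -/
def smoothPart (θ : ℕ) (κ : ℝ) (w : ℝ → ℝ) (x y : ℝ) : ℝ :=
  -(κ ^ 2 / 2 * Real.log |∑ i ∈ Finset.range θ, x ^ i * y ^ (θ - 1 - i)|)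
    - κ / 2 * (Real.log (w x) + Real.log (w y))

/-- Since x ^ θ - y ^ θ is (x - y) times a geometric sum, both pair logarithms carry the same
singularity log |x - y|. The remainder is continuous wherever the geometric sum and the weights do
not vanish. -/
lemma realInteraction_eq_add_smoothPart {θ : ℕ} {κ : ℝ} {w : ℝ → ℝ} {x y : ℝ} (h : x ^ θ ≠ y ^ θ) :
    realInteraction θ κ w x y = κ ^ 2 * -Real.log |x - y| + smoothPart θ κ w x y := by
  have h0 := (Commute.all x y).geom_sum₂_mul θ
  have h1 : x ^ θ - y ^ θ ≠ 0 := sub_ne_zero.2 h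
  rw [← h0] at h1
  rw [realInteraction, smoothPart, ← h0, abs_mul, Real.log_inv, Real.log_inv,
    Real.log_mul (abs_ne_zero.2 (left_ne_zero_of_mul h1)) (abs_ne_zero.2 (right_ne_zero_of_mul h1))]
  ring

section

variable {S : Set ℝ} {θ : ℕ} {κ : ℝ} {w : ℝ → ℝ} {B : ℝ}

lemma pow_ne_pow_of_ne (hθ : 1 ≤ θ) (hpar : Even θ → S ⊆ Set.Ici 0) {x y : ℝ} (hx : x ∈ S) (hy : y ∈ S)
    (hxy : x ≠ y) : x ^ θ ≠ y ^ θ := by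
  rcases Nat.even_or_odd θ with h | h
  · exact fun h' => hxy ((pow_left_inj₀ (hpar h hx) (hpar h hy) (by lia)).1 h')
  · exact fun h' => hxy (h.strictMono_pow.injective h')

/-- Off the diagonal this is injectivity of the θ-th power on S; on the diagonal the sum is θ x ^ (θ
- 1), which is why the origin has to be excluded. -/
lemma geom_sum_ne_zero (hθ : 1 ≤ θ) (hpar : Even θ → S ⊆ Set.Ici 0) {x y : ℝ} (hx : x ∈ S)
    (hy : y ∈ S) (hx0 : x ≠ 0) : ∑ i ∈ Finset.range θ, x ^ i * y ^ (θ - 1 - i) ≠ 0 := by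
  by_cases hxy : x = y
  · rw [← hxy, geom_sum₂_self]
    exact mul_ne_zero (by exact_mod_cast (by lia : θ ≠ 0)) (pow_ne_zero _ hx0)
  · intro h
    have h0 := (Commute.all x y).geom_sum₂_mul θ
    rw [h, zero_mul] at h0
    exact pow_ne_pow_of_ne hθ hpar hx hy hxy (sub_eq_zero.1 h0.symm)

lemma continuousOn_smoothPart (hθ : 1 ≤ θ) (hpar : Even θ → S ⊆ Set.Ici 0) (hc : ContinuousOn w S)
    {K : Set ℝ} (hKS : K ⊆ S) (hK0 : ∀ x ∈ K, x ≠ 0) (hKw : ∀ x ∈ K, 0 < w x) :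
    ContinuousOn (fun z : ℝ × ℝ => smoothPart θ κ w z.1 z.2) (K ×ˢ K) := by
  have hlog : ContinuousOn (fun x => Real.log (w x)) K :=
    (hc.mono hKS).log fun x hx => (hKw x hx).ne'
  unfold smoothPart
  refine ContinuousOn.sub (ContinuousOn.neg (ContinuousOn.mul continuousOn_const
    (ContinuousOn.log (Continuous.continuousOn (by fun_prop)) fun z hz => ?_)))
    (ContinuousOn.mul continuousOn_const (ContinuousOn.add ?_ ?_))
  · exact abs_ne_zero.2 (geom_sum_ne_zero hθ hpar (hKS hz.1) (hKS hz.2) (hK0 _ hz.1))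
  · exact hlog.comp continuousOn_fst fun z hz => hz.1
  · exact hlog.comp continuousOn_snd fun z hz => hz.2

lemma integrable_smoothPart (hθ : 1 ≤ θ) (hpar : Even θ → S ⊆ Set.Ici 0) (hc : ContinuousOn w S)
    {K : Set ℝ} (hK : IsCompact K) (hKS : K ⊆ S) (hK0 : ∀ x ∈ K, x ≠ 0) (hKw : ∀ x ∈ K, 0 < w x)
    {ν : Measure ℝ} [IsProbabilityMeasure ν] (hν : ∀ᵐ x ∂ν, x ∈ K) :
    Integrable (fun z : ℝ × ℝ => smoothPart θ κ w z.1 z.2) (ν.prod ν) := by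
  have h1 := (continuousOn_smoothPart (κ := κ) hθ hpar hc hKS hK0 hKw).integrableOn_compact
    (μ := ν.prod ν) (hK.prod hK)
  have h2 : (ν.prod ν).restrict (K ×ˢ K) = ν.prod ν := by
    rw [← Measure.prod_restrict, Measure.restrict_eq_self_of_ae_mem hν]
  rwa [IntegrableOn, h2] at h1

lemma ae_ne_of_le_smul_volume {ν : Measure ℝ} [IsProbabilityMeasure ν] {C : ℝ≥0∞}
    (hν : ν ≤ C • volume) : ∀ᵐ z ∂ν.prod ν, z.1 ≠ z.2 := by
  have hm : MeasurableSet {z : ℝ × ℝ | ¬ z.1 ≠ z.2} := by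
    simp only [ne_eq, not_not]
    exact measurableSet_eq_fun measurable_fst measurable_snd
  rw [ae_iff, Measure.measure_prod_null hm]
  refine ae_of_all _ fun x => ?_
  have : Prod.mk x ⁻¹' {z : ℝ × ℝ | ¬ z.1 ≠ z.2} = {x} := by
    ext y; simp [eq_comm]
  simp only [this, Pi.zero_apply]
  refine le_antisymm ((hν {x}).trans ?_) bot_le
  simp

/-- Integrability of the interaction for measures with bounded density on a compact set which
avoids the singularities. -/
lemma integrable_of_le_smul_volume (hθ : 1 ≤ θ) (hpar : Even θ → S ⊆ Set.Ici 0) (hc : ContinuousOn w S)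
    {K : Set ℝ} (hK : IsCompact K) (hKS : K ⊆ S) (hK0 : ∀ x ∈ K, x ≠ 0) (hKw : ∀ x ∈ K, 0 < w x)
    {ν : Measure ℝ} [IsProbabilityMeasure ν] (hν : ∀ᵐ x ∂ν, x ∈ K) {C : ℝ≥0∞} (hC : C ≠ ⊤)
    (hνC : ν ≤ C • volume) :
    Integrable (fun z : ℝ × ℝ => Real.log |z.1 - z.2|) (ν.prod ν) ∧
    (∀ᵐ z ∂ν.prod ν, z.1 ^ θ ≠ z.2 ^ θ) ∧
    Integrable (fun z : ℝ × ℝ => realInteraction θ κ w z.1 z.2) (ν.prod ν) ∧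
    ∫ z, realInteraction θ κ w z.1 z.2 ∂ν.prod ν = κ ^ 2 * ∫ z, -Real.log |z.1 - z.2| ∂ν.prod ν
      + ∫ z, smoothPart θ κ w z.1 z.2 ∂ν.prod ν := by
  obtain ⟨R, hR⟩ := hK.isBounded.exists_norm_le
  have h1 := integrable_log_abs_sub_of_le hC hνC (hν.mono fun x hx => hR x hx)
  have h2 := integrable_smoothPart (κ := κ) hθ hpar hc hK hKS hK0 hKw hν
  have h3 : ∀ᵐ z ∂ν.prod ν, z.1 ^ θ ≠ z.2 ^ θ := by
    filter_upwards [ae_ne_of_le_smul_volume hνC, Measure.quasiMeasurePreserving_fst.ae hν,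
      Measure.quasiMeasurePreserving_snd.ae hν] with z hz hz1 hz2
    exact pow_ne_pow_of_ne hθ hpar (hKS hz1) (hKS hz2) hz
  have h4 : (fun z : ℝ × ℝ => realInteraction θ κ w z.1 z.2) =ᵐ[ν.prod ν]
      fun z => κ ^ 2 * -Real.log |z.1 - z.2| + smoothPart θ κ w z.1 z.2 :=
    h3.mono fun z hz => realInteraction_eq_add_smoothPart hz
  have h5 : Integrable (fun z : ℝ × ℝ => κ ^ 2 * -Real.log |z.1 - z.2|) (ν.prod ν) := h1.neg.const_mul _
  refine ⟨h1, h3, (h5.add h2).congr h4.symm, ?_⟩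
  rw [integral_congr_ae h4, integral_add h5 h2, integral_const_mul]

/-- Points of `S` at distance at least `2 η` from `F`, near which `S` contains a one-sided
interval of length `η`. -/
def innerSet (S F : Set ℝ) (k : ℕ) : Set ℝ :=
  {x | x ∈ S ∧ |x| ≤ k ∧ (∀ f ∈ F, 2 / ((k : ℝ) + 1) ≤ |x - f|) ∧
    ((∀ t ∈ Set.Icc 0 (1 / ((k : ℝ) + 1)), x + t ∈ S) ∨
      ∀ t ∈ Set.Icc 0 (1 / ((k : ℝ) + 1)), x - t ∈ S)}

lemma isClosed_forall_add_mul_mem (hS : IsClosed S) (s η : ℝ) :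
    IsClosed {x | ∀ t ∈ Set.Icc 0 η, x + s * t ∈ S} := by
  have : {x | ∀ t ∈ Set.Icc 0 η, x + s * t ∈ S} = ⋂ t ∈ Set.Icc 0 η, (fun x => x + s * t) ⁻¹' S := by
    ext x; simp
  rw [this]
  exact isClosed_biInter fun t _ => hS.preimage (by fun_prop)

lemma measurableSet_innerSet (hS : IsClosed S) (F : Set ℝ) (k : ℕ) : MeasurableSet (innerSet S F k) := by
  refine IsClosed.measurableSet (hS.inter (IsClosed.inter (isClosed_le continuous_abs continuous_const)
    (IsClosed.inter ?_ (IsClosed.union ?_ ?_))))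
  · have : {x : ℝ | ∀ f ∈ F, 2 / ((k : ℝ) + 1) ≤ |x - f|} =
        ⋂ f ∈ F, {x | 2 / ((k : ℝ) + 1) ≤ |x - f|} := by ext x; simp
    change IsClosed {x : ℝ | ∀ f ∈ F, 2 / ((k : ℝ) + 1) ≤ |x - f|}
    rw [this]
    exact isClosed_biInter fun f _ => isClosed_le continuous_const (by fun_prop)
  · have h := isClosed_forall_add_mul_mem hS 1 (1 / ((k : ℝ) + 1))
    simp only [one_mul] at h
    exact h
  · have h := isClosed_forall_add_mul_mem hS (-1) (1 / ((k : ℝ) + 1))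
    simp only [neg_mul, one_mul, ← sub_eq_add_neg] at h
    exact h

lemma innerSet_mono (S F : Set ℝ) : Monotone (innerSet S F) := by
  intro k l hkl x hx
  have hkl' : (k : ℝ) ≤ l := by exact_mod_cast hkl
  have h1 : 1 / ((l : ℝ) + 1) ≤ 1 / ((k : ℝ) + 1) := by gcongr
  have h2 : 2 / ((l : ℝ) + 1) ≤ 2 / ((k : ℝ) + 1) := by gcongr
  refine ⟨hx.1, hx.2.1.trans hkl', fun f hf => h2.trans (hx.2.2.1 f hf), ?_⟩
  exact hx.2.2.2.imp (fun h t ht => h t ⟨ht.1, ht.2.trans h1⟩) (fun h t ht => h t ⟨ht.1, ht.2.trans h1⟩)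

/-- These sets exhaust S \ F: every point of S lies in a nondegenerate interval contained in S, so
there is room to its right, or to its left if it is the right endpoint. -/
lemma exists_mem_innerSet {F : Set ℝ} (hF : F.Finite)
    (hSint : ∀ x ∈ S, ∃ a b : ℝ, a < b ∧ x ∈ Set.Icc a b ∧ Set.Icc a b ⊆ S) {x : ℝ} (hx : x ∈ S)
    (hxF : x ∉ F) : ∃ k, x ∈ innerSet S F k := by
  have hinv : Tendsto (fun k : ℕ => 1 / ((k : ℝ) + 1)) atTop (𝓝 0) :=
    tendsto_one_div_add_atTop_nhds_zero_nat
  have e1 : ∀ᶠ k : ℕ in atTop, |x| ≤ k := tendsto_natCast_atTop_atTop.eventually_ge_atTop _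
  have e2 : ∀ᶠ k : ℕ in atTop, ∀ f ∈ F, 2 / ((k : ℝ) + 1) ≤ |x - f| := by
    rw [hF.eventually_all]
    intro f hf
    have hpos : 0 < |x - f| / 2 := by
      have : x ≠ f := fun h => hxF (h ▸ hf)
      have := abs_pos.2 (sub_ne_zero.2 this)
      positivity
    filter_upwards [hinv.eventually (gt_mem_nhds hpos)] with k hk
    have : 2 / ((k : ℝ) + 1) = 2 * (1 / ((k : ℝ) + 1)) := by ring
    rw [this]; linarith
  obtain ⟨a, b, hab, hxab, habS⟩ := hSint x hx
  have e3 : ∀ᶠ k : ℕ in atTop, (∀ t ∈ Set.Icc 0 (1 / ((k : ℝ) + 1)), x + t ∈ S) ∨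
      ∀ t ∈ Set.Icc 0 (1 / ((k : ℝ) + 1)), x - t ∈ S := by
    rcases hxab.2.lt_or_eq with h | h
    · filter_upwards [hinv.eventually (gt_mem_nhds (sub_pos.2 h))] with k hk
      exact Or.inl fun t ht => habS ⟨by linarith [hxab.1, ht.1], by linarith [ht.2]⟩
    · filter_upwards [hinv.eventually (gt_mem_nhds (sub_pos.2 hab))] with k hk
      exact Or.inr fun t ht => habS ⟨by linarith [ht.2], by linarith [ht.1]⟩
  obtain ⟨k, h1, h2, h3⟩ := (e1.and (e2.and e3)).exists
  exact ⟨k, hx, h1, h2, h3⟩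

/-- A compact neighbourhood in `S` of the set `innerSet S F k`. -/
def outerSet (S F : Set ℝ) (k : ℕ) : Set ℝ :=
  {x | x ∈ S ∧ |x| ≤ k + 1 ∧ ∀ f ∈ F, 1 / ((k : ℝ) + 1) ≤ |x - f|}

lemma isCompact_outerSet (hS : IsClosed S) (F : Set ℝ) (k : ℕ) : IsCompact (outerSet S F k) := by
  refine (isCompact_closedBall (0 : ℝ) (k + 1)).of_isClosed_subset ?_ fun x hx => by
    simpa using hx.2.1
  refine hS.inter ((isClosed_le continuous_abs continuous_const).inter ?_)
  have : {x : ℝ | ∀ f ∈ F, 1 / ((k : ℝ) + 1) ≤ |x - f|} =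
        ⋂ f ∈ F, {x | 1 / ((k : ℝ) + 1) ≤ |x - f|} := by ext x; simp
  change IsClosed {x : ℝ | ∀ f ∈ F, 1 / ((k : ℝ) + 1) ≤ |x - f|}
  rw [this]
  exact isClosed_biInter fun f _ => isClosed_le continuous_const (by fun_prop)

lemma outerSet_subset (S F : Set ℝ) (k : ℕ) : outerSet S F k ⊆ S \ F := fun x hx =>
  ⟨hx.1, fun h => by
    have := hx.2.2 x h
    rw [sub_self, abs_zero] at this
    exact absurd this (not_le.2 (by positivity))⟩

open scoped Classical in
/-- The direction in which `S` contains an interval of length `η` at `x`. -/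
def direction (S : Set ℝ) (η x : ℝ) : ℝ := if ∀ t ∈ Set.Icc 0 η, x + t ∈ S then 1 else -1

lemma measurable_direction (hS : IsClosed S) (η : ℝ) : Measurable (direction S η) := by
  unfold direction
  refine Measurable.ite ?_ measurable_const measurable_const
  simpa using (isClosed_forall_add_mul_mem hS 1 η).measurableSet

lemma abs_direction (S : Set ℝ) (η x : ℝ) : |direction S η x| = 1 := by
  unfold direction; split_ifs <;> simp

lemma displace_mem_outerSet {F : Set ℝ} {k : ℕ} {x t u : ℝ} (hx : x ∈ innerSet S F k)
    (ht : 0 ≤ t) (htk : t ≤ 1 / ((k : ℝ) + 1)) (hu : u ∈ Set.Icc (0 : ℝ) 1) :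
    x + t * direction S (1 / ((k : ℝ) + 1)) x * u ∈ outerSet S F k := by
  have hd := abs_displace_sub_le (abs_direction S (1 / ((k : ℝ) + 1))) ht (x := x) hu
  have htu : t * u ∈ Set.Icc 0 (1 / ((k : ℝ) + 1)) :=
    ⟨mul_nonneg ht hu.1, (mul_le_of_le_one_right ht hu.2).trans htk⟩
  have hone : 1 / ((k : ℝ) + 1) ≤ 1 := by rw [div_le_one (by positivity)]; simp
  refine ⟨?_, (abs_add_le _ _).trans (by linarith [hx.2.1]), fun f hf => ?_⟩
  · unfold direction
    split_ifs with h
    · have := h _ htu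
      rwa [mul_one]
    · have := hx.2.2.2.resolve_left h _ htu
      have e : x + t * -1 * u = x - t * u := by ring
      rwa [e]
  · have h1 := hx.2.2.1 f hf
    have h2 : |x - f| ≤ |x + t * direction S (1 / ((k : ℝ) + 1)) x * u - f|
        + |t * direction S (1 / ((k : ℝ) + 1)) x * u| := by
      have e : x - f = (x + t * direction S (1 / ((k : ℝ) + 1)) x * u - f)
        - t * direction S (1 / ((k : ℝ) + 1)) x * u := by ring
      calc _ = |(x + t * direction S (1 / ((k : ℝ) + 1)) x * u - f)
        - t * direction S (1 / ((k : ℝ) + 1)) x * u| := by rw [← e]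
        _ ≤ _ := abs_sub _ _
    have h3 : 2 / ((k : ℝ) + 1) = 2 * (1 / ((k : ℝ) + 1)) := by ring
    rw [h3] at h1
    linarith

/-- Smearing towards the available side keeps the mass in a compact part of S away from the
singularities. The logarithmic part rises by at most a quarter of the gap to a, and the smooth part,
by uniform continuity, by at most another quarter. -/
lemma exists_smear_energy_lt (hS : IsClosed S) (hθ : 1 ≤ θ) (hpar : Even θ → S ⊆ Set.Ici 0)
    (hc : ContinuousOn w S) {F : Set ℝ} (hF0 : 0 ∈ F)
    (hFw : ∀ x ∈ S \ F, 0 < w x) {P : Measure ℝ} [IsProbabilityMeasure P] {k : ℕ}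
    (hP : ∀ᵐ x ∂P, x ∈ innerSet S F k) (hpow : ∀ᵐ z ∂P.prod P, z.1 ^ θ ≠ z.2 ^ θ)
    (hint : Integrable (fun z : ℝ × ℝ => realInteraction θ κ w z.1 z.2) (P.prod P))
    (hκ : 0 < κ) {a : ℝ} (ha : ∫ z, realInteraction θ κ w z.1 z.2 ∂P.prod P < a) :
    ∃ (ν : Measure ℝ) (C : ℝ≥0∞), IsProbabilityMeasure ν ∧ C ≠ ⊤ ∧ C ≠ 0 ∧ ν ≤ C • volume ∧
      (∀ᵐ x ∂ν, x ∈ outerSet S F k) ∧ ∫ z, realInteraction θ κ w z.1 z.2 ∂ν.prod ν < a := by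
  set K := outerSet S F k with hK
  have hKc := isCompact_outerSet hS F k
  have hKS : K ⊆ S := fun x hx => hx.1
  have hK0 : ∀ x ∈ K, x ≠ 0 := fun x hx h => (outerSet_subset S F k hx).2 (h ▸ hF0)
  have hKw : ∀ x ∈ K, 0 < w x := fun x hx => hFw x (outerSet_subset S F k hx)
  set σ := direction S (1 / ((k : ℝ) + 1)) with hσ
  have hσm : Measurable σ := measurable_direction hS _
  have hσ1 : ∀ x, |σ x| = 1 := abs_direction S _
  have hPK : ∀ᵐ x ∂P, x ∈ K := hP.mono fun x hx => by
    have := displace_mem_outerSet hx le_rfl (by positivity) (u := 0) (by simp)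
    simpa using this
  have hsm := integrable_smoothPart (κ := κ) hθ hpar hc hKc hKS hK0 hKw hPK
  have hκ2 : 0 < κ ^ 2 := by positivity
  -- Integrability of the logarithm is recovered as that of the interaction minus its smooth part,
  -- which is integrable because P lives on the compact set K.
  have hlog : Integrable (fun z : ℝ × ℝ => Real.log |z.1 - z.2|) (P.prod P) := by
    have h1 : Integrable (fun z : ℝ × ℝ => -(κ ^ 2)⁻¹ *
        (realInteraction θ κ w z.1 z.2 - smoothPart θ κ w z.1 z.2)) (P.prod P) :=
      (hint.sub hsm).const_mul _
    refine h1.congr (hpow.mono fun z hz => ?_)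
    simp only
    rw [realInteraction_eq_add_smoothPart hz]
    field_simp
    ring
  have hdec : ∫ z, realInteraction θ κ w z.1 z.2 ∂P.prod P =
      κ ^ 2 * ∫ z, -Real.log |z.1 - z.2| ∂P.prod P + ∫ z, smoothPart θ κ w z.1 z.2 ∂P.prod P := by
    have h5 : Integrable (fun z : ℝ × ℝ => κ ^ 2 * -Real.log |z.1 - z.2|) (P.prod P) :=
      hlog.neg.const_mul _
    rw [integral_congr_ae (hpow.mono fun z hz => realInteraction_eq_add_smoothPart hz),
      integral_add h5 hsm, integral_const_mul]
  set gap := a - ∫ z, realInteraction θ κ w z.1 z.2 ∂P.prod P with hgap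
  have hgap0 : 0 < gap := sub_pos.2 ha
  obtain ⟨t₀, ht₀, hsmear⟩ := exists_integral_neg_log_smear_le hσm hσ1
    (hPK.mono fun x hx => hx.2.1) (hpow.mono fun z hz h => hz (by rw [h])) hlog
    (by positivity : 0 < gap / (4 * κ ^ 2))
  have huc := (hKc.prod hKc).uniformContinuousOn_of_continuous
    (continuousOn_smoothPart (κ := κ) hθ hpar hc hKS hK0 hKw)
  rw [Metric.uniformContinuousOn_iff] at huc
  obtain ⟨δ, hδ, huc⟩ := huc (gap / 4) (by positivity)
  -- The three constraints control the logarithmic energy, keep displacements within the modulus of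
  -- continuity of the smooth part, and keep displaced points in `K`.
  set t := min t₀ (min (δ / 2) (1 / ((k : ℝ) + 1))) with ht
  have htpos : 0 < t := by positivity
  have hprob := isProbabilityMeasure_smear (ν := P) (t := t) hσm
  have hνC := smear_le (ν := P) hσm hσ1 htpos
  have hνK : ∀ᵐ x ∂smear P σ t, x ∈ K := ae_smear hσm hKc.isClosed.measurableSet hP fun x hx u hu =>
    displace_mem_outerSet hx htpos.le ((min_le_right _ _).trans (min_le_right _ _)) hu
  have hCt : ENNReal.ofReal (1 / t) ≠ ⊤ := ENNReal.ofReal_ne_top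
  refine ⟨smear P σ t, ENNReal.ofReal (1 / t), hprob, hCt,
    (ENNReal.ofReal_pos.2 (by positivity)).ne', hνC, hνK, ?_⟩
  obtain ⟨-, -, -, hdec'⟩ := integrable_of_le_smul_volume (κ := κ) hθ hpar hc hKc hKS hK0 hKw hνK hCt hνC
  have hsm' := integrable_smoothPart (κ := κ) hθ hpar hc hKc hKS hK0 hKw hνK
  have hsmooth : ∫ z, smoothPart θ κ w z.1 z.2 ∂(smear P σ t).prod (smear P σ t) ≤
      ∫ z, smoothPart θ κ w z.1 z.2 ∂P.prod P + gap / 4 := by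
    set Q := P.prod (volume.restrict (Set.Icc (0 : ℝ) 1)) with hQ
    have hT := measurable_displace hσm t
    have hmap : (smear P σ t).prod (smear P σ t) =
        (Q.prod Q).map (Prod.map (displace σ t) (displace σ t)) := by
      rw [smear, Measure.map_prod_map _ _ hT hT]
    have hTT : Measurable (Prod.map (displace σ t) (displace σ t)) := hT.prodMap hT
    rw [hmap] at hsm' ⊢
    rw [integral_map hTT.aemeasurable hsm'.1]
    have hi1 := hsm'.comp_measurable hTT
    have hfst : MeasurePreserving (Prod.fst : ℝ × ℝ → ℝ) Q P := measurePreserving_fst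
    have hfst2 : MeasurePreserving (Prod.map Prod.fst Prod.fst : (ℝ × ℝ) × (ℝ × ℝ) → ℝ × ℝ)
        (Q.prod Q) (P.prod P) := hfst.prod hfst
    have hi2 : Integrable (fun z : (ℝ × ℝ) × (ℝ × ℝ) => smoothPart θ κ w z.1.1 z.2.1) (Q.prod Q) :=
      hfst2.integrable_comp_of_integrable hsm
    have heq : ∫ z, smoothPart θ κ w z.1 z.2 ∂P.prod P =
        ∫ z : (ℝ × ℝ) × (ℝ × ℝ), smoothPart θ κ w z.1.1 z.2.1 ∂Q.prod Q := by
      rw [← hfst2.map_eq, integral_map hfst2.measurable.aemeasurable]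
      · rfl
      · rw [hfst2.map_eq]; exact hsm.1
    have hle : ∀ᵐ z ∂Q.prod Q, smoothPart θ κ w (displace σ t z.1) (displace σ t z.2) ≤
        smoothPart θ κ w z.1.1 z.2.1 + gap / 4 := by
      have h1 : ∀ᵐ z ∂Q, z.1 ∈ innerSet S F k := Measure.quasiMeasurePreserving_fst.ae hP
      have h2 : ∀ᵐ z ∂Q, z.2 ∈ Set.Icc (0 : ℝ) 1 :=
        Measure.quasiMeasurePreserving_snd.ae (ae_restrict_mem measurableSet_Icc)
      have h3 := h1.and h2
      filter_upwards [Measure.quasiMeasurePreserving_fst.ae h3,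
        Measure.quasiMeasurePreserving_snd.ae h3] with z hz1 hz2
      have hmem : ∀ y : ℝ × ℝ, y.1 ∈ innerSet S F k → y.2 ∈ Set.Icc (0 : ℝ) 1 →
          displace σ t y ∈ K ∧ y.1 ∈ K ∧ dist (displace σ t y) y.1 < δ := by
        intro y hy hy2
        refine ⟨displace_mem_outerSet hy htpos.le ((min_le_right _ _).trans (min_le_right _ _)) hy2,
          ?_, ?_⟩
        · have := displace_mem_outerSet hy le_rfl (by positivity) (u := 0) (by simp)
          simpa using this
        · rw [Real.dist_eq, displace, add_sub_cancel_left]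
          have h4 := abs_displace_sub_le hσ1 htpos.le (x := y.1) hy2
          have h5 : t ≤ δ / 2 := (min_le_right _ _).trans (min_le_left _ _)
          linarith
      obtain ⟨a1, a2, a3⟩ := hmem _ hz1.1 hz1.2
      obtain ⟨b1, b2, b3⟩ := hmem _ hz2.1 hz2.2
      have := huc (displace σ t z.1, displace σ t z.2) ⟨a1, b1⟩ (z.1.1, z.2.1) ⟨a2, b2⟩
        (by rw [Prod.dist_eq]; exact max_lt a3 b3)
      rw [Real.dist_eq] at this
      linarith [(abs_lt.1 this).2]
    rw [heq]
    have hconst : ∫ z : (ℝ × ℝ) × (ℝ × ℝ), (smoothPart θ κ w z.1.1 z.2.1 + gap / 4) ∂Q.prod Q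
        = ∫ z : (ℝ × ℝ) × (ℝ × ℝ), smoothPart θ κ w z.1.1 z.2.1 ∂Q.prod Q + gap / 4 := by
      rw [integral_add hi2 (integrable_const _)]; simp
    rw [← hconst]
    exact integral_mono_ae hi1 (hi2.add (integrable_const _)) hle
  have h1 := hsmear t htpos (min_le_left _ _)
  have h2 : κ ^ 2 * (gap / (4 * κ ^ 2)) = gap / 4 := by field_simp
  have h3 := mul_le_mul_of_nonneg_left h1 hκ2.le
  rw [mul_add, h2] at h3
  rw [hdec']
  linarith [hdec]

end

end Biorthogonal
end

noncomputable section
namespace Biorthogonal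

/-! ### The lower bound for the partition function -/

section

variable {S : Set ℝ} {θ : ℕ} {κ : ℝ} {w : ℝ → ℝ} {B : ℝ}

/-- An atom at x would give the diagonal point (x, x) mass P {x} squared. Thus measures of finite
energy do not charge the finite exceptional set. -/
lemma measure_singleton_eq_zero {α : Type*} [MeasurableSpace α] [MeasurableSingletonClass α]
    {P : Measure α} [IsProbabilityMeasure P] {f : α → ℝ}
    (hpow : ∀ᵐ z ∂P.prod P, f z.1 ≠ f z.2) (x : α) : P {x} = 0 := by
  have h : (P.prod P) ({x} ×ˢ {x}) = 0 := by
    refine measure_mono_null ?_ (ae_iff.1 hpow)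
    rintro ⟨y, z⟩ ⟨hy, hz⟩
    simp only [Set.mem_singleton_iff] at hy hz
    simp [hy, hz]
  rw [Measure.prod_prod] at h
  simpa using h

/-- Conditioning on `innerSet S F k` for large `k` changes the energy only slightly. -/
lemma exists_innerSet_energy_lt (hS : IsClosed S)
    (hSint : ∀ x ∈ S, ∃ a b : ℝ, a < b ∧ x ∈ Set.Icc a b ∧ Set.Icc a b ⊆ S)
    {F : Set ℝ} (hF : F.Finite) {P : Measure ℝ} [IsProbabilityMeasure P]
    (hP : ∀ᵐ x ∂P, x ∈ S) (hpow : ∀ᵐ z ∂P.prod P, z.1 ^ θ ≠ z.2 ^ θ)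
    (hint : Integrable (fun z : ℝ × ℝ => realInteraction θ κ w z.1 z.2) (P.prod P))
    {a : ℝ} (ha : ∫ z, realInteraction θ κ w z.1 z.2 ∂P.prod P < a) :
    ∃ (k : ℕ) (P' : Measure ℝ), IsProbabilityMeasure P' ∧ (∀ᵐ x ∂P', x ∈ innerSet S F k) ∧
      (∀ᵐ z ∂P'.prod P', z.1 ^ θ ≠ z.2 ^ θ) ∧
      Integrable (fun z : ℝ × ℝ => realInteraction θ κ w z.1 z.2) (P'.prod P') ∧
      ∫ z, realInteraction θ κ w z.1 z.2 ∂P'.prod P' < a := by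
  have hFnull : P F = 0 := (measure_null_iff_singleton hF.countable).2 fun x _ =>
    measure_singleton_eq_zero (f := fun x => x ^ θ) hpow x
  have hUnion : ∀ᵐ x ∂P, x ∈ ⋃ k, innerSet S F k := by
    filter_upwards [hP, measure_eq_zero_iff_ae_notMem.1 hFnull] with x hx hxF
    exact Set.mem_iUnion.2 (exists_mem_innerSet hF hSint hx hxF)
  have hm := measurableSet_innerSet hS F
  have hmass : Tendsto (fun k => P (innerSet S F k)) atTop (𝓝 1) := by
    have := tendsto_measure_iUnion_atTop (μ := P) (innerSet_mono S F)
    rwa [(prob_compl_eq_zero_iff₀ (MeasurableSet.iUnion hm).nullMeasurableSet).1 (mem_ae_iff.1 hUnion)] at this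
  have hmass' : Tendsto (fun k => ((P (innerSet S F k))⁻¹).toReal) atTop (𝓝 1) := by
    have h1 : Tendsto (fun k => (P (innerSet S F k))⁻¹) atTop (𝓝 1) := by
      simpa using (tendsto_inv_iff.2 hmass)
    exact (ENNReal.tendsto_toReal ENNReal.one_ne_top).comp h1
  set f := fun z : ℝ × ℝ => realInteraction θ κ w z.1 z.2 with hf
  have hset : Tendsto (fun k => ∫ z in innerSet S F k ×ˢ innerSet S F k, f z ∂P.prod P) atTop
      (𝓝 (∫ z, f z ∂P.prod P)) := by
    have h1 := tendsto_setIntegral_of_monotone (μ := P.prod P) (f := f)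
      (s := fun k => innerSet S F k ×ˢ innerSet S F k)
      (fun k => (hm k).prod (hm k))
      (fun k l hkl => Set.prod_mono (innerSet_mono S F hkl) (innerSet_mono S F hkl))
      hint.integrableOn
    have h2 : (P.prod P).restrict (⋃ k, innerSet S F k ×ˢ innerSet S F k) = P.prod P := by
      refine Measure.restrict_eq_self_of_ae_mem ?_
      filter_upwards [Measure.quasiMeasurePreserving_fst.ae hUnion,
        Measure.quasiMeasurePreserving_snd.ae hUnion] with z h1 h2
      obtain ⟨i, hi⟩ := Set.mem_iUnion.1 h1
      obtain ⟨j, hj⟩ := Set.mem_iUnion.1 h2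
      exact Set.mem_iUnion.2 ⟨max i j, innerSet_mono S F (le_max_left _ _) hi,
        innerSet_mono S F (le_max_right _ _) hj⟩
    rwa [h2] at h1
  -- Conditioning multiplies the product law by the square of the inverse mass; the two factors tend
  -- to 1.
  have hlim := hmass'.mul (hmass'.mul hset)
  rw [one_mul, one_mul] at hlim
  have hpos : ∀ᶠ k in atTop, 0 < P (innerSet S F k) := hmass.eventually (lt_mem_nhds (by simp))
  obtain ⟨k, hk, hk0⟩ := ((hlim.eventually (gt_mem_nhds ha)).and hpos).exists
  set c := (P (innerSet S F k))⁻¹ with hc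
  have hctop : c ≠ ⊤ := ENNReal.inv_ne_top.2 hk0.ne'
  have hprod : (c • P.restrict (innerSet S F k)).prod (c • P.restrict (innerSet S F k)) =
      c • c • (P.prod P).restrict (innerSet S F k ×ˢ innerSet S F k) := by
    have : SFinite (c • P.restrict (innerSet S F k)) := inferInstance
    rw [Measure.prod_smul_left, Measure.prod_smul_right, Measure.prod_restrict]
  have hac : (c • P.restrict (innerSet S F k)).prod (c • P.restrict (innerSet S F k)) ≪ P.prod P := by
    rw [hprod]
    exact (Measure.AbsolutelyContinuous.rfl.smul_left c |>.smul_left c).trans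
      Measure.restrict_le_self.absolutelyContinuous
  refine ⟨k, c • P.restrict (innerSet S F k), ⟨?_⟩, ?_, hac.ae_le hpow, ?_, ?_⟩
  · simp [hc, ENNReal.inv_mul_cancel hk0.ne' (measure_ne_top _ _)]
  · exact (Measure.AbsolutelyContinuous.rfl.smul_left c).ae_le (ae_restrict_mem (hm k))
  · rw [hprod]
    exact (hint.restrict.smul_measure hctop).smul_measure hctop
  · rw [hprod, integral_smul_measure, integral_smul_measure]
    simpa using hk

lemma measurableEmbedding_prodMap_coe (hS : MeasurableSet S) :
    MeasurableEmbedding (Prod.map ((↑) : S → ℝ) ((↑) : S → ℝ)) :=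
  (MeasurableEmbedding.subtype_coe hS).prodMap (MeasurableEmbedding.subtype_coe hS)

lemma map_prodMap_coe {μ : Measure S} [SFinite μ] :
    (μ.prod μ).map (Prod.map ((↑) : S → ℝ) ((↑) : S → ℝ)) =
      (μ.map ((↑) : S → ℝ)).prod (μ.map ((↑) : S → ℝ)) :=
  (Measure.map_prod_map _ _ measurable_subtype_coe measurable_subtype_coe).symm

lemma map_comap_coe (hS : MeasurableSet S) {ν : Measure ℝ} (hν : ∀ᵐ x ∂ν, x ∈ S) :
    (ν.comap ((↑) : S → ℝ)).map ((↑) : S → ℝ) = ν := by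
  rw [(MeasurableEmbedding.subtype_coe hS).map_comap, Subtype.range_coe,
    Measure.restrict_eq_self_of_ae_mem hν]

lemma isProbabilityMeasure_comap_coe (hS : MeasurableSet S) {ν : Measure ℝ} [IsProbabilityMeasure ν]
    (hν : ∀ᵐ x ∂ν, x ∈ S) : IsProbabilityMeasure (ν.comap ((↑) : S → ℝ)) := by
  constructor
  have := congrArg (fun m => m Set.univ) (map_comap_coe hS hν)
  simpa [Measure.map_apply measurable_subtype_coe] using this

lemma comap_coe_le (hS : MeasurableSet S) {ν : Measure ℝ} {C : ℝ≥0∞} (hνC : ν ≤ C • volume) :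
    ν.comap ((↑) : S → ℝ) ≤ C • (volume : Measure ℝ).comap ((↑) : S → ℝ) := by
  refine Measure.le_iff.2 fun s _ => ?_
  have h := MeasurableEmbedding.subtype_coe hS
  rw [Measure.smul_apply, h.comap_apply, h.comap_apply]
  exact hνC _

/-- Energies of measures on `S` with density bounded by a multiple of Lebesgue measure, and
concentrated on a compact set avoiding the singularities, can be computed on `ℝ`. -/
lemma energy_comap_le (hS : IsClosed S) (hθ : 1 ≤ θ) (hpar : Even θ → S ⊆ Set.Ici 0) (hκ : 0 < κ)
    (hc : ContinuousOn w S) (hw : ∀ x ∈ S, 0 ≤ w x) (hB : ∀ x ∈ S, tilted θ κ w x ≤ B)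
    {K : Set ℝ} (hK : IsCompact K) (hKS : K ⊆ S) (hK0 : ∀ x ∈ K, x ≠ 0) (hKw : ∀ x ∈ K, 0 < w x)
    {ν : Measure ℝ} [IsProbabilityMeasure ν] (hν : ∀ᵐ x ∂ν, x ∈ K) {C : ℝ≥0∞} (hC : C ≠ ⊤)
    (hνC : ν ≤ C • volume) :
    ∃ μ : ProbabilityMeasure S, energy S θ κ w μ < ⊤ := by
  have hSm := hS.measurableSet
  have hνS : ∀ᵐ x ∂ν, x ∈ S := hν.mono fun x hx => hKS hx
  have hprob := isProbabilityMeasure_comap_coe hSm hνS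
  obtain ⟨-, h2, h3, -⟩ := integrable_of_le_smul_volume (κ := κ) hθ hpar hc hK hKS hK0 hKw hν hC hνC
  refine ⟨⟨ν.comap (↑), hprob⟩, lt_of_le_of_lt (energy_le_of_integrable hθ hκ hc hw hB
    ?_ ?_) (EReal.coe_lt_top _)⟩
  · have h4 : ∀ᵐ z ∂ν.prod ν, z.1 ^ θ ≠ z.2 ^ θ ∧ 0 < w z.1 ∧ 0 < w z.2 := by
      filter_upwards [h2, Measure.quasiMeasurePreserving_fst.ae hν,
        Measure.quasiMeasurePreserving_snd.ae hν] with z hz hz1 hz2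
      exact ⟨hz, hKw _ hz1, hKw _ hz2⟩
    rw [← map_comap_coe hSm hνS, ← map_prodMap_coe,
      (measurableEmbedding_prodMap_coe hSm).ae_map_iff] at h4
    exact h4
  · rw [← map_comap_coe hSm hνS, ← map_prodMap_coe,
      (measurableEmbedding_prodMap_coe hSm).integrable_map_iff] at h3
    exact h3

/-- The uniform law on a small interval inside S that avoids 0 and `F` has bounded density, hence
finite energy. -/
lemma exists_energy_lt_top (hS : IsClosed S) (hne : S.Nonempty)
    (hSint : ∀ x ∈ S, ∃ a b : ℝ, a < b ∧ x ∈ Set.Icc a b ∧ Set.Icc a b ⊆ S)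
    (hθ : 1 ≤ θ) (hpar : Even θ → S ⊆ Set.Ici 0) (hκ : 0 < κ)
    (hc : ContinuousOn w S) (hw : ∀ x ∈ S, 0 ≤ w x) (hB : ∀ x ∈ S, tilted θ κ w x ≤ B)
    {F : Set ℝ} (hF : F.Finite) (hFw : ∀ x ∈ S \ F, 0 < w x) :
    ∃ μ : ProbabilityMeasure S, energy S θ κ w μ < ⊤ := by
  obtain ⟨x, hx⟩ := hne
  obtain ⟨a, b, hab, -, habS⟩ := hSint x hx
  have hF' : (insert 0 F).Finite := hF.insert 0
  have hopen : IsOpen (Set.Ioo a b \ insert 0 F) := isOpen_Ioo.sdiff hF'.isClosed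
  obtain ⟨y, hy⟩ : (Set.Ioo a b \ insert 0 F).Nonempty :=
    ((Set.Ioo_infinite hab).sdiff hF').nonempty
  obtain ⟨r, hr, hball⟩ := Metric.nhds_basis_closedBall.mem_iff.1 (hopen.mem_nhds hy)
  rw [Real.closedBall_eq_Icc] at hball
  set K := Set.Icc (y - r) (y + r) with hKdef
  have hvol : volume K = ENNReal.ofReal (2 * r) := by
    rw [hKdef, Real.volume_Icc]; congr 1; ring
  have hv0 : volume K ≠ 0 := by rw [hvol]; exact (ENNReal.ofReal_pos.2 (by linarith)).ne'
  have hvt : volume K ≠ ⊤ := by rw [hvol]; exact ENNReal.ofReal_ne_top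
  have hprob : IsProbabilityMeasure ((volume K)⁻¹ • (volume : Measure ℝ).restrict K) :=
    ⟨by simp [ENNReal.inv_mul_cancel hv0 hvt]⟩
  refine energy_comap_le (ν := (volume K)⁻¹ • (volume : Measure ℝ).restrict K) (C := (volume K)⁻¹)
    hS hθ hpar hκ hc hw hB isCompact_Icc
    (fun z hz => habS (Set.Ioo_subset_Icc_self (hball hz).1))
    (fun z hz h => (hball hz).2 (h ▸ Set.mem_insert _ _))
    (fun z hz => hFw z ⟨habS (Set.Ioo_subset_Icc_self (hball hz).1),
      fun h => (hball hz).2 (Set.mem_insert_of_mem _ h)⟩)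
    ((Measure.AbsolutelyContinuous.rfl.smul_left _).ae_le (ae_restrict_mem measurableSet_Icc))
    (ENNReal.inv_ne_top.2 hv0) ?_
  gcongr
  exact Measure.restrict_le_self

/-- The measure μ is regularised, by conditioning and smearing, to a law ν of bounded density with
energy still below a. Jensen's inequality for independent particles with law ν then gives an
exponent that is -n² times nearly the energy of ν. -/
lemma AdmissibleWeights.eventually_le_partitionFunction {p : ℕ → ℕ} {W : ℕ → ℝ → ℝ}
    (h : AdmissibleWeights S θ κ p W w) (hS : IsClosed S)
    (hSint : ∀ x ∈ S, ∃ a b : ℝ, a < b ∧ x ∈ Set.Icc a b ∧ Set.Icc a b ⊆ S)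
    (hθ : 1 ≤ θ) (hpar : Even θ → S ⊆ Set.Ici 0) (hκ : 0 < κ)
    (hp : Tendsto (fun n : ℕ => (p n : ℝ) / n) atTop (𝓝 κ)) {μ : ProbabilityMeasure S} {a : ℝ}
    (ha : energy S θ κ w μ < a) :
    ∀ᶠ n : ℕ in atTop,
      ENNReal.ofReal (Real.exp (-((n : ℝ) ^ 2 * a))) ≤ partitionFunction S θ (p n) (W n) := by
  have hSm := hS.measurableSet
  obtain ⟨B, -, hB⟩ := exists_tilted_le hS h.continuousOn h.vanishing
  obtain ⟨F₀, hF₀, hF₀w, hlow⟩ := h.lower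
  -- The origin is added because the geometric sum in `smoothPart` may vanish there.
  set F := insert 0 F₀ with hFdef
  have hF : F.Finite := hF₀.insert 0
  have hFw : ∀ x ∈ S \ F, 0 < w x := fun x hx =>
    hF₀w x ⟨hx.1, fun h => hx.2 (Set.mem_insert_of_mem _ h)⟩
  obtain ⟨a₀, h1, h2⟩ := EReal.lt_iff_exists_real_btwn.1 ha
  have h2' : a₀ < a := by exact_mod_cast h2
  obtain ⟨hg, hi, hle⟩ :=
    integrable_realInteraction_of_energy_le hθ hκ h.continuousOn h.nonneg hB h1.le
  set P := (μ : Measure S).map ((↑) : S → ℝ) with hPdef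
  have hPprob : IsProbabilityMeasure P :=
    Measure.isProbabilityMeasure_map measurable_subtype_coe.aemeasurable
  have hemb := measurableEmbedding_prodMap_coe hSm
  have hPP : ((μ : Measure S).prod (μ : Measure S)).map (Prod.map (↑) (↑)) = P.prod P :=
    map_prodMap_coe
  have hPS : ∀ᵐ x ∂P, x ∈ S := by
    rw [hPdef, (MeasurableEmbedding.subtype_coe hSm).ae_map_iff]
    exact ae_of_all _ fun x => x.2
  have hPpow : ∀ᵐ z ∂P.prod P, z.1 ^ θ ≠ z.2 ^ θ := by
    rw [← hPP, hemb.ae_map_iff]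
    exact hg.mono fun z hz => hz.1
  have hPint : Integrable (fun z : ℝ × ℝ => realInteraction θ κ w z.1 z.2) (P.prod P) := by
    rw [← hPP, hemb.integrable_map_iff]
    exact hi
  have hPlt : ∫ z, realInteraction θ κ w z.1 z.2 ∂P.prod P < a := by
    rw [← hPP, hemb.integral_map]
    exact hle.trans_lt h2'
  obtain ⟨k, P', hP', hk, hpow', hint', hlt'⟩ :=
    exists_innerSet_energy_lt hS hSint hF hPS hPpow hPint hPlt
  obtain ⟨ν, C, hν, hC, hC0, hνC, hνK, hνlt⟩ := exists_smear_energy_lt hS hθ hpar h.continuousOn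
    (Set.mem_insert 0 F₀) hFw hk hpow' hint' hκ hlt'
  set K := outerSet S F k with hKdef
  have hKc := isCompact_outerSet hS F k
  have hKS : K ⊆ S := fun x hx => hx.1
  have hK0 : ∀ x ∈ K, x ≠ 0 := fun x hx h =>
    (outerSet_subset S F k hx).2 (h ▸ Set.mem_insert 0 F₀)
  have hKw : ∀ x ∈ K, 0 < w x := fun x hx => hFw x (outerSet_subset S F k hx)
  have hKF₀ : K ⊆ S \ F₀ := fun x hx =>
    ⟨hx.1, fun h => (outerSet_subset S F k hx).2 (Set.mem_insert_of_mem _ h)⟩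
  obtain ⟨-, hνpow, hνint, -⟩ :=
    integrable_of_le_smul_volume (κ := κ) hθ hpar h.continuousOn hKc hKS hK0 hKw hνK hC hνC
  have hνS : ∀ᵐ x ∂ν, x ∈ S := hνK.mono fun x hx => hKS hx
  have hlogw : Integrable (fun x => Real.log (w x)) ν := by
    have h3 : ContinuousOn (fun x => Real.log (w x)) K :=
      (h.continuousOn.mono hKS).log fun x hx => (hKw x hx).ne'
    have h4 := h3.integrableOn_compact (μ := ν) hKc
    rwa [IntegrableOn, Measure.restrict_eq_self_of_ae_mem hνK] at h4
  have hℓ : Integrable (fun z : ℝ × ℝ => Real.log (|z.1 - z.2| * |z.1 ^ θ - z.2 ^ θ|)) (ν.prod ν) ∧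
      ∫ z, realInteraction θ κ w z.1 z.2 ∂ν.prod ν =
        -(κ ^ 2 / 2 * ∫ z : ℝ × ℝ, Real.log (|z.1 - z.2| * |z.1 ^ θ - z.2 ^ θ|) ∂ν.prod ν)
          - κ * ∫ x, Real.log (w x) ∂ν := by
    have e1 : Integrable (fun z : ℝ × ℝ => κ / 2 * (Real.log (w z.1) + Real.log (w z.2))) (ν.prod ν) :=
      ((hlogw.comp_fst ν).add (hlogw.comp_snd ν)).const_mul _
    have e2 : (fun z : ℝ × ℝ => -(κ ^ 2 / 2) * Real.log (|z.1 - z.2| * |z.1 ^ θ - z.2 ^ θ|))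
        =ᵐ[ν.prod ν] fun z => realInteraction θ κ w z.1 z.2
          + κ / 2 * (Real.log (w z.1) + Real.log (w z.2)) := by
      filter_upwards [hνpow] with z hz
      have h5 : |z.1 - z.2| ≠ 0 := abs_ne_zero.2 (sub_ne_zero.2 fun h => hz (by rw [h]))
      have h6 : |z.1 ^ θ - z.2 ^ θ| ≠ 0 := abs_ne_zero.2 (sub_ne_zero.2 hz)
      rw [realInteraction, Real.log_mul h5 h6, Real.log_inv, Real.log_inv]
      ring
    have e3 : Integrable (fun z : ℝ × ℝ => -(κ ^ 2 / 2) *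
        Real.log (|z.1 - z.2| * |z.1 ^ θ - z.2 ^ θ|)) (ν.prod ν) := (hνint.add e1).congr e2.symm
    have e4 : -(κ ^ 2 / 2) ≠ 0 := by
      have := pow_pos hκ 2
      exact neg_ne_zero.2 (by positivity)
    refine ⟨(integrable_const_mul_iff (isUnit_iff_ne_zero.2 e4) _).1 e3, ?_⟩
    have e5 := integral_congr_ae e2
    rw [integral_const_mul, integral_add hνint e1, integral_const_mul,
      integral_add (hlogw.comp_fst ν) (hlogw.comp_snd ν), integral_fun_fst (fun x => Real.log (w x)),
      integral_fun_snd (fun x => Real.log (w x))] at e5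
    simp only [probReal_univ, one_smul] at e5
    linarith
  obtain ⟨hℓi, hℓe⟩ := hℓ
  set ℓ := ∫ z : ℝ × ℝ, Real.log (|z.1 - z.2| * |z.1 ^ θ - z.2 ^ θ|) ∂ν.prod ν with hℓdef
  set V := ∫ x, Real.log (w x) ∂ν with hV
  set gap := a - ∫ z, realInteraction θ κ w z.1 z.2 ∂ν.prod ν with hgap
  have hgap0 : 0 < gap := sub_pos.2 hνlt
  -- The weights are only known to exceed (w exp(-δ)) ^ n. This lowers the limiting exponent by κ δ,
  -- half of the gap.
  set δ := gap / (2 * κ) with hδ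
  have hδ0 : 0 < δ := by positivity
  have hκδ : κ * δ = gap / 2 := by rw [hδ]; field_simp
  set ν' := ν.comap ((↑) : S → ℝ) with hν'
  have hν'p : IsProbabilityMeasure ν' := isProbabilityMeasure_comap_coe hSm hνS
  have hmapν : ν'.map ((↑) : S → ℝ) = ν := map_comap_coe hSm hνS
  have hmapνν : (ν'.prod ν').map (Prod.map (↑) (↑)) = ν.prod ν := by
    rw [map_prodMap_coe, hmapν]
  have hSe := MeasurableEmbedding.subtype_coe hSm
  have hCr : 0 < C.toReal := ENNReal.toReal_pos hC0 hC
  -- the exponent, normalised by `n ^ 2`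
  have hpn : Tendsto (fun n : ℕ => ((p n : ℝ) - 1) / n) atTop (𝓝 κ) := by
    have := hp.sub tendsto_one_div_atTop_nhds_zero_nat
    rw [sub_zero] at this
    exact this.congr fun n => by ring
  have hlim : Tendsto (fun n : ℕ => (p n : ℝ) / n * (V - δ) + (p n : ℝ) / n * (((p n : ℝ) - 1) / n) / 2 * ℓ
      - (p n : ℝ) / n * (1 / n) * Real.log C.toReal) atTop
      (𝓝 (κ * (V - δ) + κ * κ / 2 * ℓ - κ * 0 * Real.log C.toReal)) :=
    ((hp.mul_const _).add (((hp.mul hpn).div_const 2).mul_const ℓ)).sub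
      ((hp.mul tendsto_one_div_atTop_nhds_zero_nat).mul_const _)
  have hlim0 : -a < κ * (V - δ) + κ * κ / 2 * ℓ - κ * 0 * Real.log C.toReal := by
    have : κ * (V - δ) + κ * κ / 2 * ℓ = -(∫ z, realInteraction θ κ w z.1 z.2 ∂ν.prod ν) - gap / 2 := by
      rw [hℓe, ← hκδ]; ring
    rw [this]; linarith
  filter_upwards [hlim.eventually (lt_mem_nhds hlim0), hlow K hKF₀ hKc δ hδ0,
    eventually_gt_atTop 0] with n hn hWn hn0
  have hn0' : (0 : ℝ) < n := by exact_mod_cast hn0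
  have hJ := ofReal_exp_le_partitionFunction (m := p n) (θ := θ) (W := W n) hSm (ν := ν') hC hC0
    (comap_coe_le hSm hνC) (g := fun x => n * (Real.log (w x) - δ)) ?_ ?_ ?_ ?_
  · have i1 : ∫ x : S, (n : ℝ) * (Real.log (w x) - δ) ∂ν' = n * (V - δ) := by
      rw [← hSe.integral_map (g := fun x : ℝ => (n : ℝ) * (Real.log (w x) - δ)), hmapν, integral_const_mul,
        integral_sub hlogw (integrable_const _)]
      simp [hV]
    have i2 : ∫ z : S × S, Real.log (|(z.1 : ℝ) - z.2| * |(z.1 : ℝ) ^ θ - (z.2 : ℝ) ^ θ|) ∂ν'.prod ν' = ℓ := by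
      rw [hℓdef, ← hmapνν, hemb.integral_map]
      rfl
    rw [i1, i2] at hJ
    have hCe : C ^ p n = ENNReal.ofReal (Real.exp (p n * Real.log C.toReal)) := by
      rw [Real.exp_nat_mul, Real.exp_log hCr, ENNReal.ofReal_pow hCr.le, ENNReal.ofReal_toReal hC]
    have hE : -((n : ℝ) ^ 2 * a) + p n * Real.log C.toReal ≤
        p n * (n * (V - δ)) + (p n * (p n - 1) / 2 : ℝ) * ℓ := by
      have := mul_le_mul_of_nonneg_left hn.le (by positivity : (0 : ℝ) ≤ n ^ 2)
      have e : (n : ℝ) ^ 2 * ((p n : ℝ) / n * (V - δ) + (p n : ℝ) / n * (((p n : ℝ) - 1) / n) / 2 * ℓ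
        - (p n : ℝ) / n * (1 / n) * Real.log C.toReal) =
        p n * (n * (V - δ)) + (p n * (p n - 1) / 2 : ℝ) * ℓ - p n * Real.log C.toReal := by
        field_simp
      rw [e] at this
      linarith
    have h7 : C ^ p n * ENNReal.ofReal (Real.exp (-((n : ℝ) ^ 2 * a))) ≤
        C ^ p n * partitionFunction S θ (p n) (W n) := by
      refine le_trans ?_ hJ
      rw [hCe, ← ENNReal.ofReal_mul (Real.exp_pos _).le, ← Real.exp_add]
      exact ENNReal.ofReal_le_ofReal (Real.exp_le_exp.2 (by linarith))
    exact (ENNReal.mul_le_mul_iff_right (pow_ne_zero _ hC0) (ENNReal.pow_ne_top hC)).1 h7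
  · have : Integrable (fun x : ℝ => (n : ℝ) * (Real.log (w x) - δ)) ν :=
      (hlogw.sub (integrable_const δ)).const_mul _
    rw [← hmapν, hSe.integrable_map_iff] at this
    exact this
  · have hνK' := hνK
    rw [← hmapν, hSe.ae_map_iff] at hνK'
    filter_upwards [hνK'] with x hx
    refine le_trans (le_of_eq ?_) (hWn x hx)
    rw [Real.exp_nat_mul, sub_eq_add_neg, Real.exp_add, Real.exp_log (hKw x hx)]
  · rw [← hmapνν, hemb.ae_map_iff] at hνpow
    exact hνpow
  · rw [← hmapνν, hemb.integrable_map_iff] at hℓi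
    exact hℓi

end

end Biorthogonal
end

noncomputable section
namespace Biorthogonal

/-! ### Large deviations for admissible weights -/

namespace AdmissibleWeights

variable {S : Set ℝ} {θ : ℕ} {κ : ℝ} {p : ℕ → ℕ} {W : ℕ → ℝ → ℝ} {w : ℝ → ℝ}

lemma exists_energy_lt_top (h : AdmissibleWeights S θ κ p W w) (hS : IsClosed S) (hne : S.Nonempty)
    (hSint : ∀ x ∈ S, ∃ a b : ℝ, a < b ∧ x ∈ Set.Icc a b ∧ Set.Icc a b ⊆ S)
    (hθ : 1 ≤ θ) (hpar : Even θ → S ⊆ Set.Ici 0) (hκ : 0 < κ) :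
    ∃ μ : ProbabilityMeasure S, energy S θ κ w μ < ⊤ := by
  obtain ⟨B, -, hB⟩ := exists_tilted_le hS h.continuousOn h.vanishing
  obtain ⟨F, hF, hFw, -⟩ := h.lower
  exact Biorthogonal.exists_energy_lt_top hS hne hSint hθ hpar hκ h.continuousOn h.nonneg hB hF hFw

/-- A real infimum means that passing from `energy` to `rate` is a genuine subtraction, with no
infinite constants. -/
lemma exists_iInf_energy_eq (h : AdmissibleWeights S θ κ p W w) (hS : IsClosed S) (hne : S.Nonempty)
    (hSint : ∀ x ∈ S, ∃ a b : ℝ, a < b ∧ x ∈ Set.Icc a b ∧ Set.Icc a b ⊆ S)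
    (hθ : 1 ≤ θ) (hpar : Even θ → S ⊆ Set.Ici 0) (hκ : 0 < κ) :
    ∃ e : ℝ, ⨅ ν : ProbabilityMeasure S, energy S θ κ w ν = (e : EReal) := by
  obtain ⟨B, -, hB⟩ := exists_tilted_le hS h.continuousOn h.vanishing
  obtain ⟨μ, hμ⟩ := h.exists_energy_lt_top hS hne hSint hθ hpar hκ
  have h1 : ⨅ ν : ProbabilityMeasure S, energy S θ κ w ν ≠ ⊤ := ((iInf_le _ μ).trans_lt hμ).ne
  have h2 : ⨅ ν : ProbabilityMeasure S, energy S θ κ w ν ≠ ⊥ :=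
    ((EReal.bot_lt_coe _).trans_le (le_iInf fun ν =>
      neg_le_energy hθ hκ h.continuousOn h.nonneg hB ν)).ne'
  exact ⟨_, (EReal.coe_toReal h1 h2).symm⟩

variable [∀ n, NeZero (p n)]

/-- The partition function is eventually finite and positive. -/
lemma eventually_isProbabilityMeasure (h : AdmissibleWeights S θ κ p W w) (hS : IsClosed S)
    (hne : S.Nonempty)
    (hSint : ∀ x ∈ S, ∃ a b : ℝ, a < b ∧ x ∈ Set.Icc a b ∧ Set.Icc a b ⊆ S)
    (hθ : 1 ≤ θ) (hpar : Even θ → S ⊆ Set.Ici 0) (hκ : 0 < κ)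
    (hp : Tendsto (fun n : ℕ => (p n : ℝ) / n) atTop (𝓝 κ)) :
    ∀ᶠ n in atTop, IsProbabilityMeasure (particleLaw S θ (p n) (W n)) := by
  obtain ⟨B, -, hB⟩ := exists_tilted_le hS h.continuousOn h.vanishing
  obtain ⟨μ, hμ⟩ := h.exists_energy_lt_top hS hne hSint hθ hpar hκ
  obtain ⟨a, ha, -⟩ := EReal.lt_iff_exists_real_btwn.1 hμ
  obtain ⟨a', -, hup⟩ := h.eventually_unnormalizedLaw_le (a := -(κ * Real.log (B + 1)) - 1)
    hS hθ hκ hp isClosed_univ fun ν _ hν => by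
      have := (neg_le_energy hθ hκ h.continuousOn h.nonneg hB ν).trans hν
      rw [EReal.coe_le_coe_iff] at this
      linarith
  filter_upwards [h.eventually_le_partitionFunction hS hSint hθ hpar hκ hp ha, hup] with n h1 h2
  have hZ0 : partitionFunction S θ (p n) (W n) ≠ 0 :=
    ((ENNReal.ofReal_pos.2 (Real.exp_pos _)).trans_le h1).ne'
  have hZt : partitionFunction S θ (p n) (W n) ≠ ⊤ := by
    refine (lt_of_le_of_lt ?_ (ENNReal.ofReal_lt_top (r := Real.exp (-((n : ℝ) ^ 2 * a'))))).ne
    simpa [partitionFunction] using h2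
  refine ⟨?_⟩
  rw [particleLaw, Measure.smul_apply, smul_eq_mul]
  exact ENNReal.inv_mul_cancel hZ0 hZt

/-- The exponential bound in terms of energies. -/
lemma exists_eventually_particleLaw_le (h : AdmissibleWeights S θ κ p W w) (hS : IsClosed S)
    (hSint : ∀ x ∈ S, ∃ a b : ℝ, a < b ∧ x ∈ Set.Icc a b ∧ Set.Icc a b ⊆ S)
    (hθ : 1 ≤ θ) (hpar : Even θ → S ⊆ Set.Ici 0) (hκ : 0 < κ)
    (hp : Tendsto (fun n : ℕ => (p n : ℝ) / n) atTop (𝓝 κ))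
    {A : Set (ProbabilityMeasure S)} (hA : IsClosed A) {a : ℝ}
    (hAa : ∀ ν ∈ A, ¬ energy S θ κ w ν ≤ (a : EReal)) :
    ∃ a' > a, ∀ b : ℝ, ∀ μ, energy S θ κ w μ < b → ∀ᶠ n : ℕ in atTop,
      particleLaw S θ (p n) (W n) {x | empiricalMeasure x ∈ A} ≤
        ENNReal.ofReal (Real.exp (-((n : ℝ) ^ 2 * (a' - b)))) := by
  obtain ⟨a', ha', hup⟩ := h.eventually_unnormalizedLaw_le hS hθ hκ hp hA hAa
  refine ⟨a', ha', fun b μ hμ => ?_⟩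
  filter_upwards [h.eventually_le_partitionFunction hS hSint hθ hpar hκ hp hμ, hup] with n h1 h2
  have h3 : (partitionFunction S θ (p n) (W n))⁻¹ ≤ ENNReal.ofReal (Real.exp ((n : ℝ) ^ 2 * b)) := by
    rw [ENNReal.inv_le_iff_inv_le, ← ENNReal.ofReal_inv_of_pos (Real.exp_pos _), ← Real.exp_neg]
    exact h1
  rw [particleLaw, Measure.smul_apply, smul_eq_mul]
  refine (mul_le_mul' h3 h2).trans (le_of_eq ?_)
  rw [← ENNReal.ofReal_mul (Real.exp_pos _).le, ← Real.exp_add]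
  congr 2; ring

/-- The strong law of large numbers when the energy has a unique minimiser. -/
theorem ae_tendsto_empiricalMeasure (h : AdmissibleWeights S θ κ p W w) (hS : IsClosed S)
    (hne : S.Nonempty)
    (hSint : ∀ x ∈ S, ∃ a b : ℝ, a < b ∧ x ∈ Set.Icc a b ∧ Set.Icc a b ⊆ S)
    (hθ : 1 ≤ θ) (hpar : Even θ → S ⊆ Set.Ici 0) (hκ : 0 < κ)
    (hp : Tendsto (fun n : ℕ => (p n : ℝ) / n) atTop (𝓝 κ))
    {μ : ProbabilityMeasure S} (hμ : ∀ ν, energy S θ κ w ν ≤ energy S θ κ w μ → ν = μ)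
    {Ω : Type*} [MeasurableSpace Ω] (P : Measure Ω) (X : ∀ n, Ω → Fin (p n) → S)
    (hX : ∀ᶠ n in atTop, HasLaw (X n) (particleLaw S θ (p n) (W n)) P) :
    ∀ᵐ ω ∂P, Tendsto (fun n => empiricalMeasure (X n ω)) atTop (𝓝 μ) := by
  obtain ⟨B, -, hB⟩ := exists_tilted_le hS h.continuousOn h.vanishing
  have htop : energy S θ κ w μ < ⊤ := by
    obtain ⟨ν, hν⟩ := h.exists_energy_lt_top hS hne hSint hθ hpar hκ
    -- If the energy at μ were ⊤, the hypothesis would identify the finite-energy measure ν with μ.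
    by_contra hcon
    rw [not_lt_top_iff] at hcon
    exact hcon.not_lt (hμ ν (hcon ▸ le_top) ▸ hν)
  obtain ⟨e, he⟩ : ∃ e : ℝ, energy S θ κ w μ = (e : EReal) :=
    ⟨_, (EReal.coe_toReal htop.ne ((EReal.bot_lt_coe _).trans_le
      (neg_le_energy hθ hκ h.continuousOn h.nonneg hB μ)).ne').symm⟩
  -- A countable neighbourhood basis reduces almost sure convergence to countably many almost sure
  -- events.
  obtain ⟨U, hU⟩ := (𝓝 μ).exists_antitone_basis
  suffices hk : ∀ k, ∀ᵐ ω ∂P, ∀ᶠ n in atTop, empiricalMeasure (X n ω) ∈ interior (U k) by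
    filter_upwards [ae_all_iff.2 hk] with ω hω
    rw [hU.1.tendsto_right_iff]
    exact fun k _ => (hω k).mono fun n hn => interior_subset hn
  intro k
  have hμU : μ ∈ interior (U k) := mem_interior_iff_mem_nhds.2 (hU.1.mem_of_mem trivial)
  obtain ⟨a, ha, hbound⟩ := h.exists_eventually_particleLaw_le hS hSint hθ hpar hκ hp
    (isOpen_interior (s := U k)).isClosed_compl (a := e) fun ν hν hle => hν (hμ ν (he ▸ hle) ▸ hμU)
  set c := (a - e) / 2 with hc
  have hc0 : 0 < c := by rw [hc]; linarith
  have hev := hbound (e + c) μ (by rw [he, EReal.coe_lt_coe_iff]; linarith)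
  obtain ⟨N, hN⟩ := eventually_atTop.1 (hev.and hX)
  -- Requiring N ≤ n empties the sets for small n, where no estimate is available, so the geometric
  -- bound holds for every n and Borel–Cantelli applies. No joint law is involved, since only the
  -- individual probabilities are summed.
  set s : ℕ → Set Ω := fun n => {ω | N ≤ n ∧ empiricalMeasure (X n ω) ∉ interior (U k)} with hs
  have hsum : ∑' n, P (s n) ≠ ⊤ := by
    have hle : ∀ n, P (s n) ≤ ENNReal.ofReal (Real.exp (-c) ^ n) := by
      intro n
      by_cases hn : N ≤ n
      · obtain ⟨h1, h2⟩ := hN n hn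
        calc P (s n) ≤ P (X n ⁻¹' {x | empiricalMeasure x ∈ (interior (U k))ᶜ}) :=
              measure_mono fun ω hω => hω.2
          _ ≤ P.map (X n) {x | empiricalMeasure x ∈ (interior (U k))ᶜ} :=
              Measure.le_map_apply h2.aemeasurable _
          _ = _ := by rw [h2.map_eq]
          _ ≤ _ := h1
          _ ≤ _ := by
              refine ENNReal.ofReal_le_ofReal ?_
              rw [← Real.exp_nat_mul]
              refine Real.exp_le_exp.2 ?_
              have h3 : a - (e + c) = c := by rw [hc]; ring
              have h4 : (n : ℝ) ≤ (n : ℝ) ^ 2 := by exact_mod_cast Nat.le_self_pow two_ne_zero n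
              rw [h3]
              nlinarith
      · have : s n = ∅ := by ext ω; simp [hs, hn]
        rw [this]; simp
    refine ne_top_of_le_ne_top ?_ (ENNReal.tsum_le_tsum hle)
    exact (summable_geometric_of_lt_one (Real.exp_pos _).le
      (by rw [Real.exp_lt_one_iff]; linarith)).tsum_ofReal_ne_top
  filter_upwards [ae_eventually_notMem hsum] with ω hω
  filter_upwards [hω, eventually_ge_atTop N] with n hn hnN
  by_contra hcon
  exact hn ⟨hnN, hcon⟩

/-- With e the minimal energy, the numerator decays at a rate above e + t, and a competitor of
energy below e + (t - s) bounds the partition function; the difference of the two rates exceeds s.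
-/
lemma eventually_particleLaw_le_rate (h : AdmissibleWeights S θ κ p W w) (hS : IsClosed S)
    (hne : S.Nonempty)
    (hSint : ∀ x ∈ S, ∃ a b : ℝ, a < b ∧ x ∈ Set.Icc a b ∧ Set.Icc a b ⊆ S)
    (hθ : 1 ≤ θ) (hpar : Even θ → S ⊆ Set.Ici 0) (hκ : 0 < κ)
    (hp : Tendsto (fun n : ℕ => (p n : ℝ) / n) atTop (𝓝 κ))
    {A : Set (ProbabilityMeasure S)} (hA : IsClosed A) {s t : ℝ} (hst : s < t)
    (ht : ∀ ν ∈ A, ¬ rate S θ κ w ν ≤ t) :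
    ∀ᶠ n : ℕ in atTop, particleLaw S θ (p n) (W n) {x | empiricalMeasure x ∈ A} ≤
        ENNReal.ofReal (Real.exp (-((n : ℝ) ^ 2 * s))) := by
  obtain ⟨e, he⟩ := h.exists_iInf_energy_eq hS hne hSint hθ hpar hκ
  have hb : ⨅ ν : ProbabilityMeasure S, energy S θ κ w ν < ((e + (t - s) : ℝ) : EReal) := by
    rw [he, EReal.coe_lt_coe_iff]; linarith
  obtain ⟨μ, hμ⟩ := iInf_lt_iff.1 hb
  obtain ⟨a, ha, hbound⟩ := h.exists_eventually_particleLaw_le hS hSint hθ hpar hκ hp hA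
    (a := e + t) fun ν hν hle => ht ν hν (by
      rw [rate, he]
      calc energy S θ κ w ν + -(e : EReal) ≤ ((e + t : ℝ) : EReal) + -(e : EReal) := by gcongr
        _ = _ := by
          rw [← EReal.coe_neg, ← EReal.coe_add]
          congr 1; ring)
  filter_upwards [hbound _ μ hμ] with n hn
  refine hn.trans (ENNReal.ofReal_le_ofReal (Real.exp_le_exp.2 (neg_le_neg ?_)))
  gcongr
  linarith

/-- The exponential bound for closed sets, when the infimum of the rate is finite. -/
theorem eventually_particleLaw_le_half (h : AdmissibleWeights S θ κ p W w) (hS : IsClosed S)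
    (hne : S.Nonempty)
    (hSint : ∀ x ∈ S, ∃ a b : ℝ, a < b ∧ x ∈ Set.Icc a b ∧ Set.Icc a b ⊆ S)
    (hθ : 1 ≤ θ) (hpar : Even θ → S ⊆ Set.Ici 0) (hκ : 0 < κ)
    (hp : Tendsto (fun n : ℕ => (p n : ℝ) / n) atTop (𝓝 κ))
    {A : Set (ProbabilityMeasure S)} (hA : IsClosed A) (hr : (⨅ ν ∈ A, rate S θ κ w ν) ≠ ⊤) :
    ∀ᶠ n : ℕ in atTop, particleLaw S θ (p n) (W n) {x | empiricalMeasure x ∈ A} ≤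
        ENNReal.ofReal (Real.exp (-((n : ℝ) ^ 2 * (⨅ ν ∈ A, rate S θ κ w ν).toReal / 2))) := by
  set r := ⨅ ν ∈ A, rate S θ κ w ν with hrdef
  obtain ⟨e, he⟩ := h.exists_iInf_energy_eq hS hne hSint hθ hpar hκ
  have hnonneg : 0 ≤ r := by
    refine le_iInf₂ fun ν _ => ?_
    rw [rate, he]
    have h1 : (e : EReal) ≤ energy S θ κ w ν := he ▸ iInf_le _ ν
    calc (0 : EReal) = (e : EReal) + -(e : EReal) := by
          rw [← EReal.coe_neg, ← EReal.coe_add]; simp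
      _ ≤ _ := by gcongr
  obtain ⟨ρ, hρ⟩ : ∃ ρ : ℝ, r = (ρ : EReal) :=
    ⟨_, (EReal.coe_toReal hr ((EReal.bot_lt_zero).trans_le hnonneg).ne').symm⟩
  have hρ0 : 0 ≤ ρ := by rw [hρ] at hnonneg; exact_mod_cast hnonneg
  rw [hρ, EReal.toReal_coe]
  -- If ρ = 0 the bound is 1. Otherwise 3ρ/4 lies strictly between the claimed rate ρ/2 and the
  -- infimum ρ.
  rcases hρ0.eq_or_lt with h0 | h0
  · filter_upwards [h.eventually_isProbabilityMeasure hS hne hSint hθ hpar hκ hp] with n hn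
    rw [← h0]
    simpa using prob_le_one
  · have := h.eventually_particleLaw_le_rate hS hne hSint hθ hpar hκ hp hA
      (by linarith : ρ / 2 < 3 * ρ / 4) fun ν hν hle => by
        have h1 : (ρ : EReal) ≤ ((3 * ρ / 4 : ℝ) : EReal) := hρ ▸ (iInf₂_le ν hν).trans hle
        rw [EReal.coe_le_coe_iff] at h1
        linarith
    simpa only [mul_div_assoc] using this

/-- The exponential bound for closed sets on which the rate is infinite. -/
theorem eventually_particleLaw_le_of_top (h : AdmissibleWeights S θ κ p W w) (hS : IsClosed S)
    (hne : S.Nonempty)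
    (hSint : ∀ x ∈ S, ∃ a b : ℝ, a < b ∧ x ∈ Set.Icc a b ∧ Set.Icc a b ⊆ S)
    (hθ : 1 ≤ θ) (hpar : Even θ → S ⊆ Set.Ici 0) (hκ : 0 < κ)
    (hp : Tendsto (fun n : ℕ => (p n : ℝ) / n) atTop (𝓝 κ))
    {A : Set (ProbabilityMeasure S)} (hA : IsClosed A) (hr : (⨅ ν ∈ A, rate S θ κ w ν) = ⊤)
    (M : ℝ) :
    ∀ᶠ n : ℕ in atTop, particleLaw S θ (p n) (W n) {x | empiricalMeasure x ∈ A} ≤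
        ENNReal.ofReal (Real.exp (-((n : ℝ) ^ 2 * M))) :=
  h.eventually_particleLaw_le_rate hS hne hSint hθ hpar hκ hp hA (lt_add_one M) fun ν hν hle =>
    (EReal.coe_lt_top _).not_ge (hr ▸ (iInf₂_le ν hν).trans hle)

end AdmissibleWeights

end Biorthogonal
end

noncomputable section
namespace Biorthogonal

/-! ### Varying weights -/

section

variable {S : Set ℝ} {θ : ℕ} {κ : ℝ} {p : ℕ → ℕ} {wn : ℕ → ℝ → ℝ} {w : ℝ → ℝ}

/-- For |x| > 1 the power of 1 + |x| is at most 2 ^ c times the power of |x|, and the supremum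
controls all n ≥ n₀ at once. -/
lemma ConditionA2.exists_forall_le (h : ConditionA2 S θ κ wn) (hκ : 0 < κ) :
    ∃ n₀ : ℕ, ∃ ε : ℝ, 0 < ε ∧ ∀ η : ℝ, 0 < η → ∃ R : ℝ, 1 ≤ R ∧ ∀ x ∈ S, R < |x| → ∀ n ≥ n₀,
      (1 + |x|) ^ (((θ : ℝ) + 1) * (κ + ε)) * wn n x ≤ η := by
  obtain ⟨n₀, ε, hε, h⟩ := h
  refine ⟨n₀, ε, hε, fun η hη => ?_⟩
  set c := ((θ : ℝ) + 1) * (κ + ε) with hc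
  have hc0 : 0 ≤ c := by positivity
  have h2 : (0 : ℝ) < 2 ^ c := by positivity
  have hpos : (0 : ℝ≥0∞) < ENNReal.ofReal (η / 2 ^ c) := ENNReal.ofReal_pos.2 (by positivity)
  have h1 := h.eventually (gt_mem_nhds hpos)
  rw [eventually_inf_principal, ← comap_norm_atTop, eventually_comap] at h1
  obtain ⟨R, hR⟩ := eventually_atTop.1 h1
  refine ⟨max R 1, le_max_right _ _, fun x hx hxR n hn => ?_⟩
  have hx1 : 1 < |x| := (le_max_right _ _).trans_lt hxR
  have h3 := hR |x| ((le_max_left _ _).trans hxR.le) x rfl hx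
  have h4 : ENNReal.ofReal (|x| ^ c * wn n x) ≤ ENNReal.ofReal (η / 2 ^ c) := by
    rw [ENNReal.ofReal_mul (by positivity)]
    refine le_trans ?_ h3.le
    gcongr
    exact le_iSup₂ (f := fun n (_ : n₀ ≤ n) => ENNReal.ofReal (wn n x)) n hn
  have h5 : |x| ^ c * wn n x ≤ η / 2 ^ c := (ENNReal.ofReal_le_ofReal_iff (by positivity)).1 h4
  have h6 : (1 + |x|) ^ c ≤ 2 ^ c * |x| ^ c := by
    rw [← Real.mul_rpow (by norm_num) (abs_nonneg x)]
    exact Real.rpow_le_rpow (by positivity) (by linarith) hc0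
  rcases le_or_gt 0 (wn n x) with h7 | h7
  · calc (1 + |x|) ^ c * wn n x ≤ 2 ^ c * |x| ^ c * wn n x := by gcongr
      _ = 2 ^ c * (|x| ^ c * wn n x) := by ring
      _ ≤ 2 ^ c * (η / 2 ^ c) := by gcongr
      _ = η := by field_simp
  · exact (mul_nonpos_of_nonneg_of_nonpos (by positivity) h7.le).trans hη.le

/-- The total exponent per n-th root tends to (θ + 1) κ, so it eventually stays below the exponent
(θ + 1)(κ + ε) available at infinity. -/
lemma tendsto_exponent_div (hp1 : ∀ n, 1 ≤ p n)
    (hp : Tendsto (fun n : ℕ => (p n : ℝ) / n) atTop (𝓝 κ)) :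
    Tendsto (fun n : ℕ => (((θ + 1) * (p n - 1) + 2 : ℕ) : ℝ) / n) atTop (𝓝 (((θ : ℝ) + 1) * κ)) := by
  have h1 := (hp.const_mul ((θ : ℝ) + 1)).add
    (tendsto_one_div_atTop_nhds_zero_nat.const_mul (2 - ((θ : ℝ) + 1)))
  rw [mul_zero, add_zero] at h1
  refine h1.congr fun n => ?_
  push_cast [Nat.cast_sub (hp1 n)]
  ring

/-- Varying weights satisfying the two conditions are admissible. -/
theorem ConditionA1.admissibleWeights (h1 : ConditionA1 S wn w) (h2 : ConditionA2 S θ κ wn)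
    (hS : IsClosed S) (hκ : 0 < κ) (hp1 : ∀ n, 1 ≤ p n)
    (hp : Tendsto (fun n : ℕ => (p n : ℝ) / n) atTop (𝓝 κ))
    (hwn0 : ∀ n, ∀ x ∈ S, 0 ≤ wn n x) :
    AdmissibleWeights S θ κ p (fun n t => wn n t ^ n) w := by
  obtain ⟨n₀, ε, hε, hA2⟩ := h2.exists_forall_le hκ
  set c := ((θ : ℝ) + 1) * κ with hc
  set c' := ((θ : ℝ) + 1) * (κ + ε) with hc'
  have hcc' : c < c' := by rw [hc, hc']; gcongr; linarith
  have hc0 : 0 < c := by positivity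
  have hv : ∀ δ : ℝ, 0 < δ → ∃ R : ℝ, ∀ x ∈ S, R < |x| → tilted θ κ w x ≤ δ := by
    intro δ hδ
    obtain ⟨R, -, hR⟩ := hA2 δ hδ
    refine ⟨R, fun x hx hxR => ?_⟩
    have hlim : Tendsto (fun n => wn n x) atTop (𝓝 (w x)) :=
      (h1.tendsto_weight {x} (by simpa using hx) isCompact_singleton).tendsto_at rfl
    refine le_trans ?_ (le_of_tendsto (hlim.const_mul ((1 + |x|) ^ c'))
      (eventually_atTop.2 ⟨n₀, fun n hn => hR x hx hxR n hn⟩))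
    rw [tilted]
    exact mul_le_mul_of_nonneg_right
      (Real.rpow_le_rpow_of_exponent_le (by linarith [abs_nonneg x]) hcc'.le) (h1.nonneg x hx)
  obtain ⟨B, hB0, hB⟩ := exists_tilted_le hS h1.continuousOn hv
  refine ⟨h1.continuousOn, h1.nonneg, hv, fun n x hx => pow_nonneg (hwn0 n x hx) n, ?_, ?_⟩
  · intro δ hδ
    obtain ⟨R, hR1, hR⟩ := hA2 δ hδ
    have hK : IsCompact (S ∩ Metric.closedBall 0 R) := (isCompact_closedBall 0 R).inter_left hS
    -- For |x| ≤ R, two errors of size η occur: in the exponent of 1 + |x| and in the uniform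
    -- approximation of the weight. Their combined effect on the tilted weight is kept below δ.
    obtain ⟨η, hη, hsmall⟩ : ∃ η : ℝ, 0 < η ∧
        ((1 + R) ^ η - 1) * B + (1 + R) ^ η * ((1 + R) ^ c * η) < δ := by
      have hcont : Tendsto (fun η : ℝ => ((1 + R) ^ η - 1) * B + (1 + R) ^ η * ((1 + R) ^ c * η)) (𝓝 0)
          (𝓝 (((1 + R) ^ (0 : ℝ) - 1) * B + (1 + R) ^ (0 : ℝ) * ((1 + R) ^ c * 0))) := by
        have h3 : Tendsto (fun η : ℝ => (1 + R) ^ η) (𝓝 0) (𝓝 ((1 + R) ^ (0 : ℝ))) :=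
          (Real.continuousAt_const_rpow (by linarith)).tendsto
        exact ((h3.sub_const 1).mul_const B).add (h3.mul (tendsto_id.const_mul _))
      have h4 := hcont.eventually_lt_const (by simpa using hδ)
      obtain ⟨η, h5, h6⟩ := ((h4.filter_mono nhdsWithin_le_nhds).and
        (self_mem_nhdsWithin : Set.Ioi (0 : ℝ) ∈ 𝓝[>] 0)).exists
      exact ⟨η, h6, h5⟩
    have hexp := tendsto_exponent_div (θ := θ) hp1 hp
    have huni := Metric.tendstoUniformlyOn_iff.1
      (h1.tendsto_weight (S ∩ Metric.closedBall 0 R) Set.inter_subset_left hK) η hη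
    filter_upwards [huni, hexp.eventually (gt_mem_nhds hcc'),
      hexp.eventually (gt_mem_nhds (lt_add_of_pos_right c hη)), eventually_ge_atTop n₀,
      eventually_gt_atTop 0] with n e1 e2 e3 e4 e5 x hx
    set N := (θ + 1) * (p n - 1) + 2 with hN
    have hn0 : (n : ℝ) ≠ 0 := by exact_mod_cast e5.ne'
    have hx1 : 1 ≤ 1 + |x| := by linarith [abs_nonneg x]
    have hpow : (1 + |x|) ^ N = ((1 + |x|) ^ ((N : ℝ) / n)) ^ n := by
      rw [← Real.rpow_natCast _ n, ← Real.rpow_mul (by positivity), div_mul_cancel₀ _ hn0,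
        Real.rpow_natCast]
    rw [hpow, ← mul_pow]
    refine pow_le_pow_left₀ (mul_nonneg (by positivity) (hwn0 n x hx)) ?_ n
    have ht0 := tilted_nonneg (θ := θ) (κ := κ) (h1.nonneg x hx)
    -- Beyond R the decay condition alone gives the bound δ, while inside R uniform convergence on
    -- compacts is used.
    rcases lt_or_ge R |x| with h3 | h3
    · have h4 := hR x hx h3 n e4
      have h5 : (1 + |x|) ^ ((N : ℝ) / n) * wn n x ≤ (1 + |x|) ^ c' * wn n x :=
        mul_le_mul_of_nonneg_right (Real.rpow_le_rpow_of_exponent_le hx1 e2.le) (hwn0 n x hx)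
      linarith
    · have h4 : wn n x ≤ w x + η := by
        have := e1 x ⟨hx, by simpa using h3⟩
        rw [Real.dist_eq] at this
        linarith [(abs_lt.1 this).1]
      have h5 : (1 + |x|) ^ ((N : ℝ) / n) ≤ (1 + |x|) ^ c * (1 + R) ^ η := by
        calc (1 + |x|) ^ ((N : ℝ) / n) ≤ (1 + |x|) ^ (c + η) :=
              Real.rpow_le_rpow_of_exponent_le hx1 e3.le
          _ = (1 + |x|) ^ c * (1 + |x|) ^ η := Real.rpow_add (by linarith) _ _
          _ ≤ _ := by gcongr
      have h6 : (1 + |x|) ^ c ≤ (1 + R) ^ c := by gcongr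
      have h7 := hB x hx
      have h8 : 1 ≤ (1 + R) ^ η := Real.one_le_rpow (by linarith) hη.le
      calc (1 + |x|) ^ ((N : ℝ) / n) * wn n x ≤ (1 + |x|) ^ c * (1 + R) ^ η * (w x + η) :=
            mul_le_mul h5 h4 (hwn0 n x hx) (by positivity)
        _ = (1 + R) ^ η * tilted θ κ w x + (1 + R) ^ η * ((1 + |x|) ^ c * η) := by
            rw [tilted, ← hc]; ring
        _ ≤ (1 + R) ^ η * tilted θ κ w x + (1 + R) ^ η * ((1 + R) ^ c * η) := by gcongr
        _ ≤ tilted θ κ w x + δ := by nlinarith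
  · refine ⟨zeroSet S w, h1.finite_zeroSet, fun x hx => ?_, fun K hKS hK δ hδ => ?_⟩
    · exact (h1.nonneg x hx.1).lt_of_ne' fun h => hx.2 ⟨hx.1, h⟩
    · have hu := Metric.tendstoUniformlyOn_iff.1 (h1.tendsto_log K hKS hK) δ hδ
      filter_upwards [hu, h1.zeroSet_subset] with n e1 e2 x hx
      have hxS := (hKS hx).1
      have hwx : 0 < w x := (h1.nonneg x hxS).lt_of_ne' fun h => (hKS hx).2 ⟨hxS, h⟩
      have hwnx : 0 < wn n x := (hwn0 n x hxS).lt_of_ne' fun h => (hKS hx).2 (e2 ⟨hxS, h⟩)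
      refine pow_le_pow_left₀ (by positivity) ?_ n
      have h3 := e1 x hx
      rw [Real.dist_eq] at h3
      rw [← Real.log_le_log_iff (by positivity) hwnx, Real.log_mul hwx.ne' (Real.exp_pos _).ne',
        Real.log_exp]
      linarith [(abs_lt.1 h3).2]

end

end Biorthogonal
end

noncomputable section
namespace Biorthogonal

/-! ### The weights of the boson model -/

lemma tilted_boson {x : ℝ} (hx : 0 ≤ x) :
    tilted 2 1 (fun t => Real.exp (-t)) x = (1 + x) ^ 3 * Real.exp (-x) := by
  rw [tilted, abs_of_nonneg hx]
  norm_num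

lemma one_add_pow_mul_exp_neg_le (k : ℕ) {x : ℝ} (hx : 0 ≤ x) :
    (1 + x) ^ k * Real.exp (-x) ≤ k.factorial * Real.exp 1 := by
  have h := Real.pow_div_factorial_le_exp (1 + x) (by linarith) k
  rw [div_le_iff₀ (by positivity)] at h
  calc (1 + x) ^ k * Real.exp (-x) ≤ Real.exp (1 + x) * k.factorial * Real.exp (-x) := by gcongr
    _ = k.factorial * (Real.exp (1 + x) * Real.exp (-x)) := by ring
    _ = _ := by rw [← Real.exp_add]; simp

/-- The indices are shifted: entry n has n + 1 particles and exponent n + 1, but is compared with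
n-th powers. The surplus x ^ α exp(-x), even times (1 + x)², is bounded, hence subexponential in n,
and is bounded below on compacts avoiding 0. -/
theorem admissibleWeights_boson (α : ℕ) :
    AdmissibleWeights (Set.Ici 0) 2 1 (fun n => n + 1)
      (fun n t => t ^ α * Real.exp (-((n + 1 : ℕ) * t))) (fun t => Real.exp (-t)) := by
  have hv : ∀ δ : ℝ, 0 < δ → ∃ R : ℝ, ∀ x ∈ Set.Ici (0 : ℝ), R < |x| →
      tilted 2 1 (fun t => Real.exp (-t)) x ≤ δ := by
    intro δ hδ
    have h1 : Tendsto (fun x : ℝ => (1 + x) ^ 3 * Real.exp (-(1 + x))) atTop (𝓝 0) :=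
      (Real.tendsto_pow_mul_exp_neg_atTop_nhds_zero 3).comp (tendsto_atTop_add_const_left _ 1 tendsto_id)
    have h2 := h1.mul_const (Real.exp 1)
    rw [zero_mul] at h2
    obtain ⟨R, hR⟩ := eventually_atTop.1 (h2.eventually_lt_const hδ)
    refine ⟨R, fun x hx hxR => ?_⟩
    rw [tilted_boson hx]
    rw [abs_of_nonneg hx] at hxR
    refine le_trans (le_of_eq ?_) (hR x hxR.le).le
    rw [mul_assoc, ← Real.exp_add]
    congr 2; ring
  have hc : ContinuousOn (fun t : ℝ => Real.exp (-t)) (Set.Ici 0) := by fun_prop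
  refine ⟨hc, fun x _ => (Real.exp_pos _).le, hv,
    fun n x hx => mul_nonneg (pow_nonneg hx _) (Real.exp_pos _).le, fun δ hδ => ?_,
    {0}, Set.finite_singleton 0, fun x _ => Real.exp_pos _, fun K hK hKc δ hδ => ?_⟩
  · obtain ⟨B, hB0, hB⟩ := exists_tilted_le isClosed_Ici hc hv
    -- The bounded surplus factor is eventually below (1 + δ/B) ^ n, and u (1 + δ/B) ≤ u + δ since u
    -- ≤ B.
    have hgrow := (tendsto_pow_atTop_atTop_of_one_lt
      (lt_add_of_pos_right (1 : ℝ) (div_pos hδ hB0))).eventually_ge_atTop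
        ((α + 2).factorial * Real.exp 1)
    filter_upwards [hgrow] with n hn x hx
    have hx0 : 0 ≤ x := hx
    have hu := hB x hx
    have hu0 := tilted_nonneg (θ := 2) (κ := 1) (w := fun t => Real.exp (-t)) (x := x) (Real.exp_pos (-x)).le
    rw [abs_of_nonneg hx0]
    set u := tilted 2 1 (fun t => Real.exp (-t)) x with hudef
    have e1 : (1 + x) ^ ((2 + 1) * (n + 1 - 1) + 2) * (x ^ α * Real.exp (-((n + 1 : ℕ) * x))) =
        u ^ n * ((1 + x) ^ 2 * x ^ α * Real.exp (-x)) := by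
      rw [hudef, tilted_boson hx0, mul_pow, ← Real.exp_nat_mul, ← pow_mul]
      have : Real.exp (-((n + 1 : ℕ) * x)) = Real.exp (n * -x) * Real.exp (-x) := by
        rw [← Real.exp_add]; congr 1; push_cast; ring
      rw [this, Nat.add_sub_cancel, pow_add]
      ring
    have e2 : (1 + x) ^ 2 * x ^ α * Real.exp (-x) ≤ (α + 2).factorial * Real.exp 1 := by
      refine le_trans ?_ (one_add_pow_mul_exp_neg_le (α + 2) hx0)
      rw [pow_add, mul_comm ((1 + x) ^ α)]
      gcongr
      linarith
    rw [e1]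
    calc u ^ n * ((1 + x) ^ 2 * x ^ α * Real.exp (-x)) ≤ u ^ n * (1 + δ / B) ^ n := by
          gcongr; exact e2.trans hn
      _ = (u + u / B * δ) ^ n := by rw [← mul_pow]; congr 1; ring
      _ ≤ (u + δ) ^ n := by
          gcongr
          exact mul_le_of_le_one_left hδ.le (by rw [div_le_one hB0]; exact hu)
  · rcases K.eq_empty_or_nonempty with rfl | hne
    · simp
    have hcont : ContinuousOn (fun x : ℝ => x ^ α * Real.exp (-x)) K := by fun_prop
    obtain ⟨y, hy, hmin⟩ := hKc.exists_isMinOn hne hcont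
    have hy0 : 0 < y := lt_of_le_of_ne (hK hy).1 fun h => (hK hy).2 h.symm
    have hpos : 0 < y ^ α * Real.exp (-y) := by positivity
    -- The allowance exp(-δ n) eventually drops below the positive minimum of x ^ α exp(-x) on K.
    have hlim : Tendsto (fun n : ℕ => Real.exp (-δ) ^ n) atTop (𝓝 0) :=
      tendsto_pow_atTop_nhds_zero_of_lt_one (Real.exp_pos _).le
        (by rw [Real.exp_lt_one_iff]; linarith)
    filter_upwards [hlim.eventually_lt_const hpos] with n hn x hx
    have h1 : y ^ α * Real.exp (-y) ≤ x ^ α * Real.exp (-x) := hmin hx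
    have h2 : Real.exp (-((n + 1 : ℕ) * x)) = Real.exp (-x) ^ n * Real.exp (-x) := by
      rw [← Real.exp_nat_mul, ← Real.exp_add]; congr 1; push_cast; ring
    rw [mul_pow, h2]
    calc Real.exp (-x) ^ n * Real.exp (-δ) ^ n ≤ Real.exp (-x) ^ n * (x ^ α * Real.exp (-x)) := by
          gcongr; linarith
      _ = _ := by ring

end Biorthogonal
end

noncomputable section
namespace Biorthogonal

/-! ### Positivity of the logarithmic energy -/

section LogEnergy

lemma exp_sub_exp_div_bounds {a b t : ℝ} (hab : a ≤ b) (ht : 0 < t) :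
    0 ≤ t⁻¹ * (Real.exp (-(a * t)) - Real.exp (-(b * t))) ∧
      t⁻¹ * (Real.exp (-(a * t)) - Real.exp (-(b * t))) ≤ (b - a) * Real.exp (-a * t) := by
  have h1 : Real.exp (-(b * t)) ≤ Real.exp (-(a * t)) := by
    apply Real.exp_le_exp.2; nlinarith
  refine ⟨mul_nonneg (by positivity) (sub_nonneg.2 h1), ?_⟩
  have h2 := Real.add_one_le_exp (-((b - a) * t))
  have h3 : Real.exp (-(b * t)) = Real.exp (-(a * t)) * Real.exp (-((b - a) * t)) := by
    rw [← Real.exp_add]; congr 1; ring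
  have h4 : Real.exp (-a * t) = Real.exp (-(a * t)) := by ring_nf
  rw [inv_mul_le_iff₀ ht, h3, h4]
  nlinarith [mul_le_mul_of_nonneg_left h2 (Real.exp_pos (-(a * t))).le]

lemma integrableOn_frullani {a b : ℝ} (ha : 0 < a) (hb : 0 < b) :
    IntegrableOn (fun t => t⁻¹ * (Real.exp (-(a * t)) - Real.exp (-(b * t)))) (Set.Ioi 0) := by
  have hm : Measurable fun t : ℝ => t⁻¹ * (Real.exp (-(a * t)) - Real.exp (-(b * t))) := by fun_prop
  rcases le_total a b with h | h
  · refine ((integrableOn_exp_mul_Ioi (neg_neg_of_pos ha) 0).const_mul (b - a)).mono' hm.aestronglyMeasurable ?_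
    filter_upwards [ae_restrict_mem measurableSet_Ioi] with t ht
    obtain ⟨h1, h2⟩ := exp_sub_exp_div_bounds h ht
    rwa [Real.norm_of_nonneg h1]
  · refine ((integrableOn_exp_mul_Ioi (neg_neg_of_pos hb) 0).const_mul (a - b)).mono' hm.aestronglyMeasurable ?_
    filter_upwards [ae_restrict_mem measurableSet_Ioi] with t ht
    obtain ⟨h1, h2⟩ := exp_sub_exp_div_bounds h ht
    have e : t⁻¹ * (Real.exp (-(a * t)) - Real.exp (-(b * t))) =
      -(t⁻¹ * (Real.exp (-(b * t)) - Real.exp (-(a * t)))) := by ring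
    rwa [e, norm_neg, Real.norm_of_nonneg h1]

/-- Used with a = (x - y)² and b = 1, it writes -2 log |x - y| as an integral over t of Gaussian
kernels minus a counterterm free of x and y. -/
lemma integral_frullani {a b : ℝ} (ha : 0 < a) (hb : 0 < b) :
    ∫ t in Set.Ioi 0, t⁻¹ * (Real.exp (-(a * t)) - Real.exp (-(b * t))) = Real.log (b / a) := by
  have hc : Continuous fun x : ℝ => Real.exp (-x) := by fun_prop
  have h := Frullani.integral_Ioi_eq (f := fun x : ℝ => Real.exp (-x)) (L := 1) (R := 0)
    (hc.locallyIntegrable.locallyIntegrableOn _) ha hb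
    (by simpa using (hc.tendsto 0).mono_left nhdsWithin_le_nhds)
    Real.tendsto_exp_neg_atTop_nhds_zero (by simpa using integrableOn_frullani ha hb)
  simpa using h

lemma integral_norm_frullani {a b : ℝ} (ha : 0 < a) (hb : 0 < b) :
    ∫ t in Set.Ioi 0, ‖t⁻¹ * (Real.exp (-(a * t)) - Real.exp (-(b * t)))‖ = |Real.log (b / a)| := by
  rcases le_total a b with h | h
  · rw [abs_of_nonneg (Real.log_nonneg ((one_le_div ha).2 h)), ← integral_frullani ha hb]
    refine setIntegral_congr_fun measurableSet_Ioi fun t ht => ?_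
    exact Real.norm_of_nonneg (exp_sub_exp_div_bounds h ht).1
  · rw [abs_of_nonpos (Real.log_nonpos (by positivity) ((div_le_one ha).2 h)), ← integral_frullani ha hb,
      ← integral_neg]
    refine setIntegral_congr_fun measurableSet_Ioi fun t ht => ?_
    have e : t⁻¹ * (Real.exp (-(a * t)) - Real.exp (-(b * t))) =
      -(t⁻¹ * (Real.exp (-(b * t)) - Real.exp (-(a * t)))) := by ring
    rw [e, norm_neg, Real.norm_of_nonneg (exp_sub_exp_div_bounds h ht).1, neg_neg]

/-- The Gaussian interaction energy. -/
def gaussianEnergy (t : ℝ) (α β : Measure ℝ) : ℝ :=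
  ∫ z : ℝ × ℝ, Real.exp (-((z.1 - z.2) ^ 2 * t)) ∂α.prod β

variable {α β : Measure ℝ} [IsProbabilityMeasure α] [IsProbabilityMeasure β]

lemma integrable_gaussian {t : ℝ} (ht : 0 ≤ t) :
    Integrable (fun z : ℝ × ℝ => Real.exp (-((z.1 - z.2) ^ 2 * t))) (α.prod β) := by
  refine Integrable.of_bound (by fun_prop) 1 (ae_of_all _ fun z => ?_)
  rw [Real.norm_of_nonneg (Real.exp_pos _).le, Real.exp_le_one_iff]
  have := mul_nonneg (sq_nonneg (z.1 - z.2)) ht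
  linarith

/-- The logarithmic energy as a superposition of Gaussian energies. -/
lemma integral_neg_log_eq_gaussianEnergy (hne : ∀ᵐ z ∂α.prod β, z.1 ≠ z.2)
    (hint : Integrable (fun z : ℝ × ℝ => Real.log |z.1 - z.2|) (α.prod β)) :
    IntegrableOn (fun t => t⁻¹ * (gaussianEnergy t α β - Real.exp (-t))) (Set.Ioi 0) ∧
    ∫ z, -Real.log |z.1 - z.2| ∂α.prod β =
      2⁻¹ * ∫ t in Set.Ioi 0, t⁻¹ * (gaussianEnergy t α β - Real.exp (-t)) := by
  set f : (ℝ × ℝ) × ℝ → ℝ := fun q =>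
    q.2⁻¹ * (Real.exp (-((q.1.1 - q.1.2) ^ 2 * q.2)) - Real.exp (-(1 * q.2))) with hf
  have hm : Measurable f := by rw [hf]; fun_prop
  have hlog : ∀ z : ℝ × ℝ, Real.log (1 / (z.1 - z.2) ^ 2) = -(2 * Real.log |z.1 - z.2|) := by
    intro z
    rw [one_div, Real.log_inv, ← sq_abs, Real.log_pow]
    norm_num
  have hpos : ∀ z : ℝ × ℝ, z.1 ≠ z.2 → 0 < (z.1 - z.2) ^ 2 := fun z hz =>
    sq_pos_of_ne_zero (sub_ne_zero.2 hz)
  -- For fixed z the integrand has constant sign in t, so its absolute integral is |2 log |z.1 -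
  -- z.2||, which is integrable by assumption; this justifies Fubini.
  have hfi : Integrable f ((α.prod β).prod (volume.restrict (Set.Ioi (0 : ℝ)))) := by
    rw [integrable_prod_iff hm.aestronglyMeasurable]
    refine ⟨hne.mono fun z hz => integrableOn_frullani (hpos z hz) one_pos, ?_⟩
    refine ((hint.const_mul 2).abs).congr (hne.mono fun z hz => ?_)
    have := integral_norm_frullani (hpos z hz) one_pos
    simp only [hf]
    rw [this, hlog, abs_neg]
  have hsec : ∀ t ∈ Set.Ioi (0 : ℝ), ∫ z, f (z, t) ∂α.prod β =
      t⁻¹ * (gaussianEnergy t α β - Real.exp (-t)) := by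
    intro t ht
    simp only [hf]
    rw [integral_const_mul, integral_sub (integrable_gaussian (le_of_lt ht)) (integrable_const _)]
    simp [gaussianEnergy]
  have hswap := hfi.integral_prod_right
  refine ⟨hswap.congr ?_, ?_⟩
  · filter_upwards [ae_restrict_mem measurableSet_Ioi] with t ht using hsec t ht
  · have h1 : ∫ z, ∫ t in Set.Ioi (0 : ℝ), f (z, t) ∂volume ∂α.prod β = 2 * ∫ z, -Real.log |z.1 - z.2| ∂α.prod β := by
      rw [← integral_const_mul]
      refine integral_congr_ae (hne.mono fun z hz => ?_)
      have := integral_frullani (hpos z hz) one_pos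
      simp only [hf]
      rw [this, hlog]
      ring
    rw [integral_integral_swap (f := fun z t => f (z, t)) hfi, setIntegral_congr_fun measurableSet_Ioi hsec] at h1
    rw [h1]; ring

/-- The kernel exp(-t u²) is the characteristic function at u of the centred normal law of variance
2 t; the rest is Fubini. -/
lemma gaussianEnergy_eq_charFun {t : ℝ} (ht : 0 ≤ t) :
    ((gaussianEnergy t α β : ℝ) : ℂ) =
      ∫ s, charFun α s * (starRingEnd ℂ) (charFun β s) ∂gaussianReal 0 (2 * t).toNNReal := by
  set N := gaussianReal 0 (2 * t).toNNReal with hN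
  have hexp : ∀ z : ℝ × ℝ, ((Real.exp (-((z.1 - z.2) ^ 2 * t)) : ℝ) : ℂ) =
      ∫ s, Complex.exp (s * (z.1 - z.2 : ℝ) * Complex.I) ∂N := by
    intro z
    have h1 := charFun_gaussianReal (μ := 0) (v := (2 * t).toNNReal) (z.1 - z.2)
    rw [charFun_apply_real] at h1
    have h2 : (((2 * t).toNNReal : ℝ) : ℂ) = 2 * t := by
      rw [Real.coe_toNNReal _ (by positivity)]; push_cast; ring
    have h3 : ∀ s : ℝ, Complex.exp (s * (z.1 - z.2 : ℝ) * Complex.I) =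
        Complex.exp (((z.1 - z.2 : ℝ) : ℂ) * s * Complex.I) := fun s => by
      rw [mul_comm (s : ℂ)]
    simp_rw [h3]
    rw [h1, h2, Complex.ofReal_exp]
    congr 1
    push_cast
    ring
  set F : (ℝ × ℝ) × ℝ → ℂ := fun q => Complex.exp (q.2 * (q.1.1 - q.1.2 : ℝ) * Complex.I) with hF
  have hFi : Integrable F ((α.prod β).prod N) := by
    refine Integrable.of_bound (by rw [hF]; fun_prop) 1 (ae_of_all _ fun q => ?_)
    rw [hF]
    simp only
    rw [← Complex.ofReal_mul, Complex.norm_exp_ofReal_mul_I]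
  rw [gaussianEnergy, ← integral_complex_ofReal]
  simp_rw [hexp]
  rw [integral_integral_swap (f := fun z s => F (z, s)) hFi]
  refine integral_congr_ae (ae_of_all _ fun s => ?_)
  have hconj : (starRingEnd ℂ) (charFun β s) = ∫ y, Complex.exp (-(s * y * Complex.I)) ∂β := by
    rw [← charFun_neg, charFun_apply_real]
    simp
  simp only
  rw [hconj, charFun_apply_real, ← integral_prod_mul]
  refine integral_congr_ae (ae_of_all _ fun z => ?_)
  simp only [hF]
  rw [← Complex.exp_add]
  congr 1
  push_cast
  ring

lemma gaussianEnergy_comm (t : ℝ) : gaussianEnergy t α β = gaussianEnergy t β α := by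
  rw [gaussianEnergy, gaussianEnergy, ← integral_prod_swap]
  refine integral_congr_ae (ae_of_all _ fun z => ?_)
  simp only [Prod.fst_swap, Prod.snd_swap]
  congr 2; ring

lemma integrable_charFun_mul_conj (α β : Measure ℝ) [IsProbabilityMeasure α] [IsProbabilityMeasure β]
    (N : Measure ℝ) [IsProbabilityMeasure N] :
    Integrable (fun s => charFun α s * (starRingEnd ℂ) (charFun β s)) N := by
  refine Integrable.of_bound (by fun_prop) 1 (ae_of_all _ fun s => ?_)
  rw [norm_mul, Complex.norm_conj]
  exact mul_le_one₀ (norm_charFun_le_one s) (norm_nonneg _) (norm_charFun_le_one s)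

/-- The Gaussian energy of the signed measure α - β is the squared L² norm of the difference of
characteristic functions, which shows its sign. -/
lemma gaussianEnergy_diff_eq {t : ℝ} (ht : 0 ≤ t) :
    gaussianEnergy t α α - 2 * gaussianEnergy t α β + gaussianEnergy t β β =
      ∫ s, ‖charFun α s - charFun β s‖ ^ 2 ∂gaussianReal 0 (2 * t).toNNReal := by
  set N := gaussianReal 0 (2 * t).toNNReal with hN
  have h1 : gaussianEnergy t α α - 2 * gaussianEnergy t α β + gaussianEnergy t β β =
      gaussianEnergy t α α - gaussianEnergy t α β - gaussianEnergy t β α + gaussianEnergy t β β := by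
    rw [gaussianEnergy_comm (α := β) (β := α)]; ring
  rw [← Complex.ofReal_inj, h1, ← integral_complex_ofReal]
  push_cast
  rw [gaussianEnergy_eq_charFun ht, gaussianEnergy_eq_charFun ht, gaussianEnergy_eq_charFun ht,
    gaussianEnergy_eq_charFun ht, ← hN]
  have i1 := integrable_charFun_mul_conj α α N
  have i2 := integrable_charFun_mul_conj α β N
  have i3 := integrable_charFun_mul_conj β α N
  have i4 := integrable_charFun_mul_conj β β N
  have i5 : Integrable (fun s => charFun α s * (starRingEnd ℂ) (charFun α s)
      - charFun α s * (starRingEnd ℂ) (charFun β s)) N := i1.sub i2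
  have i6 : Integrable (fun s => charFun α s * (starRingEnd ℂ) (charFun α s)
      - charFun α s * (starRingEnd ℂ) (charFun β s)
      - charFun β s * (starRingEnd ℂ) (charFun α s)) N := i5.sub i3
  rw [← integral_sub i1 i2, ← integral_sub i5 i3, ← integral_add i6 i4]
  refine integral_congr_ae (ae_of_all _ fun s => ?_)
  simp only
  rw [← Complex.mul_conj', map_sub]
  ring

lemma gaussianEnergy_diff_nonneg {t : ℝ} (ht : 0 ≤ t) :
    0 ≤ gaussianEnergy t α α - 2 * gaussianEnergy t α β + gaussianEnergy t β β := by
  rw [gaussianEnergy_diff_eq ht]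
  positivity

/-- For t > 0, Lebesgue measure is absolutely continuous with respect to the normal law, so the
continuous characteristic functions agree almost everywhere, hence everywhere. -/
lemma eq_of_gaussianEnergy_diff_eq_zero {t : ℝ} (ht : 0 < t)
    (h : gaussianEnergy t α α - 2 * gaussianEnergy t α β + gaussianEnergy t β β = 0) : α = β := by
  have hc : Continuous fun s => ‖charFun α s - charFun β s‖ ^ 2 := by fun_prop
  have hi : Integrable (fun s => ‖charFun α s - charFun β s‖ ^ 2) (gaussianReal 0 (2 * t).toNNReal) := by
    refine Integrable.of_bound hc.aestronglyMeasurable (2 ^ 2) (ae_of_all _ fun s => ?_)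
    rw [Real.norm_of_nonneg (by positivity)]
    have : ‖charFun α s - charFun β s‖ ≤ 2 := (norm_sub_le _ _).trans
      (by linarith [norm_charFun_le_one (μ := α) s, norm_charFun_le_one (μ := β) s])
    gcongr
  rw [gaussianEnergy_diff_eq ht.le, integral_eq_zero_iff_of_nonneg (fun s => by positivity) hi] at h
  have h2 : (fun s => ‖charFun α s - charFun β s‖ ^ 2) =ᵐ[volume] fun _ => 0 :=
    (gaussianReal_absolutelyContinuous' 0 (by simpa using ht)).ae_le h
  have h3 := (hc.ae_eq_iff_eq volume continuous_const).1 h2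
  refine Measure.ext_of_charFun (funext fun s => ?_)
  have := congrFun h3 s
  simpa [sub_eq_zero] using this

/-- Positive definiteness of the logarithmic kernel. -/
theorem logEnergy_diff_nonneg
    (h1 : ∀ᵐ z ∂α.prod α, z.1 ≠ z.2) (i1 : Integrable (fun z : ℝ × ℝ => Real.log |z.1 - z.2|) (α.prod α))
    (h2 : ∀ᵐ z ∂α.prod β, z.1 ≠ z.2) (i2 : Integrable (fun z : ℝ × ℝ => Real.log |z.1 - z.2|) (α.prod β))
    (h3 : ∀ᵐ z ∂β.prod β, z.1 ≠ z.2) (i3 : Integrable (fun z : ℝ × ℝ => Real.log |z.1 - z.2|) (β.prod β)) :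
    0 ≤ ∫ z, -Real.log |z.1 - z.2| ∂α.prod α - 2 * ∫ z, -Real.log |z.1 - z.2| ∂α.prod β
        + ∫ z, -Real.log |z.1 - z.2| ∂β.prod β ∧
    (∫ z, -Real.log |z.1 - z.2| ∂α.prod α - 2 * ∫ z, -Real.log |z.1 - z.2| ∂α.prod β
        + ∫ z, -Real.log |z.1 - z.2| ∂β.prod β = 0 → α = β) := by
  obtain ⟨j1, e1⟩ := integral_neg_log_eq_gaussianEnergy h1 i1
  obtain ⟨j2, e2⟩ := integral_neg_log_eq_gaussianEnergy h2 i2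
  obtain ⟨j3, e3⟩ := integral_neg_log_eq_gaussianEnergy h3 i3
  -- The counterterms exp(-t) cancel, having coefficients 1 - 2 + 1 = 0.
  set D : ℝ → ℝ := fun t =>
    t⁻¹ * (gaussianEnergy t α α - 2 * gaussianEnergy t α β + gaussianEnergy t β β) with hD
  have hDi : IntegrableOn D (Set.Ioi 0) ∧
      ∫ t in Set.Ioi 0, D t = 2 * (∫ z, -Real.log |z.1 - z.2| ∂α.prod α
        - 2 * ∫ z, -Real.log |z.1 - z.2| ∂α.prod β + ∫ z, -Real.log |z.1 - z.2| ∂β.prod β) := by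
    have j2' : IntegrableOn (fun t => 2 * (t⁻¹ * (gaussianEnergy t α β - Real.exp (-t)))) (Set.Ioi 0) :=
      j2.const_mul 2
    have hDeq : D = fun t => t⁻¹ * (gaussianEnergy t α α - Real.exp (-t))
        - 2 * (t⁻¹ * (gaussianEnergy t α β - Real.exp (-t)))
        + t⁻¹ * (gaussianEnergy t β β - Real.exp (-t)) := by
      funext t; rw [hD]; ring
    have j4 : IntegrableOn (fun t => t⁻¹ * (gaussianEnergy t α α - Real.exp (-t))
        - 2 * (t⁻¹ * (gaussianEnergy t α β - Real.exp (-t)))) (Set.Ioi 0) := j1.sub j2'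
    rw [hDeq]
    refine ⟨j4.add j3, ?_⟩
    rw [integral_add j4 j3, integral_sub j1 j2', integral_const_mul, e1, e2, e3]
    ring
  have hDn : 0 ≤ᵐ[volume.restrict (Set.Ioi 0)] D := by
    filter_upwards [ae_restrict_mem measurableSet_Ioi] with t ht
    exact mul_nonneg (inv_nonneg.2 (le_of_lt ht)) (gaussianEnergy_diff_nonneg (le_of_lt ht))
  refine ⟨?_, fun h => ?_⟩
  · have := integral_nonneg_of_ae hDn
    linarith [hDi.2]
  · have h0 : ∫ t in Set.Ioi 0, D t = 0 := by rw [hDi.2, h, mul_zero]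
    rw [integral_eq_zero_iff_of_nonneg_ae hDn hDi.1] at h0
    have : NeZero (volume.restrict (Set.Ioi (0 : ℝ))) := ⟨by simp⟩
    obtain ⟨t, ht, ht0⟩ := (h0.and (ae_restrict_mem measurableSet_Ioi)).exists
    have ht0' : (0 : ℝ) < t := ht0
    refine eq_of_gaussianEnergy_diff_eq_zero ht0' ?_
    simpa [hD, ht0'.ne'] using ht

end LogEnergy

end Biorthogonal
end

noncomputable section
namespace Biorthogonal

/-! ### Integrals of hyperbolic functions -/

section Hyperbolic

lemma cos_re (θ : ℂ) : (Complex.cos θ).re = Real.cos θ.re * Real.cosh θ.im := by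
  rw [Complex.cos_eq, ← Complex.ofReal_cos, ← Complex.ofReal_sin, ← Complex.ofReal_cosh,
    ← Complex.ofReal_sinh]
  simp only [Complex.mul_re, Complex.sub_re, Complex.ofReal_re,
    Complex.ofReal_im, Complex.I_re, Complex.I_im, Complex.mul_im]
  ring

lemma cos_im (θ : ℂ) : (Complex.cos θ).im = -(Real.sin θ.re * Real.sinh θ.im) := by
  rw [Complex.cos_eq, ← Complex.ofReal_cos, ← Complex.ofReal_sin, ← Complex.ofReal_cosh,
    ← Complex.ofReal_sinh]
  simp only [Complex.mul_re, Complex.sub_im, Complex.ofReal_re,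
    Complex.ofReal_im, Complex.I_re, Complex.I_im, Complex.mul_im]
  ring

lemma normSq_cosh_add_cos (w : ℝ) (θ : ℂ) :
    ‖(Real.cosh w : ℂ) + Complex.cos θ‖ ^ 2 = Real.cosh w ^ 2
      + 2 * Real.cos θ.re * Real.cosh w * Real.cosh θ.im + Real.cosh θ.im ^ 2 - Real.sin θ.re ^ 2 := by
  rw [← Complex.normSq_eq_norm_sq, Complex.normSq_apply, Complex.add_re, Complex.add_im,
    Complex.ofReal_re, Complex.ofReal_im, cos_re, cos_im]
  have h3 := Real.cosh_sq θ.im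
  have h4 := Real.sin_sq_add_cos_sq θ.re
  linear_combination (Real.cosh θ.im ^ 2) * h4 - Real.sin θ.re ^ 2 * h3

lemma cos_add_one_pos {a : ℝ} (ha : |a| < Real.pi) : 0 < (1 + Real.cos a) / 2 := by
  have h := Real.cos_sq (a / 2)
  rw [mul_div_cancel₀ a two_ne_zero] at h
  have h2 : 0 < Real.cos (a / 2) := Real.cos_pos_of_mem_Ioo
    ⟨by linarith [(abs_lt.1 ha).1], by linarith [(abs_lt.1 ha).2]⟩
  have := pow_pos h2 2
  linarith

/-- With C = cosh w, D = cosh (Im θ) and k = (1 + cos (Re θ))/2, the squared norm exceeds (k (C +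
D))² by (1 - k²)(C - D)² + 4 k (1 - k)(C D - 1) ≥ 0. In the strip |Re θ| < π, k is positive, so this
controls all denominators. -/
lemma mul_cosh_le_norm (w : ℝ) (θ : ℂ) :
    (1 + Real.cos θ.re) / 2 * Real.cosh w ≤ ‖(Real.cosh w : ℂ) + Complex.cos θ‖ := by
  have hk0 : 0 ≤ (1 + Real.cos θ.re) / 2 := by linarith [Real.neg_one_le_cos θ.re]
  have hk1 : (1 + Real.cos θ.re) / 2 ≤ 1 := by linarith [Real.cos_le_one θ.re]
  have hC := Real.one_le_cosh w
  have hD := Real.one_le_cosh θ.im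
  have hsq := normSq_cosh_add_cos w θ
  have hs : Real.sin θ.re ^ 2 = 1 - Real.cos θ.re ^ 2 := Real.sin_sq _
  rw [hs] at hsq
  set k := (1 + Real.cos θ.re) / 2 with hk
  have hcos : Real.cos θ.re = 2 * k - 1 := by rw [hk]; ring
  rw [hcos] at hsq
  set C := Real.cosh w
  set D := Real.cosh θ.im
  have hCD : 0 ≤ C * D - 1 := by nlinarith
  have h1 : (k * (C + D)) ^ 2 ≤ ‖(C : ℂ) + Complex.cos θ‖ ^ 2 := by
    rw [hsq]
    have e : C ^ 2 + 2 * (2 * k - 1) * C * D + D ^ 2 - (1 - (2 * k - 1) ^ 2) - (k * (C + D)) ^ 2 =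
      (1 - k ^ 2) * (C - D) ^ 2 + 4 * (k * (1 - k)) * (C * D - 1) := by ring
    have h2 : 0 ≤ 1 - k ^ 2 := by nlinarith
    have h3 : 0 ≤ k * (1 - k) := mul_nonneg hk0 (by linarith)
    have h4 := mul_nonneg h2 (sq_nonneg (C - D))
    have h5 := mul_nonneg h3 hCD
    nlinarith
  have h2 := (pow_le_pow_iff_left₀ (by positivity) (norm_nonneg _) two_ne_zero).1 h1
  nlinarith

lemma cosh_add_cos_ne_zero (w : ℝ) {θ : ℂ} (hθ : |θ.re| < Real.pi) :
    (Real.cosh w : ℂ) + Complex.cos θ ≠ 0 := by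
  have := mul_cosh_le_norm w θ
  have h2 := mul_pos (cos_add_one_pos hθ) (Real.cosh_pos w)
  exact norm_pos_iff.1 (h2.trans_le this)

lemma inv_cosh_le (w : ℝ) : (Real.cosh w)⁻¹ ≤ 2 * Real.exp (-w) := by
  rw [inv_le_iff_one_le_mul₀ (Real.cosh_pos w), Real.cosh_eq]
  have h : Real.exp (-w) * Real.exp w = 1 := by rw [← Real.exp_add]; simp
  nlinarith [sq_nonneg (Real.exp (-w))]

lemma continuous_cosh_add_cos (θ : ℂ) : Continuous fun w : ℝ => (Real.cosh w : ℂ) + Complex.cos θ := by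
  have := Real.continuous_cosh
  fun_prop

lemma integrableOn_inv_cosh_add_cos {θ : ℂ} (hθ : |θ.re| < Real.pi) :
    IntegrableOn (fun w : ℝ => ((Real.cosh w : ℂ) + Complex.cos θ)⁻¹) (Set.Ioi 0) := by
  have hk := cos_add_one_pos hθ
  refine ((integrableOn_exp_mul_Ioi (a := -1) (by norm_num) 0).const_mul
    (2 / ((1 + Real.cos θ.re) / 2))).mono' ?_ (ae_of_all _ fun w => ?_)
  · exact ((continuous_cosh_add_cos θ).inv₀ fun w => cosh_add_cos_ne_zero w hθ).aestronglyMeasurable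
  · rw [norm_inv]
    calc _ ≤ ((1 + Real.cos θ.re) / 2 * Real.cosh w)⁻¹ :=
          inv_anti₀ (mul_pos hk (Real.cosh_pos w)) (mul_cosh_le_norm w θ)
      _ = ((1 + Real.cos θ.re) / 2)⁻¹ * (Real.cosh w)⁻¹ := by rw [mul_inv]
      _ ≤ ((1 + Real.cos θ.re) / 2)⁻¹ * (2 * Real.exp (-w)) := by gcongr; exact inv_cosh_le w
      _ = _ := by rw [neg_one_mul]; ring

lemma one_add_mem_slitPlane {r : ℝ} (hr : 0 ≤ r) {θ : ℂ} (hθ : |θ.re| < Real.pi) :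
    1 + Complex.exp (θ * Complex.I) * r ∈ Complex.slitPlane := by
  have hre : (1 + Complex.exp (θ * Complex.I) * r).re =
      1 + Real.exp (-θ.im) * Real.cos θ.re * r := by
    simp [Complex.exp_re]
  have him : (1 + Complex.exp (θ * Complex.I) * r).im = Real.exp (-θ.im) * Real.sin θ.re * r := by
    simp [Complex.exp_im]
  rw [Complex.mem_slitPlane_iff, hre, him]
  rcases eq_or_ne θ.re 0 with h | h
  · left
    rw [h, Real.cos_zero]
    positivity
  · rcases hr.eq_or_lt with hr0 | hr0
    · left; rw [← hr0]; simp
    · right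
      refine mul_ne_zero (mul_ne_zero (Real.exp_pos _).ne' fun hs => h ?_) hr0.ne'
      exact (Real.sin_eq_zero_iff_of_lt_of_lt (abs_lt.1 hθ).1 (abs_lt.1 hθ).2).1 hs

/-- In the strip, 2 cos (θ/2) has positive real part and |Re θ / 2| < π/2, so the arguments add
without leaving the principal branch. -/
lemma log_one_add_exp {θ : ℂ} (hθ : |θ.re| < Real.pi) :
    Complex.log (1 + Complex.exp (θ * Complex.I)) =
      Complex.log (2 * Complex.cos (θ / 2)) + θ / 2 * Complex.I := by
  have h1 : 1 + Complex.exp (θ * Complex.I) =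
      2 * Complex.cos (θ / 2) * Complex.exp (θ / 2 * Complex.I) := by
    rw [Complex.two_cos, add_mul, ← Complex.exp_add, ← Complex.exp_add]
    rw [show θ / 2 * Complex.I + θ / 2 * Complex.I = θ * Complex.I by ring,
      show -(θ / 2) * Complex.I + θ / 2 * Complex.I = 0 by ring, Complex.exp_zero, add_comm]
  have hre : (θ / 2).re = θ.re / 2 := by simp
  have hhalf : |θ.re / 2| < Real.pi / 2 := by
    rw [abs_div, abs_two]; linarith
  have hcos : 0 < (2 * Complex.cos (θ / 2)).re := by
    rw [Complex.mul_re, cos_re, hre, Complex.re_ofNat, Complex.im_ofNat]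
    have h2 : 0 < Real.cos (θ.re / 2) := Real.cos_pos_of_mem_Ioo (abs_lt.1 hhalf)
    have := mul_pos h2 (Real.cosh_pos (θ / 2).im)
    linarith
  have harg := Complex.abs_arg_lt_pi_div_two_iff.2 (Or.inl hcos)
  have him : (θ / 2 * Complex.I).im = θ.re / 2 := by simp
  have h3 := abs_lt.1 hhalf
  have h4 := abs_lt.1 harg
  have hlogexp : Complex.log (Complex.exp (θ / 2 * Complex.I)) = θ / 2 * Complex.I :=
    Complex.log_exp (by rw [him]; linarith [Real.pi_pos]) (by rw [him]; linarith [Real.pi_pos])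
  have hargexp : Complex.arg (Complex.exp (θ / 2 * Complex.I)) = θ.re / 2 := by
    rw [← Complex.log_im, hlogexp, him]
  rw [h1, (Complex.log_mul_eq_add_log_iff (fun h => by rw [h] at hcos; simp at hcos)
    (Complex.exp_ne_zero _)).2 (by rw [hargexp]; exact ⟨by linarith, by linarith⟩), hlogexp]

/-- The function G is an explicit primitive of -i sin θ / (cosh w + cos θ): a difference of two
logarithms tending to 0 at infinity and equal to i θ at 0. -/
lemma sin_mul_integral_inv_cosh_add_cos {θ : ℂ} (hθ : |θ.re| < Real.pi) :
    Complex.sin θ * ∫ w in Set.Ioi (0 : ℝ), ((Real.cosh w : ℂ) + Complex.cos θ)⁻¹ = θ := by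
  have hθ' : |(-θ).re| < Real.pi := by rwa [Complex.neg_re, abs_neg]
  set G : ℝ → ℂ := fun w => Complex.log (1 + Complex.exp (θ * Complex.I) * (Real.exp (-w) : ℝ))
    - Complex.log (1 + Complex.exp (-θ * Complex.I) * (Real.exp (-w) : ℝ)) with hG
  have hexp : ∀ w : ℝ, HasDerivAt (fun w : ℝ => ((Real.exp (-w) : ℝ) : ℂ)) (-(Real.exp (-w) : ℝ) : ℂ) w := by
    intro w
    have := ((hasDerivAt_neg w).exp).ofReal_comp
    simpa using this
  have hlog : ∀ (η : ℂ), |η.re| < Real.pi → ∀ w : ℝ, HasDerivAt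
      (fun w : ℝ => Complex.log (1 + Complex.exp (η * Complex.I) * (Real.exp (-w) : ℝ)))
      (Complex.exp (η * Complex.I) * (-(Real.exp (-w) : ℝ) : ℂ) /
        (1 + Complex.exp (η * Complex.I) * (Real.exp (-w) : ℝ))) w := fun η hη w =>
    (((hexp w).const_mul (Complex.exp (η * Complex.I))).const_add 1).clog_real
      (one_add_mem_slitPlane (Real.exp_pos _).le hη)
  have hderiv : ∀ w : ℝ, HasDerivAt G
      (-Complex.I * Complex.sin θ * ((Real.cosh w : ℂ) + Complex.cos θ)⁻¹) w := by
    intro w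
    refine HasDerivAt.congr_deriv (f := G) ((hlog θ hθ w).sub (hlog (-θ) hθ' w)) ?_
    have n1 := Complex.slitPlane_ne_zero (one_add_mem_slitPlane (Real.exp_pos (-w)).le hθ)
    have n2 := Complex.slitPlane_ne_zero (one_add_mem_slitPlane (Real.exp_pos (-w)).le hθ')
    have n3 := cosh_add_cos_ne_zero w hθ
    have e1 : Complex.exp (θ * Complex.I) * Complex.exp (-θ * Complex.I) = 1 := by
      rw [← Complex.exp_add]; simp
    have e2 : ((Real.exp w : ℝ) : ℂ) * ((Real.exp (-w) : ℝ) : ℂ) = 1 := by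
      rw [← Complex.ofReal_mul, ← Real.exp_add]; simp
    have e3 : (Real.cosh w : ℂ) = (((Real.exp w : ℝ) : ℂ) + ((Real.exp (-w) : ℝ) : ℂ)) / 2 := by
      rw [Real.cosh_eq]; push_cast; ring
    have e4 : Complex.cos θ = (Complex.exp (θ * Complex.I) + Complex.exp (-θ * Complex.I)) / 2 := rfl
    have e5 : Complex.sin θ = (Complex.exp (-θ * Complex.I) - Complex.exp (θ * Complex.I)) * Complex.I / 2 := rfl
    rw [e3, e4] at n3 ⊢
    rw [e5]
    set x := Complex.exp (θ * Complex.I)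
    set y := Complex.exp (-θ * Complex.I)
    set p := ((Real.exp w : ℝ) : ℂ)
    set q := ((Real.exp (-w) : ℝ) : ℂ)
    have e6 : (1 + x * q) * (1 + y * q) = 2 * q * ((p + q) / 2 + (x + y) / 2) := by
      linear_combination q ^ 2 * e1 - e2
    have e7 : Complex.I * Complex.I = -1 := Complex.I_mul_I
    rw [div_sub_div _ _ n1 n2, e6]
    have hq : q ≠ 0 := by
      intro h; rw [h, mul_zero] at e2; exact zero_ne_one e2
    rw [← div_eq_mul_inv, div_eq_div_iff (mul_ne_zero (mul_ne_zero two_ne_zero hq) n3) n3]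
    linear_combination ((y - x) * q * ((p + q) / 2 + (x + y) / 2)) * e7
  have hlim : Tendsto G atTop (𝓝 0) := by
    have h0 : Tendsto (fun w : ℝ => ((Real.exp (-w) : ℝ) : ℂ)) atTop (𝓝 0) := by
      have := (Complex.continuous_ofReal.tendsto 0).comp Real.tendsto_exp_neg_atTop_nhds_zero
      rwa [Complex.ofReal_zero] at this
    have h1 : ∀ c : ℂ, Tendsto (fun w : ℝ => Complex.log (1 + c * (Real.exp (-w) : ℝ))) atTop (𝓝 0) := by
      intro c
      have h2 : Tendsto (fun w : ℝ => 1 + c * ((Real.exp (-w) : ℝ) : ℂ)) atTop (𝓝 1) := by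
        simpa using (h0.const_mul c).const_add 1
      have := (continuousAt_clog (x := 1) (by simp)).tendsto.comp h2
      rw [Complex.log_one] at this
      exact this
    have := (h1 (Complex.exp (θ * Complex.I))).sub (h1 (Complex.exp (-θ * Complex.I)))
    rw [sub_zero] at this
    exact this
  have hint : IntegrableOn (fun w : ℝ =>
      -Complex.I * Complex.sin θ * ((Real.cosh w : ℂ) + Complex.cos θ)⁻¹) (Set.Ioi 0) :=
    (integrableOn_inv_cosh_add_cos hθ).const_mul _
  have h := integral_Ioi_of_hasDerivAt_of_tendsto (hderiv 0).continuousAt.continuousWithinAt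
    (fun w _ => hderiv w) hint hlim
  have hG0 : G 0 = θ * Complex.I := by
    simp only [hG, neg_zero, Real.exp_zero, Complex.ofReal_one, mul_one]
    rw [log_one_add_exp hθ, log_one_add_exp hθ', neg_div, Complex.cos_neg]
    ring
  rw [integral_const_mul, hG0] at h
  have : Complex.I * (Complex.sin θ * ∫ w in Set.Ioi (0 : ℝ), ((Real.cosh w : ℂ) + Complex.cos θ)⁻¹) =
      Complex.I * θ := by linear_combination -h
  exact mul_left_cancel₀ Complex.I_ne_zero this

/-- Partial fractions for `cosh w / (cosh (3 w) + cos (3 θ))`. -/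
lemma partial_fraction {X C S C₁ C₂ S₁ S₂ r : ℂ} (hr : r ^ 2 = 3) (hSC : S ^ 2 + C ^ 2 = 1)
    (hC₁ : C₁ = -C / 2 - r * S / 2) (hS₁ : S₁ = -S / 2 + r * C / 2)
    (hC₂ : C₂ = -C / 2 + r * S / 2) (hS₂ : S₂ = -S / 2 - r * C / 2)
    (h0 : X + C ≠ 0) (h1 : X + C₁ ≠ 0) (h2 : X + C₂ ≠ 0) :
    3 * (3 * S - 4 * S ^ 3) * (X * (4 * X ^ 3 - 3 * X + (4 * C ^ 3 - 3 * C))⁻¹) =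
      -(C * (S * (X + C)⁻¹) + C₁ * (S₁ * (X + C₁)⁻¹) + C₂ * (S₂ * (X + C₂)⁻¹)) := by
  -- By the triple-angle formula the roots in X are minus the cosines of θ, θ + 2π/3 and θ - 2π/3.
  have e1 : 4 * X ^ 3 - 3 * X + (4 * C ^ 3 - 3 * C) = 4 * ((X + C) * (X + C₁) * (X + C₂)) := by
    subst hC₁ hC₂
    grind
  have e2 : 3 * (3 * S - 4 * S ^ 3) * X = -(4 * (C * S * ((X + C₁) * (X + C₂))
      + C₁ * S₁ * ((X + C) * (X + C₂)) + C₂ * S₂ * ((X + C) * (X + C₁)))) := by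
    subst hC₁ hC₂ hS₁ hS₂
    grind
  rw [e1, ← mul_assoc, e2]
  field_simp

end Hyperbolic

end Biorthogonal
end

noncomputable section
namespace Biorthogonal

/-! ### The mixing distribution and its logarithmic potential -/

section Mixing

lemma ofReal_sqrt_three_sq : ((√3 : ℝ) : ℂ) ^ 2 = 3 := by
  rw [← Complex.ofReal_pow, Real.sq_sqrt (by norm_num)]; norm_num

lemma cos_two_pi_div_three : Complex.cos (2 * Real.pi / 3) = -1 / 2 := by
  have h : (2 * Real.pi / 3 : ℂ) = ((Real.pi - Real.pi / 3 : ℝ) : ℂ) := by push_cast; ring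
  rw [h, ← Complex.ofReal_cos, Real.cos_pi_sub, Real.cos_pi_div_three]
  push_cast; ring

lemma sin_two_pi_div_three : Complex.sin (2 * Real.pi / 3) = (√3 : ℝ) / 2 := by
  have h : (2 * Real.pi / 3 : ℂ) = ((Real.pi - Real.pi / 3 : ℝ) : ℂ) := by push_cast; ring
  rw [h, ← Complex.ofReal_sin, Real.sin_pi_sub, Real.sin_pi_div_three]
  push_cast; ring

/-- The substitution v = 3 w and partial fractions reduce the integral to the basic one at θ and θ ±
2π/3, where θ = φ/3. Terms linear in θ cancel because the three cosines sum to 0; only a multiple of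
sin θ survives. -/
lemma sin_mul_integral_cosh_div {φ : ℂ} (hφ : |φ.re| < Real.pi) :
    Complex.sin φ * ∫ v in Set.Ioi (0 : ℝ),
      (Real.cosh (v / 3) : ℂ) * ((Real.cosh v : ℂ) + Complex.cos φ)⁻¹ =
    2 * Real.pi / (√3 : ℝ) * Complex.sin (φ / 3) := by
  set θ := φ / 3 with hθ
  set r : ℂ := ((√3 : ℝ) : ℂ) with hr
  have hr2 : r ^ 2 = 3 := ofReal_sqrt_three_sq
  have hr0 : r ≠ 0 := by
    intro h; rw [h] at hr2; norm_num at hr2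
  have hπ := Real.pi_pos
  have hre : θ.re = φ.re / 3 := by simp [hθ]
  have hb := abs_lt.1 hφ
  have h0 : |θ.re| < Real.pi := by rw [hre, abs_lt]; constructor <;> linarith
  have hre₁ : (θ + 2 * Real.pi / 3).re = φ.re / 3 + 2 * Real.pi / 3 := by
    rw [Complex.add_re, hre]; congr 1
    have : (2 * Real.pi / 3 : ℂ) = ((2 * Real.pi / 3 : ℝ) : ℂ) := by push_cast; ring
    rw [this, Complex.ofReal_re]
  have hre₂ : (θ - 2 * Real.pi / 3).re = φ.re / 3 - 2 * Real.pi / 3 := by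
    rw [Complex.sub_re, hre]; congr 1
    have : (2 * Real.pi / 3 : ℂ) = ((2 * Real.pi / 3 : ℝ) : ℂ) := by push_cast; ring
    rw [this, Complex.ofReal_re]
  have h1 : |(θ + 2 * Real.pi / 3).re| < Real.pi := by rw [hre₁, abs_lt]; constructor <;> linarith
  have h2 : |(θ - 2 * Real.pi / 3).re| < Real.pi := by rw [hre₂, abs_lt]; constructor <;> linarith
  have i0 := integrableOn_inv_cosh_add_cos h0
  have i1 := integrableOn_inv_cosh_add_cos h1
  have i2 := integrableOn_inv_cosh_add_cos h2
  have j0 := sin_mul_integral_inv_cosh_add_cos h0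
  have j1 := sin_mul_integral_inv_cosh_add_cos h1
  have j2 := sin_mul_integral_inv_cosh_add_cos h2
  have hC₁ : Complex.cos (θ + 2 * Real.pi / 3) = -Complex.cos θ / 2 - r * Complex.sin θ / 2 := by
    rw [Complex.cos_add, cos_two_pi_div_three, sin_two_pi_div_three]; ring
  have hS₁ : Complex.sin (θ + 2 * Real.pi / 3) = -Complex.sin θ / 2 + r * Complex.cos θ / 2 := by
    rw [Complex.sin_add, cos_two_pi_div_three, sin_two_pi_div_three]; ring
  have hC₂ : Complex.cos (θ - 2 * Real.pi / 3) = -Complex.cos θ / 2 + r * Complex.sin θ / 2 := by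
    rw [Complex.cos_sub, cos_two_pi_div_three, sin_two_pi_div_three]; ring
  have hS₂ : Complex.sin (θ - 2 * Real.pi / 3) = -Complex.sin θ / 2 - r * Complex.cos θ / 2 := by
    rw [Complex.sin_sub, cos_two_pi_div_three, sin_two_pi_div_three]; ring
  have hφ3 : φ = 3 * θ := by rw [hθ]; ring
  have hcos : Complex.cos φ = 4 * Complex.cos θ ^ 3 - 3 * Complex.cos θ := by
    rw [hφ3, Complex.cos_three_mul]
  have hsin : Complex.sin φ = 3 * Complex.sin θ - 4 * Complex.sin θ ^ 3 := by
    rw [hφ3, Complex.sin_three_mul]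
  set g : ℝ → ℂ := fun v => (Real.cosh (v / 3) : ℂ) * ((Real.cosh v : ℂ) + Complex.cos φ)⁻¹ with hg
  have hsub := integral_comp_mul_left_Ioi g 0 (by norm_num : (0 : ℝ) < 3)
  rw [mul_zero] at hsub
  have hpt : ∀ w : ℝ, 3 * Complex.sin φ * g (3 * w) =
      -(Complex.cos θ * (Complex.sin θ * ((Real.cosh w : ℂ) + Complex.cos θ)⁻¹)
      + Complex.cos (θ + 2 * Real.pi / 3) * (Complex.sin (θ + 2 * Real.pi / 3) *
          ((Real.cosh w : ℂ) + Complex.cos (θ + 2 * Real.pi / 3))⁻¹)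
      + Complex.cos (θ - 2 * Real.pi / 3) * (Complex.sin (θ - 2 * Real.pi / 3) *
          ((Real.cosh w : ℂ) + Complex.cos (θ - 2 * Real.pi / 3))⁻¹)) := by
    intro w
    rw [← partial_fraction hr2 (Complex.sin_sq_add_cos_sq θ) hC₁ hS₁ hC₂ hS₂
      (cosh_add_cos_ne_zero w h0) (cosh_add_cos_ne_zero w h1) (cosh_add_cos_ne_zero w h2), hg]
    simp only
    rw [mul_div_cancel_left₀ w (by norm_num : (3 : ℝ) ≠ 0), Real.cosh_three_mul, hcos, hsin]
    push_cast
    ring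
  have k0 := (i0.const_mul (Complex.sin θ)).const_mul (Complex.cos θ)
  have k1 := (i1.const_mul (Complex.sin (θ + 2 * Real.pi / 3))).const_mul (Complex.cos (θ + 2 * Real.pi / 3))
  have k2 := (i2.const_mul (Complex.sin (θ - 2 * Real.pi / 3))).const_mul (Complex.cos (θ - 2 * Real.pi / 3))
  have hI : 3 * Complex.sin φ * ∫ w in Set.Ioi (0 : ℝ), g (3 * w) =
      -(Complex.cos θ * θ + Complex.cos (θ + 2 * Real.pi / 3) * (θ + 2 * Real.pi / 3)
      + Complex.cos (θ - 2 * Real.pi / 3) * (θ - 2 * Real.pi / 3)) := by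
    rw [← integral_const_mul]
    simp_rw [hpt]
    have k3 : Integrable (fun w : ℝ =>
        Complex.cos θ * (Complex.sin θ * ((Real.cosh w : ℂ) + Complex.cos θ)⁻¹)
        + Complex.cos (θ + 2 * Real.pi / 3) * (Complex.sin (θ + 2 * Real.pi / 3) *
          ((Real.cosh w : ℂ) + Complex.cos (θ + 2 * Real.pi / 3))⁻¹))
        (volume.restrict (Set.Ioi (0 : ℝ))) := k0.add k1
    rw [integral_neg, integral_add k3 k2, integral_add k0 k1]
    simp only [integral_const_mul]
    rw [j0, j1, j2]
  rw [hsub, hC₁, hC₂, Complex.real_smul] at hI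
  push_cast at hI
  have h6 : r * r⁻¹ = 1 := mul_inv_cancel₀ hr0
  rw [div_mul_eq_mul_div, eq_div_iff hr0]
  linear_combination r * hI + (2 * (Real.pi : ℂ) * Complex.sin θ / 3) * hr2

/-- The density of the mixing variable. -/
def mixDensity (v : ℝ) : ℝ := √3 / Real.pi * (Real.cosh (v / 3) * (Real.cosh v)⁻¹)

lemma continuous_mixDensity : Continuous mixDensity := by
  have h1 := Real.continuous_cosh
  have h2 : Continuous fun v => (Real.cosh v)⁻¹ := h1.inv₀ fun v => (Real.cosh_pos v).ne'
  unfold mixDensity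
  fun_prop

lemma mixDensity_pos (v : ℝ) : 0 < mixDensity v := by
  have := Real.cosh_pos v
  have := Real.cosh_pos (v / 3)
  have := Real.pi_pos
  unfold mixDensity
  positivity

lemma mixDensity_le {v : ℝ} (hv : 0 ≤ v) : mixDensity v ≤ 2 * Real.exp (-(2 / 3) * v) := by
  have h1 : √3 / Real.pi ≤ 1 := by
    rw [div_le_one Real.pi_pos]
    have : √3 ≤ 2 := by rw [Real.sqrt_le_left (by norm_num)]; norm_num
    linarith [Real.pi_gt_three]
  have h2 : Real.cosh (v / 3) ≤ Real.exp (v / 3) := by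
    rw [Real.cosh_eq]
    have : Real.exp (-(v / 3)) ≤ Real.exp (v / 3) := Real.exp_le_exp.2 (by linarith)
    linarith
  have h3 := inv_cosh_le v
  have h4 : 0 < (Real.cosh v)⁻¹ := inv_pos.2 (Real.cosh_pos v)
  have h5 := Real.cosh_pos (v / 3)
  calc mixDensity v ≤ 1 * (Real.exp (v / 3) * (2 * Real.exp (-v))) := by
        unfold mixDensity; gcongr
    _ = 2 * (Real.exp (v / 3) * Real.exp (-v)) := by ring
    _ = _ := by rw [← Real.exp_add]; congr 2; ring

lemma integrableOn_mixDensity : IntegrableOn mixDensity (Set.Ioi 0) := by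
  refine ((integrableOn_exp_mul_Ioi (a := -(2 / 3)) (by norm_num) 0).const_mul 2).mono'
    continuous_mixDensity.aestronglyMeasurable ?_
  filter_upwards [ae_restrict_mem measurableSet_Ioi] with v hv
  rw [Real.norm_of_nonneg (mixDensity_pos v).le]
  exact mixDensity_le (le_of_lt hv)

lemma integrableOn_mul_mixDensity : IntegrableOn (fun v => mixDensity v * v) (Set.Ioi 0) := by
  refine ((integrableOn_exp_mul_Ioi (a := -(1 / 3)) (by norm_num) 0).const_mul 6).mono'
    (continuous_mixDensity.mul continuous_id).aestronglyMeasurable ?_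
  filter_upwards [ae_restrict_mem measurableSet_Ioi] with v hv
  have hv0 : 0 < v := hv
  rw [Real.norm_of_nonneg (mul_nonneg (mixDensity_pos v).le hv0.le)]
  have h1 := Real.add_one_le_exp (v / 3)
  calc mixDensity v * v ≤ 2 * Real.exp (-(2 / 3) * v) * (3 * Real.exp (v / 3)) := by
        gcongr
        · exact mixDensity_le hv0.le
        · linarith
    _ = 6 * (Real.exp (-(2 / 3) * v) * Real.exp (v / 3)) := by ring
    _ = _ := by rw [← Real.exp_add]; congr 2; ring

lemma sin_mul_integral_mixDensity {φ : ℂ} (hφ : |φ.re| < Real.pi) :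
    Complex.sin φ * ∫ v in Set.Ioi (0 : ℝ), ((mixDensity v * Real.cosh v : ℝ) : ℂ) *
      ((Real.cosh v : ℂ) + Complex.cos φ)⁻¹ = 2 * Complex.sin (φ / 3) := by
  have hr0 : ((√3 : ℝ) : ℂ) ≠ 0 := by
    intro h; have := ofReal_sqrt_three_sq; rw [h] at this; norm_num at this
  have hπ : (Real.pi : ℂ) ≠ 0 := by exact_mod_cast Real.pi_pos.ne'
  have h1 : ∀ v : ℝ, ((mixDensity v * Real.cosh v : ℝ) : ℂ) * ((Real.cosh v : ℂ) + Complex.cos φ)⁻¹ =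
      (√3 : ℝ) / Real.pi * ((Real.cosh (v / 3) : ℂ) * ((Real.cosh v : ℂ) + Complex.cos φ)⁻¹) := by
    intro v
    have h2 : mixDensity v * Real.cosh v = √3 / Real.pi * Real.cosh (v / 3) := by
      have := (Real.cosh_pos v).ne'
      unfold mixDensity; field_simp
    rw [h2]; push_cast; ring
  simp_rw [h1]
  rw [integral_const_mul, mul_left_comm, sin_mul_integral_cosh_div hφ]
  field_simp

/-- The previous identity at φ = π/2, where cos φ = 0 and 2 sin (π/6) = 1. -/
lemma integral_mixDensity : ∫ v in Set.Ioi (0 : ℝ), mixDensity v = 1 := by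
  have h := sin_mul_integral_mixDensity (φ := (Real.pi / 2 : ℝ)) (by
    rw [Complex.ofReal_re, abs_of_pos (by positivity)]; linarith [Real.pi_pos])
  have h1 : ∀ v : ℝ, ((mixDensity v * Real.cosh v : ℝ) : ℂ) *
      ((Real.cosh v : ℂ) + Complex.cos (Real.pi / 2 : ℝ))⁻¹ = (mixDensity v : ℂ) := by
    intro v
    have : (Real.cosh v : ℂ) ≠ 0 := by exact_mod_cast (Real.cosh_pos v).ne'
    rw [← Complex.ofReal_cos, Real.cos_pi_div_two, Complex.ofReal_zero, add_zero, Complex.ofReal_mul,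
      mul_assoc, mul_inv_cancel₀ this, mul_one]
  simp_rw [h1] at h
  have h2 : ((Real.pi / 2 : ℝ) : ℂ) / 3 = ((Real.pi / 6 : ℝ) : ℂ) := by push_cast; ring
  rw [← Complex.ofReal_sin, Real.sin_pi_div_two, h2, ← Complex.ofReal_sin, Real.sin_pi_div_six,
    integral_complex_ofReal] at h
  have h3 : (((∫ v in Set.Ioi (0 : ℝ), mixDensity v) : ℝ) : ℂ) = ((1 : ℝ) : ℂ) := by
    rw [← one_mul (((∫ v in Set.Ioi (0 : ℝ), mixDensity v) : ℝ) : ℂ)]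
    rw [← Complex.ofReal_one, h]; push_cast; ring
  exact Complex.ofReal_injective h3

/-- The complex logarithmic potential of the mixing distribution. -/
def mixLog (φ : ℂ) : ℂ :=
  ∫ v in Set.Ioi (0 : ℝ), (mixDensity v : ℂ) * Complex.log (1 + Complex.cos φ * ((Real.cosh v)⁻¹ : ℝ))

lemma one_add_cos_div_eq (φ : ℂ) (v : ℝ) : 1 + Complex.cos φ * ((Real.cosh v)⁻¹ : ℝ) =
    ((Real.cosh v : ℂ) + Complex.cos φ) * ((Real.cosh v)⁻¹ : ℝ) := by
  have h0 : (Real.cosh v : ℂ) ≠ 0 := by exact_mod_cast (Real.cosh_pos v).ne'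
  rw [Complex.ofReal_inv, add_mul, mul_inv_cancel₀ h0]

/-- The principal logarithm under the integral is therefore analytic in φ on the whole strip. -/
lemma one_add_cos_div_mem_slitPlane {φ : ℂ} (hφ : |φ.re| < Real.pi) (v : ℝ) :
    1 + Complex.cos φ * ((Real.cosh v)⁻¹ : ℝ) ∈ Complex.slitPlane := by
  have hv : 0 < (Real.cosh v)⁻¹ := inv_pos.2 (Real.cosh_pos v)
  rw [Complex.mem_slitPlane_iff]
  have hre : (1 + Complex.cos φ * ((Real.cosh v)⁻¹ : ℝ)).re =
      1 + Real.cos φ.re * Real.cosh φ.im * (Real.cosh v)⁻¹ := by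
    rw [Complex.add_re, Complex.re_mul_ofReal, cos_re, Complex.one_re]
  have him : (1 + Complex.cos φ * ((Real.cosh v)⁻¹ : ℝ)).im =
      -(Real.sin φ.re * Real.sinh φ.im) * (Real.cosh v)⁻¹ := by
    rw [Complex.add_im, Complex.im_mul_ofReal, cos_im, Complex.one_im, zero_add]
  rw [hre, him]
  by_cases h1 : φ.re = 0
  · left
    have := Real.cosh_pos φ.im
    rw [h1, Real.cos_zero]; positivity
  by_cases h2 : φ.im = 0
  · left
    rw [h2, Real.cosh_zero, mul_one]
    have h3 : -1 < Real.cos φ.re := by linarith [cos_add_one_pos hφ]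
    have h4 : (Real.cosh v)⁻¹ ≤ 1 := inv_le_one_of_one_le₀ (Real.one_le_cosh v)
    nlinarith
  · right
    refine mul_ne_zero (neg_ne_zero.2 (mul_ne_zero (fun h => h1 ?_) (fun h => h2 ?_))) hv.ne'
    · exact (Real.sin_eq_zero_iff_of_lt_of_lt (abs_lt.1 hφ).1 (abs_lt.1 hφ).2).1 h
    · exact Real.sinh_eq_zero.1 h

lemma le_norm_one_add_cos_div (φ : ℂ) (v : ℝ) :
    (1 + Real.cos φ.re) / 2 ≤ ‖1 + Complex.cos φ * ((Real.cosh v)⁻¹ : ℝ)‖ := by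
  have hc := Real.cosh_pos v
  rw [one_add_cos_div_eq, norm_mul, Complex.norm_real, Real.norm_of_nonneg (inv_pos.2 hc).le,
    ← div_eq_mul_inv, le_div_iff₀ hc]
  exact mul_cosh_le_norm v φ

lemma norm_one_add_cos_div_le (φ : ℂ) (v : ℝ) :
    ‖1 + Complex.cos φ * ((Real.cosh v)⁻¹ : ℝ)‖ ≤ 1 + ‖Complex.cos φ‖ := by
  refine (norm_add_le _ _).trans ?_
  have hc : 0 < (Real.cosh v)⁻¹ := inv_pos.2 (Real.cosh_pos v)
  have h4 : (Real.cosh v)⁻¹ ≤ 1 := inv_le_one_of_one_le₀ (Real.one_le_cosh v)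
  rw [norm_one, norm_mul, Complex.norm_real, Real.norm_of_nonneg hc.le]
  gcongr
  exact mul_le_of_le_one_right (norm_nonneg _) h4

lemma continuous_one_add_cos_div (φ : ℂ) :
    Continuous fun v : ℝ => 1 + Complex.cos φ * ((Real.cosh v)⁻¹ : ℝ) := by
  have h2 : Continuous fun v => (Real.cosh v)⁻¹ :=
    Real.continuous_cosh.inv₀ fun v => (Real.cosh_pos v).ne'
  fun_prop

lemma continuous_mixLog_integrand {φ : ℂ} (hφ : |φ.re| < Real.pi) : Continuous fun v : ℝ =>
    (mixDensity v : ℂ) * Complex.log (1 + Complex.cos φ * ((Real.cosh v)⁻¹ : ℝ)) := by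
  have h1 := continuous_mixDensity
  have h2 : Continuous fun v : ℝ => Complex.log (1 + Complex.cos φ * ((Real.cosh v)⁻¹ : ℝ)) :=
    (continuous_one_add_cos_div φ).clog fun v => one_add_cos_div_mem_slitPlane hφ v
  fun_prop

lemma integrableOn_mixLog_integrand {φ : ℂ} (hφ : |φ.re| < Real.pi) : IntegrableOn (fun v : ℝ =>
    (mixDensity v : ℂ) * Complex.log (1 + Complex.cos φ * ((Real.cosh v)⁻¹ : ℝ))) (Set.Ioi 0) := by
  have hk := cos_add_one_pos hφ
  set k := (1 + Real.cos φ.re) / 2 with hkdef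
  refine (integrableOn_mixDensity.mul_const (|Real.log k| + Real.log (1 + ‖Complex.cos φ‖) + Real.pi)).mono'
    (continuous_mixLog_integrand hφ).aestronglyMeasurable (ae_of_all _ fun v => ?_)
  have h1 := le_norm_one_add_cos_div φ v
  have h2 := norm_one_add_cos_div_le φ v
  have h3 := Real.log_le_log hk h1
  have h4 := Real.log_le_log (hk.trans_le h1) h2
  have h5 : 0 ≤ Real.log (1 + ‖Complex.cos φ‖) := Real.log_nonneg (by simp)
  rw [norm_mul, Complex.norm_real, Real.norm_of_nonneg (mixDensity_pos v).le]
  refine mul_le_mul_of_nonneg_left ?_ (mixDensity_pos v).le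
  refine (Complex.norm_le_abs_re_add_abs_im _).trans (add_le_add ?_ ?_)
  · rw [Complex.log_re, abs_le]
    constructor <;> linarith [neg_abs_le (Real.log k), abs_nonneg (Real.log k)]
  · rw [Complex.log_im]; exact Complex.abs_arg_le_pi _

lemma hasDerivAt_mixLog {φ₀ : ℂ} (hφ₀ : |φ₀.re| < Real.pi) :
    HasDerivAt mixLog (∫ v in Set.Ioi (0 : ℝ), (mixDensity v : ℂ) *
      (-Complex.sin φ₀ * ((Real.cosh v : ℂ) + Complex.cos φ₀)⁻¹)) φ₀ := by
  have hk := cos_add_one_pos hφ₀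
  set k := (1 + Real.cos φ₀.re) / 2 with hkdef
  -- On this neighbourhood the denominators stay at least k/2 and sin stays bounded, which gives an
  -- integrable majorant for the derivative.
  set s : Set ℂ := {φ | |φ.re| < Real.pi ∧ k / 2 < (1 + Real.cos φ.re) / 2 ∧
    ‖Complex.sin φ‖ < ‖Complex.sin φ₀‖ + 1} with hs
  have hsn : s ∈ 𝓝 φ₀ := by
    have c1 : Continuous fun φ : ℂ => |φ.re| := Complex.continuous_re.abs
    have c2 : Continuous fun φ : ℂ => (1 + Real.cos φ.re) / 2 :=
      (continuous_const.add (Real.continuous_cos.comp Complex.continuous_re)).div_const 2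
    have c3 : Continuous fun φ : ℂ => ‖Complex.sin φ‖ := Complex.continuous_sin.norm
    filter_upwards [(isOpen_lt c1 continuous_const).mem_nhds hφ₀,
      (isOpen_lt continuous_const c2).mem_nhds (half_lt_self hk),
      (isOpen_lt c3 continuous_const).mem_nhds
        (show ‖Complex.sin φ₀‖ < ‖Complex.sin φ₀‖ + 1 from lt_add_one _)] with φ h1 h2 h3
    exact ⟨h1, h2, h3⟩
  refine (hasDerivAt_integral_of_dominated_loc_of_deriv_le (μ := volume.restrict (Set.Ioi (0 : ℝ)))
    (F := fun φ v => (mixDensity v : ℂ) * Complex.log (1 + Complex.cos φ * ((Real.cosh v)⁻¹ : ℝ)))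
    (F' := fun φ v => (mixDensity v : ℂ) *
      (-Complex.sin φ * ((Real.cosh v : ℂ) + Complex.cos φ)⁻¹))
    (bound := fun v => mixDensity v * ((‖Complex.sin φ₀‖ + 1) * (k / 2)⁻¹))
    hsn ?_ (integrableOn_mixLog_integrand hφ₀) ?_ (ae_of_all _ fun v φ hφ => ?_)
    (integrableOn_mixDensity.mul_const _) (ae_of_all _ fun v φ hφ => ?_)).2
  · filter_upwards [hsn] with φ hφ using (continuous_mixLog_integrand hφ.1).aestronglyMeasurable
  · have h1 := continuous_mixDensity
    have h2 := (continuous_cosh_add_cos φ₀).inv₀ fun w => cosh_add_cos_ne_zero w hφ₀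
    exact ((Complex.continuous_ofReal.comp h1).mul (continuous_const.mul h2)).aestronglyMeasurable
  · have h1 : k / 2 ≤ ‖(Real.cosh v : ℂ) + Complex.cos φ‖ := by
      refine le_trans ?_ (mul_cosh_le_norm v φ)
      nlinarith [hφ.2.1, Real.one_le_cosh v]
    rw [norm_mul, Complex.norm_real, Real.norm_of_nonneg (mixDensity_pos v).le, norm_mul, norm_neg,
      norm_inv]
    gcongr
    · exact (mixDensity_pos v).le
    · exact hφ.2.2.le
  · have h1 := ((((Complex.hasDerivAt_cos φ).mul_const (((Real.cosh v)⁻¹ : ℝ) : ℂ)).const_add 1).clog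
      (one_add_cos_div_mem_slitPlane hφ.1 v)).const_mul (mixDensity v : ℂ)
    refine h1.congr_deriv ?_
    rw [one_add_cos_div_eq]
    have h0 : (Real.cosh v : ℂ) ≠ 0 := by exact_mod_cast (Real.cosh_pos v).ne'
    have h2 := cosh_add_cos_ne_zero v hφ.1
    push_cast at h0 h2 ⊢
    field_simp

end Mixing

end Biorthogonal
end

/-! ### The closed form of the mixing potential and its boundary values. -/

noncomputable section
namespace Biorthogonal

section Mixing

lemma re_cos_div_three_pos {φ : ℂ} (hφ : |φ.re| ≤ Real.pi) : 0 < (Complex.cos (φ / 3)).re := by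
  have hre : (φ / 3).re = φ.re / 3 := by simp
  rw [cos_re, hre]
  have := abs_le.1 hφ
  exact mul_pos (Real.cos_pos_of_mem_Ioo ⟨by linarith [Real.pi_pos], by linarith [Real.pi_pos]⟩)
    (Real.cosh_pos _)

/-- Multiplication by cos φ allows cos φ / (cosh v + cos φ) = 1 - cosh v / (cosh v + cos φ), so only
the total mass and the already evaluated integral remain. -/
lemma cos_mul_deriv_mixLog {φ : ℂ} (hφ : |φ.re| < Real.pi) :
    Complex.cos φ * ∫ v in Set.Ioi (0 : ℝ), (mixDensity v : ℂ) *
      (-Complex.sin φ * ((Real.cosh v : ℂ) + Complex.cos φ)⁻¹) =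
      -Complex.sin φ + 2 * Complex.sin (φ / 3) := by
  have h1 : ∀ v : ℝ, Complex.cos φ * ((mixDensity v : ℂ) *
      (-Complex.sin φ * ((Real.cosh v : ℂ) + Complex.cos φ)⁻¹)) =
      -Complex.sin φ * (mixDensity v : ℂ) + Complex.sin φ * (((mixDensity v * Real.cosh v : ℝ) : ℂ) *
        ((Real.cosh v : ℂ) + Complex.cos φ)⁻¹) := by
    intro v
    have := cosh_add_cos_ne_zero v hφ
    push_cast at this ⊢
    field_simp
    ring
  have i1 : Integrable (fun v : ℝ => -Complex.sin φ * (mixDensity v : ℂ)) (volume.restrict (Set.Ioi 0)) :=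
    (Integrable.ofReal integrableOn_mixDensity).const_mul _
  have i2 : Integrable (fun v : ℝ => Complex.sin φ * (((mixDensity v * Real.cosh v : ℝ) : ℂ) *
        ((Real.cosh v : ℂ) + Complex.cos φ)⁻¹)) (volume.restrict (Set.Ioi 0)) := by
    have hk := cos_add_one_pos hφ
    have c1 : Continuous fun v : ℝ => ((mixDensity v * Real.cosh v : ℝ) : ℂ) *
        ((Real.cosh v : ℂ) + Complex.cos φ)⁻¹ :=
      (Complex.continuous_ofReal.comp (continuous_mixDensity.mul Real.continuous_cosh)).mul
        ((continuous_cosh_add_cos φ).inv₀ fun w => cosh_add_cos_ne_zero w hφ)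
    refine Integrable.const_mul ?_ _
    refine (integrableOn_mixDensity.mul_const (((1 + Real.cos φ.re) / 2)⁻¹)).mono'
      c1.aestronglyMeasurable (ae_of_all _ fun v => ?_)
    have hc := Real.cosh_pos v
    have h3 := mul_cosh_le_norm v φ
    rw [norm_mul, norm_inv, Complex.norm_real,
      Real.norm_of_nonneg (mul_nonneg (mixDensity_pos v).le hc.le), mul_assoc]
    refine mul_le_mul_of_nonneg_left ?_ (mixDensity_pos v).le
    rw [← div_eq_mul_inv, ← one_div, div_le_div_iff₀ ((mul_pos hk hc).trans_le h3) hk]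
    linarith
  rw [← integral_const_mul]
  simp_rw [h1]
  rw [integral_add i1 i2, integral_const_mul, integral_const_mul, sin_mul_integral_mixDensity hφ,
    integral_complex_ofReal, integral_mixDensity]
  simp

/-- The logarithmic potential of the mixing distribution in closed form. -/
lemma mixLog_eq {φ : ℂ} (hφ : |φ.re| < Real.pi) :
    mixLog φ = 3 * Complex.log (Complex.cos (φ / 3)) - 3 * Complex.log ((√3 / 2 : ℝ) : ℂ) := by
  set U : Set ℂ := {φ | |φ.re| < Real.pi} with hU
  have hUo : IsOpen U := isOpen_lt Complex.continuous_re.abs continuous_const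
  have hUc : IsPreconnected U := by
    have : U = Complex.re ⁻¹' (Set.Ioo (-Real.pi) Real.pi) := by
      ext z; simp [hU, abs_lt]
    rw [this]
    exact ((convex_Ioo _ _).is_linear_preimage (f := Complex.re) Complex.reLm.isLinear).isPreconnected
  -- The goal is that h is constant. The derivative of the integral is known only after
  -- multiplication by cos φ, so it vanishes directly off the zeros of cos, and at the zeros by
  -- continuity. The constant is read off at π/2, where `mixLog` vanishes.
  set h : ℂ → ℂ := fun φ => mixLog φ - 3 * Complex.log (Complex.cos (φ / 3)) with hh
  have hderiv : ∀ φ ∈ U, HasDerivAt h ((∫ v in Set.Ioi (0 : ℝ), (mixDensity v : ℂ) *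
      (-Complex.sin φ * ((Real.cosh v : ℂ) + Complex.cos φ)⁻¹)) +
      Complex.sin (φ / 3) / Complex.cos (φ / 3)) φ := by
    intro φ hφ
    have hs : Complex.cos (φ / 3) ∈ Complex.slitPlane :=
      Or.inl (re_cos_div_three_pos (le_of_lt hφ))
    have h0 : HasDerivAt (fun φ : ℂ => Complex.cos (φ / 3)) (-Complex.sin (φ / 3) * (1 / 3)) φ :=
      ((hasDerivAt_id φ).div_const 3).ccos
    refine HasDerivAt.congr_deriv ((hasDerivAt_mixLog hφ).sub ((h0.clog hs).const_mul 3)) ?_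
    rw [sub_eq_add_neg]
    congr 1
    ring
  have hdiff : DifferentiableOn ℂ h U := fun φ hφ => (hderiv φ hφ).differentiableAt.differentiableWithinAt
  have hzero : ∀ φ ∈ U, Complex.cos φ * deriv h φ = 0 := by
    intro φ hφ
    have hne := Complex.slitPlane_ne_zero (Or.inl (re_cos_div_three_pos (le_of_lt hφ)) :
      Complex.cos (φ / 3) ∈ Complex.slitPlane)
    rw [(hderiv φ hφ).deriv, mul_add, cos_mul_deriv_mixLog hφ]
    have e1 : φ = 3 * (φ / 3) := by ring
    have e2 := Complex.cos_three_mul (φ / 3)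
    have e3 := Complex.sin_three_mul (φ / 3)
    rw [← e1] at e2 e3
    rw [e2, e3]
    have e4 := Complex.sin_sq_add_cos_sq (φ / 3)
    field_simp
    linear_combination (4 * Complex.sin (φ / 3)) * e4
  have hd0 : U.EqOn (deriv h) 0 := by
    intro φ hφ
    by_cases hc : Complex.cos φ = 0
    · have hcont : ContinuousAt (deriv h) φ :=
        ((hdiff.deriv hUo).continuousOn).continuousAt (hUo.mem_nhds hφ)
      have hs : -Complex.sin φ ≠ 0 := by
        intro hs
        have := Complex.sin_sq_add_cos_sq φ
        rw [hc, neg_eq_zero.1 hs] at this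
        norm_num at this
      have hev : ∀ᶠ z in 𝓝[≠] φ, deriv h z = 0 := by
        filter_upwards [(Complex.hasDerivAt_cos φ).eventually_ne hs (c := 0),
          nhdsWithin_le_nhds (hUo.mem_nhds hφ)] with z h1 h2
        exact (mul_eq_zero.1 (hzero z h2)).resolve_left h1
      exact tendsto_nhds_unique (hcont.tendsto.mono_left nhdsWithin_le_nhds)
        (tendsto_const_nhds.congr' (hev.mono fun z hz => hz.symm))
    · exact (mul_eq_zero.1 (hzero φ hφ)).resolve_left hc
  have hbase : ((Real.pi / 2 : ℝ) : ℂ) ∈ U := by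
    simp only [hU, Set.mem_ofPred_eq, Complex.ofReal_re]
    rw [abs_of_pos (by positivity)]; linarith [Real.pi_pos]
  have hconst := hUo.is_const_of_deriv_eq_zero hUc hdiff hd0 (x := φ) hφ hbase
  have hb : h ((Real.pi / 2 : ℝ) : ℂ) = -(3 * Complex.log ((√3 / 2 : ℝ) : ℂ)) := by
    have h3 : ((Real.pi / 2 : ℝ) : ℂ) / 3 = ((Real.pi / 6 : ℝ) : ℂ) := by push_cast; ring
    simp only [hh, mixLog]
    rw [h3, ← Complex.ofReal_cos, ← Complex.ofReal_cos, Real.cos_pi_div_two, Real.cos_pi_div_six]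
    simp
  rw [hb] at hconst
  simp only [hh] at hconst
  linear_combination hconst

/-- The mixing distribution. -/
def mixMeasure : Measure ℝ :=
  (volume.restrict (Set.Ioi 0)).withDensity fun v => ENNReal.ofReal (mixDensity v)

lemma measurable_ofReal_mixDensity : Measurable fun v => ENNReal.ofReal (mixDensity v) :=
  continuous_mixDensity.measurable.ennreal_ofReal

lemma integrable_mixMeasure_iff {f : ℝ → ℝ} :
    Integrable f mixMeasure ↔ IntegrableOn (fun v => mixDensity v * f v) (Set.Ioi 0) := by
  rw [mixMeasure, integrable_withDensity_iff_integrable_smul' measurable_ofReal_mixDensity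
    (ae_of_all _ fun v => ENNReal.ofReal_lt_top)]
  simp only [ENNReal.toReal_ofReal (mixDensity_pos _).le, smul_eq_mul, IntegrableOn]

lemma integral_mixMeasure (f : ℝ → ℝ) :
    ∫ v, f v ∂mixMeasure = ∫ v in Set.Ioi 0, mixDensity v * f v := by
  rw [mixMeasure, integral_withDensity_eq_integral_toReal_smul measurable_ofReal_mixDensity
    (ae_of_all _ fun v => ENNReal.ofReal_lt_top)]
  simp only [ENNReal.toReal_ofReal (mixDensity_pos _).le, smul_eq_mul]

instance isProbabilityMeasure_mixMeasure : IsProbabilityMeasure mixMeasure := by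
  constructor
  rw [mixMeasure, withDensity_apply _ MeasurableSet.univ, Measure.restrict_univ,
    ← ofReal_integral_eq_lintegral_ofReal integrableOn_mixDensity
      (ae_of_all _ fun v => (mixDensity_pos v).le), integral_mixDensity, ENNReal.ofReal_one]

lemma mixMeasure_absolutelyContinuous : mixMeasure ≪ volume :=
  (withDensity_absolutelyContinuous _ _).trans Measure.restrict_le_self.absolutelyContinuous

lemma ae_mixMeasure_pos : ∀ᵐ v ∂mixMeasure, 0 < v :=
  (withDensity_absolutelyContinuous _ _).ae_le (ae_restrict_mem measurableSet_Ioi)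

lemma integrable_id_mixMeasure : Integrable (fun v => v) mixMeasure :=
  integrable_mixMeasure_iff.2 integrableOn_mul_mixDensity

lemma integral_log_norm {φ : ℂ} (hφ : |φ.re| < Real.pi) :
    Integrable (fun v : ℝ => Real.log ‖1 + Complex.cos φ * ((Real.cosh v)⁻¹ : ℝ)‖) mixMeasure ∧
    ∫ v, Real.log ‖1 + Complex.cos φ * ((Real.cosh v)⁻¹ : ℝ)‖ ∂mixMeasure =
      3 * Real.log ‖Complex.cos (φ / 3)‖ - 3 * Real.log (√3 / 2) := by
  have h1 := integrableOn_mixLog_integrand hφ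
  have h2 : ∀ v : ℝ, ((mixDensity v : ℂ) * Complex.log (1 + Complex.cos φ * ((Real.cosh v)⁻¹ : ℝ))).re =
      mixDensity v * Real.log ‖1 + Complex.cos φ * ((Real.cosh v)⁻¹ : ℝ)‖ := fun v => by
    rw [Complex.re_ofReal_mul, Complex.log_re]
  refine ⟨?_, ?_⟩
  · rw [integrable_mixMeasure_iff]
    exact (h1.re).congr (ae_of_all _ h2)
  · rw [integral_mixMeasure]
    have h3 : ∫ v in Set.Ioi (0 : ℝ), ((mixDensity v : ℂ) *
        Complex.log (1 + Complex.cos φ * ((Real.cosh v)⁻¹ : ℝ))).re = (mixLog φ).re :=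
      integral_re h1
    simp_rw [h2] at h3
    rw [h3, mixLog_eq hφ, Complex.sub_re, ← Complex.ofReal_log (by positivity)]
    have e : (3 : ℂ) = ((3 : ℝ) : ℂ) := by norm_num
    rw [e, Complex.re_ofReal_mul, Complex.re_ofReal_mul, Complex.log_re, Complex.ofReal_re]

/-- The value on the boundary of the strip. -/
lemma integral_log_boundary {u : ℝ} (hu : 0 < u) :
    Integrable (fun v : ℝ => Real.log |1 - Real.cosh u * (Real.cosh v)⁻¹|) mixMeasure ∧
    ∫ v, Real.log |1 - Real.cosh u * (Real.cosh v)⁻¹| ∂mixMeasure =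
      3 * Real.log ‖Complex.cos ((Real.pi + u * Complex.I) / 3)‖ - 3 * Real.log (√3 / 2) := by
  set δ : ℕ → ℝ := fun n => 1 / ((n : ℝ) + 1) with hδ
  have hδ0 : Tendsto δ atTop (𝓝 0) := tendsto_one_div_add_atTop_nhds_zero_nat
  have hδpos : ∀ n, 0 < δ n := fun n => by positivity
  have hδ1 : ∀ n, δ n ≤ 1 := fun n => by
    rw [hδ]; simp only; rw [div_le_one (by positivity)]; simp
  -- The boundary point π + i u is approached horizontally from inside the strip.
  set φ : ℕ → ℂ := fun n => ((Real.pi - δ n : ℝ) : ℂ) + u * Complex.I with hφ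
  have hre : ∀ n, (φ n).re = Real.pi - δ n := fun n => by simp [hφ]
  have him : ∀ n, (φ n).im = u := fun n => by simp [hφ]
  have hstrip : ∀ n, |(φ n).re| < Real.pi := fun n => by
    rw [hre, abs_lt]
    constructor <;> linarith [Real.pi_gt_three, hδpos n, hδ1 n]
  have hφlim : Tendsto φ atTop (𝓝 (Real.pi + u * Complex.I)) := by
    have h1 : Tendsto (fun n => ((Real.pi - δ n : ℝ) : ℂ)) atTop (𝓝 (Real.pi : ℂ)) := by
      have := (Complex.continuous_ofReal.tendsto (Real.pi - 0)).comp (hδ0.const_sub Real.pi)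
      rwa [sub_zero] at this
    exact h1.add_const _
  have hcoslim : Complex.cos (Real.pi + u * Complex.I) = ((-Real.cosh u : ℝ) : ℂ) := by
    rw [add_comm, Complex.cos_add_pi, Complex.cos_mul_I]; push_cast; ring
  set ℓ : ℕ → ℝ → ℝ := fun n v => Real.log ‖1 + Complex.cos (φ n) * ((Real.cosh v)⁻¹ : ℝ)‖ with hℓ
  set ℓ₀ : ℝ → ℝ := fun v => Real.log |1 - Real.cosh u * (Real.cosh v)⁻¹| with hℓ₀
  have hval : ∀ v : ℝ, ‖1 + ((-Real.cosh u : ℝ) : ℂ) * ((Real.cosh v)⁻¹ : ℝ)‖ =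
      |1 - Real.cosh u * (Real.cosh v)⁻¹| := by
    intro v
    have : 1 + ((-Real.cosh u : ℝ) : ℂ) * ((Real.cosh v)⁻¹ : ℝ) =
        ((1 - Real.cosh u * (Real.cosh v)⁻¹ : ℝ) : ℂ) := by push_cast; ring
    rw [this, Complex.norm_real, Real.norm_eq_abs]
  have hne : ∀ᵐ v ∂mixMeasure, 0 < |1 - Real.cosh u * (Real.cosh v)⁻¹| := by
    have h1 : ∀ᵐ v ∂mixMeasure, v ≠ u :=
      mixMeasure_absolutelyContinuous.ae_le (Measure.ae_ne volume u)
    filter_upwards [h1, ae_mixMeasure_pos] with v hv hv0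
    refine abs_pos.2 (sub_ne_zero.2 fun h => hv ?_)
    have hc := (Real.cosh_pos v).ne'
    rw [eq_comm, mul_inv_eq_one₀ hc] at h
    exact (Real.cosh_injOn hu.le hv0.le h).symm
  -- For fixed imaginary part u, |cosh v + cos φ| is smallest at real part π. The boundary integrand
  -- thus bounds the approximating ones below and serves as a majorant once known to be integrable.
  have hlow : ∀ n v, |1 - Real.cosh u * (Real.cosh v)⁻¹| ≤ ‖1 + Complex.cos (φ n) * ((Real.cosh v)⁻¹ : ℝ)‖ := by
    intro n v
    have hc := Real.cosh_pos v
    have e1 : 1 - Real.cosh u * (Real.cosh v)⁻¹ = (Real.cosh v - Real.cosh u) * (Real.cosh v)⁻¹ := by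
      rw [sub_mul, mul_inv_cancel₀ hc.ne']
    rw [one_add_cos_div_eq, norm_mul, Complex.norm_real, Real.norm_of_nonneg (inv_pos.2 hc).le, e1,
      abs_mul, abs_of_pos (inv_pos.2 hc)]
    refine mul_le_mul_of_nonneg_right ?_ (inv_pos.2 hc).le
    refine abs_le_of_sq_le_sq ?_ (norm_nonneg _)
    rw [normSq_cosh_add_cos, hre, him, Real.cos_pi_sub, Real.sin_pi_sub, Real.sin_sq]
    have hC := Real.one_le_cosh v
    have hD := Real.one_le_cosh u
    have hx := Real.cos_le_one (δ n)
    have hCD : 1 ≤ Real.cosh v * Real.cosh u := by nlinarith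
    nlinarith [mul_nonneg (sub_nonneg.2 hx) (by linarith : 0 ≤ 2 * (Real.cosh v * Real.cosh u) - 1 - Real.cos (δ n))]
  have hup : ∀ n v, ‖1 + Complex.cos (φ n) * ((Real.cosh v)⁻¹ : ℝ)‖ ≤ 1 + Real.cosh u := by
    intro n v
    refine (norm_one_add_cos_div_le _ v).trans ?_
    gcongr
    refine (pow_le_pow_iff_left₀ (norm_nonneg _) (Real.cosh_pos u).le two_ne_zero).1 ?_
    rw [← Complex.normSq_eq_norm_sq, Complex.normSq_apply, cos_re, cos_im, him]
    have h3 := Real.cosh_sq u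
    have h4 := Real.sin_sq_add_cos_sq (φ n).re
    nlinarith [sq_nonneg (Real.sin (φ n).re)]
  have hptw : ∀ᵐ v ∂mixMeasure, Tendsto (fun n => ℓ n v) atTop (𝓝 (ℓ₀ v)) := by
    filter_upwards [hne] with v hv
    have h1 : Tendsto (fun n => ‖1 + Complex.cos (φ n) * ((Real.cosh v)⁻¹ : ℝ)‖) atTop
        (𝓝 |1 - Real.cosh u * (Real.cosh v)⁻¹|) := by
      rw [← hval, ← hcoslim]
      exact ((((Complex.continuous_cos.tendsto _).comp hφlim).mul_const _).const_add 1).norm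
    exact (Real.continuousAt_log hv.ne').tendsto.comp h1
  have hints : Tendsto (fun n => ∫ v, ℓ n v ∂mixMeasure) atTop
      (𝓝 (3 * Real.log ‖Complex.cos ((Real.pi + u * Complex.I) / 3)‖ - 3 * Real.log (√3 / 2))) := by
    have h1 : ∀ n, ∫ v, ℓ n v ∂mixMeasure =
        3 * Real.log ‖Complex.cos (φ n / 3)‖ - 3 * Real.log (√3 / 2) := fun n =>
      (integral_log_norm (hstrip n)).2
    simp_rw [h1]
    have hpos : 0 < ‖Complex.cos ((Real.pi + u * Complex.I) / 3)‖ := by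
      refine norm_pos_iff.2 (Complex.slitPlane_ne_zero (Or.inl (re_cos_div_three_pos ?_)))
      simp [abs_of_pos Real.pi_pos]
    have h2 : Tendsto (fun n => ‖Complex.cos (φ n / 3)‖) atTop
        (𝓝 ‖Complex.cos ((Real.pi + u * Complex.I) / 3)‖) :=
      ((Complex.continuous_cos.tendsto _).comp (hφlim.div_const 3)).norm
    exact (((Real.continuousAt_log hpos.ne').tendsto.comp h2).const_mul 3).sub_const _
  have hmeas : AEStronglyMeasurable ℓ₀ mixMeasure := by
    have := Real.continuous_cosh.measurable
    rw [hℓ₀]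
    exact Measurable.aestronglyMeasurable (by fun_prop)
  set c := Real.log (1 + Real.cosh u) with hc
  have hℓlow : ∀ᵐ v ∂mixMeasure, ∀ n, ℓ₀ v ≤ ℓ n v := hne.mono fun v hv n => Real.log_le_log hv (hlow n v)
  have hℓup : ∀ᵐ v ∂mixMeasure, ∀ n, ℓ n v ≤ c := hne.mono fun v hv n =>
    Real.log_le_log (hv.trans_le (hlow n v)) (hup n v)
  have hℓ₀c : ∀ᵐ v ∂mixMeasure, ℓ₀ v ≤ c := by
    filter_upwards [hℓlow, hℓup] with v h1 h2 using (h1 0).trans (h2 0)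
  have hbdd := hints.bddBelow_range
  obtain ⟨m, hm⟩ := hbdd
  -- Integrability of the boundary function comes from Fatou's lemma, because the integrals inside
  -- the strip converge.
  have hint₀ : Integrable (fun v => c - ℓ₀ v) mixMeasure := by
    refine ⟨aestronglyMeasurable_const.sub hmeas, ?_⟩
    rw [hasFiniteIntegral_iff_ofReal (hℓ₀c.mono fun v hv => sub_nonneg.2 hv)]
    have hfatou : ∫⁻ v, ENNReal.ofReal (c - ℓ₀ v) ∂mixMeasure ≤
        liminf (fun n => ∫⁻ v, ENNReal.ofReal (c - ℓ n v) ∂mixMeasure) atTop := by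
      refine le_trans (le_of_eq ?_) (lintegral_liminf_le' fun n => ?_)
      · refine lintegral_congr_ae (hptw.mono fun v hv => ?_)
        exact ((ENNReal.continuous_ofReal.tendsto _).comp (hv.const_sub c)).liminf_eq.symm
      · exact (aemeasurable_const.sub (integral_log_norm (hstrip n)).1.1.aemeasurable).ennreal_ofReal
    refine (hfatou.trans (liminf_le_of_frequently_le' (Frequently.of_forall fun n => ?_))).trans_lt
      (ENNReal.ofReal_lt_top (r := c - m))
    have h1 : Integrable (fun v => c - ℓ n v) mixMeasure :=
      (integrable_const c).sub (integral_log_norm (hstrip n)).1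
    rw [← ofReal_integral_eq_lintegral_ofReal h1 (hℓup.mono fun v hv => sub_nonneg.2 (hv n))]
    refine ENNReal.ofReal_le_ofReal ?_
    rw [integral_sub (integrable_const c) (integral_log_norm (hstrip n)).1]
    rw [integral_const, probReal_univ, one_smul]
    exact sub_le_sub_left (hm ⟨n, rfl⟩) c
  have hI : Integrable ℓ₀ mixMeasure := by
    refine ((integrable_const c).sub hint₀).congr (ae_of_all _ fun v => ?_)
    simp
  refine ⟨hI, tendsto_nhds_unique ?_ hints⟩
  refine tendsto_integral_of_dominated_convergence (fun v => |ℓ₀ v| + |c|)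
    (fun n => (integral_log_norm (hstrip n)).1.1) (hI.abs.add (integrable_const _)) (fun n => ?_) hptw
  filter_upwards [hℓlow, hℓup] with v h1 h2
  rw [Real.norm_eq_abs, abs_le]
  constructor
  · linarith [h1 n, neg_abs_le (ℓ₀ v), abs_nonneg c]
  · linarith [h2 n, le_abs_self c, abs_nonneg (ℓ₀ v)]

end Mixing

end Biorthogonal
end

/-! ### The potential of the law of 1 / cosh V on the real line, and the excess. -/

noncomputable section
namespace Biorthogonal

section Potential

lemma ae_mixMeasure_cosh_ne (s : ℝ) : ∀ᵐ v ∂mixMeasure, Real.cosh v ≠ s := by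
  have hnull : volume {v : ℝ | 0 < v ∧ Real.cosh v = s} = 0 := by
    refine Set.Subsingleton.measure_zero (fun x hx y hy => ?_) _
    exact Real.cosh_injOn hx.1.le hy.1.le (hx.2.trans hy.2.symm)
  filter_upwards [ae_mixMeasure_pos,
    mixMeasure_absolutelyContinuous.ae_le (measure_eq_zero_iff_ae_notMem.1 hnull)] with v h1 h2 h3
  exact h2 ⟨h1, h3⟩

/-- The logarithmic potential of the law of `1 / cosh V`. -/
def mixPotential (s : ℝ) : ℝ := ∫ v, Real.log |1 - s * (Real.cosh v)⁻¹| ∂mixMeasure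

/-- The constant in the equilibrium condition for the mixing distribution. -/
def mixConst : ℝ := -3 * Real.log 4 - 9 * Real.log (√3 / 2)

/-- Writing s = cosh u, the potentials at s and -s are the values at φ = π + i u and φ = i u. The
factorisation cosh u = 4 |cos((π + i u)/3)|² cosh(u/3) collapses the combination with weights 2 and
1 to 3 log s plus a constant. -/
lemma mixPotential_of_one_lt {s : ℝ} (hs : 1 < s) :
    Integrable (fun v : ℝ => Real.log |1 - s * (Real.cosh v)⁻¹|) mixMeasure ∧
    Integrable (fun v : ℝ => Real.log |1 - -s * (Real.cosh v)⁻¹|) mixMeasure ∧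
    2 * mixPotential s + mixPotential (-s) = 3 * Real.log s + mixConst := by
  obtain ⟨u, hu, rfl⟩ : ∃ u, 0 < u ∧ Real.cosh u = s :=
    ⟨Real.arcosh s, Real.arcosh_pos hs, Real.cosh_arcosh hs.le⟩
  obtain ⟨h1, h2⟩ := integral_log_boundary hu
  obtain ⟨h3, h4⟩ := integral_log_norm (φ := u * Complex.I) (by simpa using Real.pi_pos)
  have e1 : ∀ v : ℝ, ‖1 + Complex.cos (u * Complex.I) * ((Real.cosh v)⁻¹ : ℝ)‖ =
      |1 - -Real.cosh u * (Real.cosh v)⁻¹| := by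
    intro v
    have : 1 + Complex.cos (u * Complex.I) * ((Real.cosh v)⁻¹ : ℝ) =
        ((1 - -Real.cosh u * (Real.cosh v)⁻¹ : ℝ) : ℂ) := by
      rw [Complex.cos_mul_I]; push_cast; ring
    rw [this, Complex.norm_real, Real.norm_eq_abs]
  simp_rw [e1] at h3 h4
  refine ⟨h1, h3, ?_⟩
  have e2 : ‖Complex.cos (u * Complex.I / 3)‖ = Real.cosh (u / 3) := by
    have : (u * Complex.I / 3 : ℂ) = ((u / 3 : ℝ) : ℂ) * Complex.I := by push_cast; ring
    rw [this, Complex.cos_mul_I, ← Complex.ofReal_cosh, Complex.norm_real,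
      Real.norm_of_nonneg (Real.cosh_pos _).le]
  have e3 : ‖Complex.cos ((Real.pi + u * Complex.I) / 3)‖ ^ 2 = Real.cosh (u / 3) ^ 2 - 3 / 4 := by
    have hre : ((Real.pi + u * Complex.I) / 3 : ℂ).re = Real.pi / 3 := by simp
    have him : ((Real.pi + u * Complex.I) / 3 : ℂ).im = u / 3 := by simp
    rw [← Complex.normSq_eq_norm_sq, Complex.normSq_apply, cos_re, cos_im, hre, him,
      Real.cos_pi_div_three, Real.sin_pi_div_three]
    have h5 := Real.cosh_sq (u / 3)
    have h6 : √3 ^ 2 = 3 := Real.sq_sqrt (by norm_num)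
    linear_combination (Real.sinh (u / 3) ^ 2 / 4) * h6 - (3 / 4) * h5
  have e4 : Real.cosh u = 4 * (‖Complex.cos ((Real.pi + u * Complex.I) / 3)‖ ^ 2 * Real.cosh (u / 3)) := by
    have h7 := Real.cosh_three_mul (u / 3)
    rw [mul_div_cancel₀ u (by norm_num : (3 : ℝ) ≠ 0)] at h7
    rw [e3, h7]; ring
  have hpos : 0 < ‖Complex.cos ((Real.pi + u * Complex.I) / 3)‖ := by
    refine norm_pos_iff.2 (Complex.slitPlane_ne_zero (Or.inl (re_cos_div_three_pos ?_)))
    simp [abs_of_pos Real.pi_pos]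
  have hc := Real.cosh_pos (u / 3)
  have e5 : Real.log (Real.cosh u) = Real.log 4 +
      (2 * Real.log ‖Complex.cos ((Real.pi + u * Complex.I) / 3)‖ + Real.log (Real.cosh (u / 3))) := by
    rw [e4, Real.log_mul (by norm_num) (by positivity), Real.log_mul (by positivity) hc.ne', Real.log_pow]
    norm_num
  rw [mixPotential, mixPotential, h2, h4, e2, e5, mixConst]
  ring

/-- The excess of the potential of the mixing distribution outside its support. -/
def excess (s : ℝ) : ℝ :=
  3 * (Real.log (Real.cos ((Real.pi - Real.arccos s) / 3))
    - Real.log (Real.cos ((Real.pi + Real.arccos s) / 3)))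

/-- Triple-angle formula in product form, the real counterpart of the factorisation of cosh u. -/
lemma cos_eq_prod (ψ : ℝ) : Real.cos ψ =
    4 * Real.cos (ψ / 3) * Real.cos ((Real.pi - ψ) / 3) * Real.cos ((Real.pi + ψ) / 3) := by
  have h := Real.cos_three_mul (ψ / 3)
  rw [mul_div_cancel₀ ψ (by norm_num : (3 : ℝ) ≠ 0)] at h
  rw [sub_div, add_div, Real.cos_sub, Real.cos_add, Real.cos_pi_div_three, Real.sin_pi_div_three, h]
  have h6 : √3 ^ 2 = 3 := Real.sq_sqrt (by norm_num)
  have h5 := Real.sin_sq_add_cos_sq (ψ / 3)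
  linear_combination (Real.cos (ψ / 3) * Real.sin (ψ / 3) ^ 2) * h6 + 3 * Real.cos (ψ / 3) * h5

lemma cos_pos_of_angle {ψ : ℝ} (h0 : 0 ≤ ψ) (h1 : ψ < Real.pi / 2) :
    0 < Real.cos (ψ / 3) ∧ 0 < Real.cos ((Real.pi + ψ) / 3) ∧
      Real.cos ((Real.pi + ψ) / 3) ≤ Real.cos ((Real.pi - ψ) / 3) := by
  have hπ := Real.pi_pos
  refine ⟨Real.cos_pos_of_mem_Ioo ⟨by linarith, by linarith⟩,
    Real.cos_pos_of_mem_Ioo ⟨by linarith, by linarith⟩, ?_⟩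
  exact Real.cos_le_cos_of_nonneg_of_le_pi (by linarith) (by linarith) (by linarith)

lemma excess_nonneg {s : ℝ} (hs : s ∈ Set.Ioo (0 : ℝ) 1) : 0 ≤ excess s := by
  obtain ⟨-, h2, h3⟩ := cos_pos_of_angle (Real.arccos_nonneg s) (Real.arccos_lt_pi_div_two.2 hs.1)
  have := Real.log_le_log h2 h3
  unfold excess
  linarith

/-- Now s = cos ψ, and s and -s correspond to φ = π - ψ and φ = ψ. The squared modulus becomes
cos²((π-ψ)/3) instead of the product of two different cosines; `excess` records the discrepancy. -/
lemma mixPotential_of_lt_one {s : ℝ} (hs : s ∈ Set.Ioo (0 : ℝ) 1) :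
    Integrable (fun v : ℝ => Real.log |1 - s * (Real.cosh v)⁻¹|) mixMeasure ∧
    Integrable (fun v : ℝ => Real.log |1 - -s * (Real.cosh v)⁻¹|) mixMeasure ∧
    2 * mixPotential s + mixPotential (-s) = 3 * Real.log s + mixConst + excess s := by
  have h0 := Real.arccos_nonneg s
  have h1 : Real.arccos s < Real.pi / 2 := Real.arccos_lt_pi_div_two.2 hs.1
  have hcos : Real.cos (Real.arccos s) = s := Real.cos_arccos (by linarith [hs.1]) hs.2.le
  have hψ0 : 0 < Real.arccos s := Real.arccos_pos.2 hs.2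
  rw [excess]
  set ψ := Real.arccos s with hψ
  have key : ∀ (φ : ℝ), |φ| < Real.pi →
      Integrable (fun v : ℝ => Real.log |1 - -Real.cos φ * (Real.cosh v)⁻¹|) mixMeasure ∧
      mixPotential (-Real.cos φ) = 3 * Real.log |Real.cos (φ / 3)| - 3 * Real.log (√3 / 2) := by
    intro φ hφ
    obtain ⟨h3, h4⟩ := integral_log_norm (φ := φ) (by simpa using hφ)
    have e1 : ∀ v : ℝ, ‖1 + Complex.cos φ * ((Real.cosh v)⁻¹ : ℝ)‖ =
        |1 - -Real.cos φ * (Real.cosh v)⁻¹| := by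
      intro v
      have : 1 + Complex.cos φ * ((Real.cosh v)⁻¹ : ℝ) =
          ((1 - -Real.cos φ * (Real.cosh v)⁻¹ : ℝ) : ℂ) := by
        push_cast; ring
      rw [this, Complex.norm_real, Real.norm_eq_abs]
    have e2 : ‖Complex.cos (φ / 3)‖ = |Real.cos (φ / 3)| := by
      have : (φ / 3 : ℂ) = ((φ / 3 : ℝ) : ℂ) := by push_cast; ring
      rw [this, ← Complex.ofReal_cos, Complex.norm_real, Real.norm_eq_abs]
    simp_rw [e1] at h3 h4
    exact ⟨h3, by rw [mixPotential, h4, e2]⟩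
  obtain ⟨i1, p1⟩ := key ψ (by rw [abs_of_nonneg h0]; linarith)
  obtain ⟨i2, p2⟩ := key (Real.pi - ψ) (by rw [abs_of_nonneg (by linarith)]; linarith)
  rw [Real.cos_pi_sub, neg_neg, hcos] at i2 p2
  rw [hcos] at i1 p1
  refine ⟨i2, i1, ?_⟩
  obtain ⟨c1, c2, c3⟩ := cos_pos_of_angle h0 h1
  have c4 := c2.trans_le c3
  rw [p1, p2, abs_of_pos c1, abs_of_pos c4]
  have hs4 : Real.log s = Real.log 4 + Real.log (Real.cos (ψ / 3))
      + Real.log (Real.cos ((Real.pi - ψ) / 3)) + Real.log (Real.cos ((Real.pi + ψ) / 3)) := by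
    conv_lhs => rw [← hcos]
    rw [cos_eq_prod ψ, Real.log_mul (by positivity) c2.ne', Real.log_mul (by positivity) c4.ne',
      Real.log_mul (by norm_num) c1.ne']
  rw [hs4, mixConst]
  ring

/-- A primitive of the excess. -/
def excessPrimitive (s : ℝ) : ℝ :=
  3 * s * Real.log (Real.cos ((Real.pi - Real.arccos s) / 3))
    - 12 * Real.cos (Real.arccos s / 3) * Real.cos ((Real.pi - Real.arccos s) / 3) *
      (Real.cos ((Real.pi + Real.arccos s) / 3) * Real.log (Real.cos ((Real.pi + Real.arccos s) / 3)))
    - 6 * √3 * Real.sin (Real.arccos s / 3)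

/-- At s = 0 the angle (π + arccos s)/3 is π/2 and the logarithm of its cosine is singular. The
primitive keeps that cosine next to its logarithm, so continuity of t log t applies. -/
lemma continuousOn_excessPrimitive : ContinuousOn excessPrimitive (Set.Icc 0 1) := by
  have h1 := Real.continuous_arccos
  have h2 := Real.continuous_cos
  have h3 := Real.continuous_sin
  have h4 : ContinuousOn (fun s => Real.log (Real.cos ((Real.pi - Real.arccos s) / 3))) (Set.Icc 0 1) := by
    refine ContinuousOn.log (by fun_prop) fun s hs => ?_
    have := Real.arccos_nonneg s
    have := Real.arccos_le_pi s
    exact (Real.cos_pos_of_mem_Ioo ⟨by linarith [Real.pi_pos], by linarith [Real.pi_pos]⟩).ne'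
  have h5 : Continuous fun s => Real.cos ((Real.pi + Real.arccos s) / 3) *
      Real.log (Real.cos ((Real.pi + Real.arccos s) / 3)) :=
    Real.continuous_mul_log.comp (by fun_prop)
  unfold excessPrimitive
  fun_prop

lemma excessPrimitive_eq {s : ℝ} (hs : s ∈ Set.Icc (0 : ℝ) 1) :
    excessPrimitive s = s * excess s - 6 * √3 * Real.sin (Real.arccos s / 3) := by
  have h := cos_eq_prod (Real.arccos s)
  rw [Real.cos_arccos (by linarith [hs.1]) hs.2] at h
  rw [excessPrimitive, excess]
  linear_combination (3 * Real.log (Real.cos ((Real.pi + Real.arccos s) / 3))) * h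

lemma hasDerivAt_excessPrimitive {s : ℝ} (hs : s ∈ Set.Ioo (0 : ℝ) 1) :
    HasDerivAt excessPrimitive (excess s) s := by
  have heq : excessPrimitive =ᶠ[𝓝 s] fun s => s * excess s - 6 * √3 * Real.sin (Real.arccos s / 3) := by
    filter_upwards [Ioo_mem_nhds hs.1 hs.2] with t ht
    exact excessPrimitive_eq ⟨ht.1.le, ht.2.le⟩
  refine HasDerivAt.congr_of_eventuallyEq ?_ heq
  obtain ⟨c1, c2, c3⟩ := cos_pos_of_angle (Real.arccos_nonneg s) (Real.arccos_lt_pi_div_two.2 hs.1)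
  have c4 := c2.trans_le c3
  have hψ := Real.hasDerivAt_arccos (x := s) (by linarith [hs.1]) (by linarith [hs.2])
  set d := -(1 / √(1 - s ^ 2)) with hd
  have h := cos_eq_prod (Real.arccos s)
  rw [Real.cos_arccos (by linarith [hs.1]) hs.2.le] at h
  have hA := (((hψ.const_sub Real.pi).div_const 3).cos).log c4.ne'
  have hB := (((hψ.const_add Real.pi).div_const 3).cos).log c2.ne'
  have hS := ((hψ.div_const 3).sin).const_mul (6 * √3)
  have hE : HasDerivAt excess _ s := (hA.sub hB).const_mul 3
  refine (((hasDerivAt_id s).mul hE).sub hS).congr_deriv ?_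
  -- The two angles add up to 2π/3. Hence s times the derivative of the excess equals the derivative
  -- of 6 √3 sin (arccos s / 3), and only the excess itself remains.
  have hsum : Real.sin ((Real.pi - Real.arccos s) / 3) * Real.cos ((Real.pi + Real.arccos s) / 3) +
      Real.cos ((Real.pi - Real.arccos s) / 3) * Real.sin ((Real.pi + Real.arccos s) / 3) = √3 / 2 := by
    rw [← Real.sin_add, ← Real.sin_pi_div_three, ← Real.sin_pi_sub (Real.pi / 3)]
    congr 1; ring
  simp only [id]
  set A := (Real.pi - Real.arccos s) / 3
  set Bq := (Real.pi + Real.arccos s) / 3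
  have hmain : s * (3 * (-Real.sin A * (-d / 3) / Real.cos A - -Real.sin Bq * (d / 3) / Real.cos Bq)) =
      6 * √3 * (Real.cos (Real.arccos s / 3) * (d / 3)) := by
    have e : Real.cos A * Real.cos Bq * (Real.sin A / Real.cos A + Real.sin Bq / Real.cos Bq) = √3 / 2 := by
      rw [← hsum]; field_simp
    calc s * (3 * (-Real.sin A * (-d / 3) / Real.cos A - -Real.sin Bq * (d / 3) / Real.cos Bq))
        = 4 * Real.cos (Real.arccos s / 3) * Real.cos A * Real.cos Bq *
          (3 * (-Real.sin A * (-d / 3) / Real.cos A - -Real.sin Bq * (d / 3) / Real.cos Bq)) := by rw [← h]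
      _ = _ := by linear_combination (4 * Real.cos (Real.arccos s / 3) * d) * e
  rw [hmain]
  ring

/-- The value 3 √3 determines the edge b. Integrability up to the singular endpoint follows from
continuity of the primitive and the sign of its derivative. -/
lemma integral_excess : IntervalIntegrable excess volume 0 1 ∧ ∫ s in (0 : ℝ)..1, excess s = 3 * √3 := by
  have hi : IntervalIntegrable excess volume 0 1 := by
    refine intervalIntegral.intervalIntegrable_deriv_of_nonneg (g := excessPrimitive) ?_ ?_ ?_
    · rw [Set.uIcc_of_le zero_le_one]; exact continuousOn_excessPrimitive
    · simpa using fun x h1 h2 => hasDerivAt_excessPrimitive ⟨h1, h2⟩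
    · simpa using fun x h1 h2 => excess_nonneg ⟨h1, h2⟩
  refine ⟨hi, ?_⟩
  rw [intervalIntegral.integral_eq_sub_of_hasDerivAt_of_le zero_le_one continuousOn_excessPrimitive
    (fun x hx => hasDerivAt_excessPrimitive hx) hi, excessPrimitive_eq (by simp), excessPrimitive_eq (by simp)]
  have h6 : Real.pi / 2 / 3 = Real.pi / 6 := by ring
  simp only [Real.arccos_one, Real.arccos_zero, excess, h6, Real.sin_pi_div_six]
  norm_num
  ring

end Potential

end Biorthogonal
end

noncomputable section
namespace Biorthogonal

/-! ### The equilibrium measure of the boson model -/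

section BosonMeasure

lemma bosonEdge_pos : 0 < bosonEdge := by unfold bosonEdge; positivity

/-- The scaled position `b T / cosh V`. -/
def bosonPosition (z : ℝ × ℝ) : ℝ := bosonEdge * z.2 * (Real.cosh z.1)⁻¹

lemma measurable_bosonPosition : Measurable bosonPosition := by
  have := Real.continuous_cosh.measurable
  unfold bosonPosition
  fun_prop

instance isProbabilityMeasure_restrict_Ioc :
    IsProbabilityMeasure ((volume : Measure ℝ).restrict (Set.Ioc 0 1)) := ⟨by simp⟩

/-- The joint law of the mixing variable and an independent uniform variable. -/
def bosonBase : Measure (ℝ × ℝ) := mixMeasure.prod (volume.restrict (Set.Ioc 0 1))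

instance : IsProbabilityMeasure bosonBase := by unfold bosonBase; infer_instance

/-- The equilibrium measure of the boson model, as a mixture of uniform distributions. -/
def bosonMeasure : Measure ℝ := bosonBase.map bosonPosition

instance : IsProbabilityMeasure bosonMeasure :=
  Measure.isProbabilityMeasure_map measurable_bosonPosition.aemeasurable

lemma ae_bosonBase : ∀ᵐ z ∂bosonBase, 0 < z.1 ∧ 0 < z.2 ∧ z.2 ≤ 1 := by
  have h1 : ∀ᵐ z ∂bosonBase, 0 < z.1 := Measure.quasiMeasurePreserving_fst.ae ae_mixMeasure_pos
  have h2 : ∀ᵐ z ∂bosonBase, z.2 ∈ Set.Ioc (0 : ℝ) 1 :=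
    Measure.quasiMeasurePreserving_snd.ae (ae_restrict_mem measurableSet_Ioc)
  filter_upwards [h1, h2] with z hz1 hz2 using ⟨hz1, hz2.1, hz2.2⟩

lemma map_mul_restrict_Ioc {c : ℝ} (hc : 0 < c) :
    ((volume : Measure ℝ).restrict (Set.Ioc 0 1)).map (fun t => c * t) =
      ENNReal.ofReal c⁻¹ • volume.restrict (Set.Ioc 0 c) := by
  have h1 : (fun t => c * t) ⁻¹' Set.Ioc 0 c = Set.Ioc 0 1 := by
    ext t
    simp only [Set.mem_preimage, Set.mem_Ioc]
    exact and_congr (by simp [hc]) (mul_le_iff_le_one_right hc)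
  rw [← h1, ← Measure.restrict_map (by fun_prop) measurableSet_Ioc, Real.map_volume_mul_left hc.ne',
    Measure.restrict_smul, abs_of_pos (inv_pos.2 hc)]

/-- Given V = v, the position is uniform on (0, b / cosh v]. The condition t ≤ b / cosh v reads v ≤
arcosh (b/t), and integrating cosh (v/3) yields sinh (arcosh (b/t) / 3) / π, which is the stated
density written with exponentials. -/
lemma lintegral_cosh_restrict {t : ℝ} (ht : 0 < t) :
    ∫⁻ v in Set.Ioi (0 : ℝ), (Set.Ioc 0 (bosonEdge * (Real.cosh v)⁻¹)).indicator
      (fun _ => ENNReal.ofReal (√3 / Real.pi / bosonEdge * Real.cosh (v / 3))) t =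
      ENNReal.ofReal (bosonDensity t) := by
  have hb := bosonEdge_pos
  rcases lt_or_ge bosonEdge t with h | h
  · have h0 : bosonDensity t = 0 := by
      unfold bosonDensity; rw [if_neg]; exact fun h' => absurd h'.2 (not_le.2 h)
    rw [h0, ENNReal.ofReal_zero]
    refine (lintegral_congr fun v => ?_).trans lintegral_zero
    refine Set.indicator_of_notMem (fun hm => ?_) _
    have h2 : bosonEdge * (Real.cosh v)⁻¹ ≤ bosonEdge :=
      mul_le_of_le_one_right hb.le (inv_le_one_of_one_le₀ (Real.one_le_cosh v))
    linarith [hm.2]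
  · set q := bosonEdge / t with hq
    have hq1 : 1 ≤ q := (one_le_div ht).2 h
    set a := Real.arcosh q with ha
    have ha0 : 0 ≤ a := Real.arcosh_nonneg hq1
    have hset : ∀ v ∈ Set.Ioi (0 : ℝ), (Set.Ioc 0 (bosonEdge * (Real.cosh v)⁻¹)).indicator
        (fun _ => ENNReal.ofReal (√3 / Real.pi / bosonEdge * Real.cosh (v / 3))) t =
        (Set.Ioc 0 a).indicator
          (fun v => ENNReal.ofReal (√3 / Real.pi / bosonEdge * Real.cosh (v / 3))) v := by
      intro v hv
      have hv0 : 0 < v := hv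
      have hiff : t ∈ Set.Ioc 0 (bosonEdge * (Real.cosh v)⁻¹) ↔ v ∈ Set.Ioc 0 a := by
        simp only [Set.mem_Ioc, ht, hv0, true_and]
        rw [← div_eq_mul_inv, le_div_iff₀ (Real.cosh_pos v), ← le_div_iff₀' ht, ← hq,
          ← Real.cosh_arcosh hq1, Real.cosh_le_cosh, abs_of_pos hv0, abs_of_nonneg ha0]
      by_cases hm : v ∈ Set.Ioc 0 a
      · rw [Set.indicator_of_mem hm, Set.indicator_of_mem (hiff.2 hm)]
      · rw [Set.indicator_of_notMem hm, Set.indicator_of_notMem (fun h => hm (hiff.1 h))]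
    have hcont : Continuous fun v => √3 / Real.pi / bosonEdge * Real.cosh (v / 3) := by
      have := Real.continuous_cosh
      fun_prop
    have hderiv : ∀ v : ℝ, HasDerivAt (fun v => 3 * Real.sinh (v / 3)) (Real.cosh (v / 3)) v := by
      intro v
      have := (((hasDerivAt_id v).div_const 3).sinh).const_mul 3
      refine this.congr_deriv ?_
      simp only [id]
      ring
    have hint : ∫ v in (0 : ℝ)..a, √3 / Real.pi / bosonEdge * Real.cosh (v / 3) =
        1 / Real.pi * Real.sinh (a / 3) := by
      rw [intervalIntegral.integral_const_mul,
        intervalIntegral.integral_eq_sub_of_hasDerivAt (fun v _ => hderiv v)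
          (Continuous.intervalIntegrable (by have := Real.continuous_cosh; fun_prop) _ _)]
      simp only [zero_div, Real.sinh_zero, mul_zero, sub_zero, bosonEdge]
      have : √3 ≠ 0 := by positivity
      have := Real.pi_pos.ne'
      field_simp
    rw [setLIntegral_congr_fun measurableSet_Ioi hset, lintegral_indicator measurableSet_Ioc,
      Measure.restrict_restrict measurableSet_Ioc,
      Set.inter_eq_left.2 (Set.Ioc_subset_Ioi_self : Set.Ioc 0 a ⊆ Set.Ioi 0),
      ← ofReal_integral_eq_lintegral_ofReal (hcont.integrableOn_Ioc)
        (ae_of_all _ fun v => by have := Real.cosh_pos (v / 3); have := Real.pi_pos; positivity),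
      ← intervalIntegral.integral_of_le ha0, hint]
    congr 1
    unfold bosonDensity
    rw [if_pos ⟨ht, h⟩]
    set y := t / bosonEdge with hy
    have hy0 : 0 < y := div_pos ht hb
    have hqy : q = y⁻¹ := by rw [hq, hy, inv_div]
    have hy1 : y ≤ 1 := (div_le_one hb).2 h
    have hy2 : t ^ 2 / bosonEdge ^ 2 = y ^ 2 := by rw [hy, div_pow]
    rw [hy2]
    set r := √(1 - y ^ 2) with hr
    have hr1 : r ≤ 1 := by
      rw [hr, Real.sqrt_le_left zero_le_one]; nlinarith [sq_nonneg y]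
    have hsq : √(q ^ 2 - 1) = r / y := by
      rw [hqy, hr]
      have : (y⁻¹) ^ 2 - 1 = (1 - y ^ 2) / y ^ 2 := by field_simp
      rw [this, Real.sqrt_div' _ (by positivity), Real.sqrt_sq hy0.le]
    have e1 : Real.exp a = (1 + r) / y := by
      rw [ha, Real.exp_arcosh hq1, hsq, hqy]; ring
    have e2 : Real.exp (-a) = (1 - r) / y := by
      rw [Real.exp_neg, ha, Real.exp_arcosh hq1, Real.add_sqrt_self_sq_sub_one_inv hq1, hsq, hqy]; ring
    have e3 : Real.exp (a / 3) = (1 + r) ^ (1 / 3 : ℝ) * y ^ (-(1 / 3 : ℝ)) := by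
      have : Real.exp (a / 3) = Real.exp a ^ (1 / 3 : ℝ) := by rw [← Real.exp_mul]; congr 1; ring
      rw [this, e1, Real.div_rpow (by positivity) hy0.le, Real.rpow_neg hy0.le, div_eq_mul_inv]
    have e4 : Real.exp (-(a / 3)) = (1 - r) ^ (1 / 3 : ℝ) * y ^ (-(1 / 3 : ℝ)) := by
      have : Real.exp (-(a / 3)) = Real.exp (-a) ^ (1 / 3 : ℝ) := by
        rw [← Real.exp_mul]; congr 1; ring
      rw [this, e2, Real.div_rpow (by linarith) hy0.le, Real.rpow_neg hy0.le, div_eq_mul_inv]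
    rw [Real.sinh_eq, e3, e4]
    have := Real.pi_pos.ne'
    field_simp

/-- Conditioning on V and exchanging the order of integration. As the left side is a probability
measure, the normalisation of the density comes for free. -/
theorem bosonMeasure_eq_withDensity :
    bosonMeasure = volume.withDensity fun t => ENNReal.ofReal (bosonDensity t) := by
  have hb := bosonEdge_pos
  refine Measure.ext_of_lintegral _ fun f hf => ?_
  have hcosh := Real.continuous_cosh.measurable
  set k : ℝ → ℝ → ℝ≥0∞ := fun v t => (Set.Ioc 0 (bosonEdge * (Real.cosh v)⁻¹)).indicator
    (fun _ => ENNReal.ofReal (√3 / Real.pi / bosonEdge * Real.cosh (v / 3))) t with hk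
  have hkm : Measurable (Function.uncurry k) := by
    have hset : MeasurableSet {z : ℝ × ℝ | z.2 ∈ Set.Ioc 0 (bosonEdge * (Real.cosh z.1)⁻¹)} := by
      refine MeasurableSet.inter (measurableSet_lt measurable_const measurable_snd)
        (measurableSet_le measurable_snd (by fun_prop))
    have heq : Function.uncurry k = {z : ℝ × ℝ | z.2 ∈ Set.Ioc 0 (bosonEdge * (Real.cosh z.1)⁻¹)}.indicator
        fun z => ENNReal.ofReal (√3 / Real.pi / bosonEdge * Real.cosh (z.1 / 3)) := by
      funext z
      rcases z with ⟨v, t⟩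
      simp only [Function.uncurry, hk, Set.indicator, Set.mem_ofPred_eq]
    rw [heq]
    exact Measurable.indicator (by fun_prop) hset
  have hinner : ∀ v, ENNReal.ofReal (mixDensity v) *
      ∫⁻ T in Set.Ioc (0 : ℝ) 1, f (bosonPosition (v, T)) = ∫⁻ t, k v t * f t := by
    intro v
    have hcv := Real.cosh_pos v
    set c := bosonEdge * (Real.cosh v)⁻¹ with hc
    have hc0 : 0 < c := by positivity
    have h1 : ∫⁻ T in Set.Ioc (0 : ℝ) 1, f (bosonPosition (v, T)) =
        ENNReal.ofReal c⁻¹ * ∫⁻ t in Set.Ioc 0 c, f t := by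
      have h2 : ∀ T, bosonPosition (v, T) = c * T := fun T => by
        simp only [bosonPosition, hc]; ring
      simp_rw [h2]
      rw [← lintegral_map hf (by fun_prop : Measurable fun t => c * t), map_mul_restrict_Ioc hc0,
        lintegral_smul_measure, smul_eq_mul]
    have h3 : mixDensity v * c⁻¹ = √3 / Real.pi / bosonEdge * Real.cosh (v / 3) := by
      rw [mixDensity, hc]; field_simp
    rw [h1, ← mul_assoc, ← ENNReal.ofReal_mul (mixDensity_pos v).le, h3,
      ← lintegral_indicator measurableSet_Ioc, ← lintegral_const_mul _ (hf.indicator measurableSet_Ioc)]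
    refine lintegral_congr fun t => ?_
    simp only [hk, ← hc]
    by_cases ht : t ∈ Set.Ioc 0 c
    · rw [Set.indicator_of_mem ht, Set.indicator_of_mem ht]
    · rw [Set.indicator_of_notMem ht, Set.indicator_of_notMem ht, mul_zero, zero_mul]
  have hpos : Measurable fun z : ℝ × ℝ => f (bosonPosition z) := hf.comp measurable_bosonPosition
  rw [bosonMeasure, lintegral_map hf measurable_bosonPosition, bosonBase, lintegral_prod _ hpos.aemeasurable,
    mixMeasure, lintegral_withDensity_eq_lintegral_mul _ measurable_ofReal_mixDensity
      hpos.lintegral_prod_right']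
  simp only [Pi.mul_apply, hinner]
  rw [lintegral_lintegral_swap (by
    have h2 : Measurable fun z : ℝ × ℝ => f z.2 := hf.comp measurable_snd
    exact (hkm.mul h2).aemeasurable)]
  have hdens : ∀ t, ∫⁻ v in Set.Ioi (0 : ℝ), k v t * f t = ENNReal.ofReal (bosonDensity t) * f t := by
    intro t
    have hkt : Measurable fun v => k v t := hkm.of_uncurry_right
    have hmul : ∫⁻ v in Set.Ioi (0 : ℝ), k v t * f t = (∫⁻ v in Set.Ioi (0 : ℝ), k v t) * f t :=
      lintegral_mul_const (f t) hkt
    rw [hmul]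
    rcases lt_or_ge 0 t with ht | ht
    · rw [lintegral_cosh_restrict ht]
    · have h0 : bosonDensity t = 0 := by
        unfold bosonDensity; rw [if_neg]; exact fun h' => absurd h'.1 (not_lt.2 ht)
      have h1 : ∀ v, k v t = 0 := fun v =>
        Set.indicator_of_notMem (fun hm => absurd hm.1 (not_lt.2 ht)) _
      simp [h0, h1]
  simp only [hdens]
  have hmd : Measurable fun t => ENNReal.ofReal (bosonDensity t) := by
    refine Measurable.ennreal_ofReal ?_
    unfold bosonDensity
    refine Measurable.ite (measurableSet_Ioc (a := (0 : ℝ)) (b := bosonEdge)) ?_ measurable_const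
    fun_prop
  rw [lintegral_withDensity_eq_lintegral_mul _ hmd hf]
  rfl

end BosonMeasure

end Biorthogonal
end

/-! ### The Euler–Lagrange condition for the boson equilibrium measure. -/

noncomputable section
namespace Biorthogonal

section BosonPotential

/-- Since |log y| ≤ -log y + 2 y, the absolute integral is controlled by the signed one already
bounded. -/
lemma integral_abs_log_le {x c : ℝ} (hc : c ≠ 0) :
    ∫ t in (0 : ℝ)..1, |(Real.log |x + c * t|)| ≤ -Real.log |c| + 2 + 2 * (|x| + |c|) := by
  obtain ⟨s, hs, hcs⟩ : ∃ s : ℝ, |s| = 1 ∧ |c| * s = c := by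
    refine ⟨c / |c|, ?_, by field_simp⟩
    rw [abs_div, abs_abs, div_self (abs_ne_zero.2 hc)]
  have h1 := integral_neg_log_add_mul_le x (abs_pos.2 hc) hs
  rw [hcs] at h1
  have hlog : ∀ y : ℝ, 0 ≤ y → |Real.log y| ≤ -Real.log y + 2 * y := by
    intro y hy
    have : Real.log y ≤ y := Real.log_le_self hy
    rcases abs_cases (Real.log y) with h | h <;> linarith
  have i1 := intervalIntegrable_log_abs x c 0 1
  have i2 : IntervalIntegrable (fun t => -Real.log |x + c * t| + 2 * (|x| + |c|)) volume 0 1 :=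
    i1.neg.add intervalIntegrable_const
  calc ∫ t in (0 : ℝ)..1, |(Real.log |x + c * t|)|
      ≤ ∫ t in (0 : ℝ)..1, (-Real.log |x + c * t| + 2 * (|x| + |c|)) := by
        refine intervalIntegral.integral_mono_on zero_le_one i1.abs i2 fun t ht => ?_
        refine (hlog _ (abs_nonneg _)).trans ?_
        have h2 : |x + c * t| ≤ |x| + |c| := by
          refine (abs_add_le _ _).trans ?_
          rw [abs_mul, abs_of_nonneg ht.1]
          gcongr
          exact mul_le_of_le_one_right (abs_nonneg _) ht.2
        linarith
    _ = (∫ t in (0 : ℝ)..1, -Real.log |x + c * t|) + ∫ t in (0 : ℝ)..1, 2 * (|x| + |c|) :=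
        intervalIntegral.integral_add (f := fun t => -Real.log |x + c * t|) i1.neg intervalIntegrable_const
    _ ≤ _ := by
        rw [intervalIntegral.integral_const]
        simp only [sub_zero, one_smul]
        linarith

lemma one_lt_bosonEdge : 1 < bosonEdge := by
  unfold bosonEdge
  have : (1 : ℝ) ≤ √3 := Real.one_le_sqrt.2 (by norm_num)
  linarith

lemma measurable_log_abs_add (x ε : ℝ) : Measurable fun z : ℝ × ℝ => Real.log |x + ε * bosonPosition z| := by
  have := measurable_bosonPosition
  fun_prop

/-- The average over T costs at most log (cosh v) ≤ v, integrable under `mixMeasure`. The bound is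
linear in |x|, so a finite first moment of x gives joint integrability. -/
lemma integrable_log_bosonPosition (x : ℝ) {ε : ℝ} (hε : |ε| = 1) :
    Integrable (fun z => Real.log |x + ε * bosonPosition z|) bosonBase ∧
    ∫ z, ‖Real.log |x + ε * bosonPosition z|‖ ∂bosonBase ≤
      ∫ v, v ∂mixMeasure + (2 + 2 * bosonEdge) + 2 * |x| := by
  have hb := bosonEdge_pos
  have hb1 := one_lt_bosonEdge
  have hε0 : ε ≠ 0 := by rw [← abs_pos, hε]; exact one_pos
  have hpos : ∀ v T : ℝ, x + ε * bosonPosition (v, T) = x + (ε * bosonEdge * (Real.cosh v)⁻¹) * T := by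
    intro v T; simp only [bosonPosition]; ring
  have hc : ∀ v : ℝ, ε * bosonEdge * (Real.cosh v)⁻¹ ≠ 0 := fun v =>
    mul_ne_zero (mul_ne_zero hε0 hb.ne') (inv_ne_zero (Real.cosh_pos v).ne')
  have hcabs : ∀ v : ℝ, |ε * bosonEdge * (Real.cosh v)⁻¹| = bosonEdge * (Real.cosh v)⁻¹ := fun v => by
    rw [abs_mul, abs_mul, hε, one_mul, abs_of_pos hb, abs_of_pos (inv_pos.2 (Real.cosh_pos v))]
  have hm := (measurable_log_abs_add x ε).aestronglyMeasurable (μ := bosonBase)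
  have hsec : ∀ v : ℝ, Integrable (fun T => Real.log |x + ε * bosonPosition (v, T)|)
      ((volume : Measure ℝ).restrict (Set.Ioc 0 1)) := by
    intro v
    simp_rw [hpos]
    have := intervalIntegrable_log_abs x (ε * bosonEdge * (Real.cosh v)⁻¹) 0 1
    rwa [intervalIntegrable_iff_integrableOn_Ioc_of_le zero_le_one] at this
  have hbd : ∀ v : ℝ, 0 < v → ∫ T in Set.Ioc (0 : ℝ) 1, ‖Real.log |x + ε * bosonPosition (v, T)|‖ ≤
      v + ((2 + 2 * bosonEdge) + 2 * |x|) := by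
    intro v hv
    simp_rw [hpos, Real.norm_eq_abs]
    rw [← intervalIntegral.integral_of_le zero_le_one]
    refine (integral_abs_log_le (hc v)).trans ?_
    have hcv := Real.cosh_pos v
    have h2 : Real.log (Real.cosh v) ≤ v := by
      rw [Real.log_le_iff_le_exp hcv, Real.cosh_eq]
      have : Real.exp (-v) ≤ Real.exp v := Real.exp_le_exp.2 (by linarith)
      linarith
    have h3 : 0 ≤ Real.log bosonEdge := Real.log_nonneg hb1.le
    have h4 : bosonEdge * (Real.cosh v)⁻¹ ≤ bosonEdge :=
      mul_le_of_le_one_right hb.le (inv_le_one_of_one_le₀ (Real.one_le_cosh v))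
    rw [hcabs, Real.log_mul hb.ne' (inv_ne_zero hcv.ne'), Real.log_inv]
    linarith
  have hbi : Integrable (fun v : ℝ => v + ((2 + 2 * bosonEdge) + 2 * |x|)) mixMeasure :=
    integrable_id_mixMeasure.add (integrable_const _)
  have hi : Integrable (fun z => Real.log |x + ε * bosonPosition z|) bosonBase := by
    unfold bosonBase at hm ⊢
    rw [integrable_prod_iff hm]
    refine ⟨ae_of_all _ hsec, hbi.mono' hm.norm.integral_prod_right' ?_⟩
    filter_upwards [ae_mixMeasure_pos] with v hv
    rw [Real.norm_of_nonneg (integral_nonneg fun _ => norm_nonneg _)]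
    exact hbd v hv
  refine ⟨hi, ?_⟩
  have hi2 := hi.norm
  unfold bosonBase at hi2 ⊢
  rw [integral_prod _ hi2]
  calc _ ≤ ∫ v, (v + ((2 + 2 * bosonEdge) + 2 * |x|)) ∂mixMeasure :=
        integral_mono_ae hi2.integral_prod_left hbi (ae_mixMeasure_pos.mono hbd)
    _ = _ := by
        rw [integral_add integrable_id_mixMeasure (integrable_const _)]
        simp; ring

/-- Logarithmic integrability against the equilibrium measure. -/
lemma integrable_log_prod_bosonMeasure {ν : Measure ℝ} [IsProbabilityMeasure ν]
    (hν : Integrable (fun x => x) ν) {ε : ℝ} (hε : |ε| = 1) :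
    Integrable (fun z : ℝ × ℝ => Real.log |z.1 + ε * z.2|) (ν.prod bosonMeasure) := by
  have hmap : ν.prod bosonMeasure = (ν.prod bosonBase).map (Prod.map id bosonPosition) := by
    rw [bosonMeasure, ← Measure.map_prod_map _ _ measurable_id measurable_bosonPosition, Measure.map_id]
  have hT : Measurable (Prod.map (id : ℝ → ℝ) bosonPosition) := measurable_id.prodMap measurable_bosonPosition
  have hm : Measurable fun z : ℝ × ℝ => Real.log |z.1 + ε * z.2| := by fun_prop
  rw [hmap, integrable_map_measure hm.aestronglyMeasurable hT.aemeasurable]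
  have hm2 := (hm.comp hT).aestronglyMeasurable (μ := ν.prod bosonBase)
  rw [integrable_prod_iff hm2]
  refine ⟨ae_of_all _ fun x => (integrable_log_bosonPosition x hε).1, ?_⟩
  refine ((integrable_const (∫ v, v ∂mixMeasure + (2 + 2 * bosonEdge))).add
    (hν.abs.const_mul 2)).mono' hm2.norm.integral_prod_right' (ae_of_all _ fun x => ?_)
  rw [Real.norm_of_nonneg (integral_nonneg fun _ => norm_nonneg _)]
  exact (integrable_log_bosonPosition x hε).2

lemma integrable_id_bosonMeasure : Integrable (fun x => x) bosonMeasure := by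
  rw [bosonMeasure, integrable_map_measure (f := bosonPosition) (g := fun x : ℝ => x)
    measurable_id.aestronglyMeasurable measurable_bosonPosition.aemeasurable]
  refine Integrable.of_bound measurable_bosonPosition.aestronglyMeasurable bosonEdge ?_
  filter_upwards [ae_bosonBase] with z hz
  have hb := bosonEdge_pos
  have h1 : 0 < (Real.cosh z.1)⁻¹ := inv_pos.2 (Real.cosh_pos z.1)
  have h2 : (Real.cosh z.1)⁻¹ ≤ 1 := inv_le_one_of_one_le₀ (Real.one_le_cosh z.1)
  have h3 : 0 < z.2 := hz.2.1
  simp only [Function.comp, bosonPosition]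
  rw [Real.norm_of_nonneg (by positivity), mul_assoc]
  refine mul_le_of_le_one_right hb.le ?_
  nlinarith [hz.2.2]

/-- The excess, extended by zero. -/
def excessExt : ℝ → ℝ := (Set.Ioo (0 : ℝ) 1).indicator excess

lemma excessExt_nonneg (s : ℝ) : 0 ≤ excessExt s :=
  Set.indicator_nonneg (fun _ h => excess_nonneg h) s

lemma integrable_excessExt : Integrable excessExt ∧ ∫ s, excessExt s = bosonEdge := by
  obtain ⟨h1, h2⟩ := integral_excess
  rw [intervalIntegrable_iff_integrableOn_Ioo_of_le zero_le_one] at h1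
  refine ⟨h1.integrable_indicator measurableSet_Ioo, ?_⟩
  rw [excessExt, integral_indicator measurableSet_Ioo, ← integral_Ioc_eq_integral_Ioo,
    ← intervalIntegral.integral_of_le zero_le_one, h2, bosonEdge]

/-- After scaling, the integral is x/b times the integral of the excess over (0, b/x], whose total
is b. For x ≤ b all of it is captured; for general x monotonicity gives the inequality. This
produces the linear external field. -/
lemma integral_excessExt_div {x : ℝ} (hx : 0 < x) :
    ∫ T in (0 : ℝ)..1, excessExt (bosonEdge / x * T) ≤ x ∧
    (x ≤ bosonEdge → ∫ T in (0 : ℝ)..1, excessExt (bosonEdge / x * T) = x) := by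
  have hb := bosonEdge_pos
  obtain ⟨hi, hI⟩ := integrable_excessExt
  have hc : 0 < bosonEdge / x := div_pos hb hx
  rw [intervalIntegral.integral_comp_mul_left _ hc.ne', mul_zero, mul_one,
    intervalIntegral.integral_of_le hc.le, smul_eq_mul]
  have e : (bosonEdge / x)⁻¹ * bosonEdge = x := by field_simp
  constructor
  · calc _ ≤ (bosonEdge / x)⁻¹ * bosonEdge := by
          refine mul_le_mul_of_nonneg_left ?_ (inv_nonneg.2 hc.le)
          exact (setIntegral_le_integral hi (ae_of_all _ excessExt_nonneg)).trans_eq hI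
      _ = x := e
  · intro hxb
    have h1 : ∫ s in Set.Ioc 0 (bosonEdge / x), excessExt s = bosonEdge := by
      refine (setIntegral_eq_integral_of_forall_compl_eq_zero fun s hs => ?_).trans hI
      refine Set.indicator_of_notMem (fun hs' => hs ⟨hs'.1, hs'.2.le.trans ?_⟩) _
      exact (one_le_div hx).2 hxb
    rw [h1, e]

/-- The equilibrium constant. -/
def bosonConst : ℝ := ∫ T in (0 : ℝ)..1, (3 * Real.log bosonEdge + mixConst + 3 * Real.log T)

/-- Factoring x out of both logarithms leaves the mixing potential at s = b T / x; the contributions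
3 log x cancel. -/
lemma integral_mix_section {x T : ℝ} (hx : 0 < x) (hT : 0 < T) (hne : bosonEdge * T / x ≠ 1) :
    ∫ v, (2 * Real.log |x - bosonPosition (v, T)| + Real.log |x + bosonPosition (v, T)|) ∂mixMeasure =
      (3 * Real.log bosonEdge + mixConst + 3 * Real.log T) + excessExt (bosonEdge / x * T) := by
  have hb := bosonEdge_pos
  set s := bosonEdge * T / x with hs
  have hs0 : 0 < s := by positivity
  have hxs : x * s = bosonEdge * T := by rw [hs]; field_simp
  have hlogs : Real.log s = Real.log bosonEdge + Real.log T - Real.log x := by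
    rw [hs, Real.log_div (by positivity) hx.ne', Real.log_mul hb.ne' hT.ne']
  have hs' : bosonEdge / x * T = s := by rw [hs]; ring
  have key : Integrable (fun v : ℝ => Real.log |1 - s * (Real.cosh v)⁻¹|) mixMeasure ∧
      Integrable (fun v : ℝ => Real.log |1 - -s * (Real.cosh v)⁻¹|) mixMeasure ∧
      2 * mixPotential s + mixPotential (-s) = 3 * Real.log s + mixConst + excessExt s := by
    rcases lt_or_gt_of_ne hne with h | h
    · obtain ⟨a1, a2, a3⟩ := mixPotential_of_lt_one ⟨hs0, h⟩
      refine ⟨a1, a2, ?_⟩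
      rw [a3, excessExt, Set.indicator_of_mem (show s ∈ Set.Ioo (0 : ℝ) 1 from ⟨hs0, h⟩)]
    · obtain ⟨a1, a2, a3⟩ := mixPotential_of_one_lt h
      refine ⟨a1, a2, ?_⟩
      rw [a3, excessExt, Set.indicator_of_notMem (fun h' => absurd h'.2 (not_lt.2 h.le)), add_zero]
  obtain ⟨i1, i2, hval⟩ := key
  have hcongr : (fun v => 2 * Real.log |x - bosonPosition (v, T)| + Real.log |x + bosonPosition (v, T)|)
      =ᵐ[mixMeasure] fun v => 3 * Real.log x + (2 * Real.log |1 - s * (Real.cosh v)⁻¹|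
        + Real.log |1 - -s * (Real.cosh v)⁻¹|) := by
    filter_upwards [ae_mixMeasure_cosh_ne s] with v hv
    have hcv := Real.cosh_pos v
    have e1 : x - bosonPosition (v, T) = x * (1 - s * (Real.cosh v)⁻¹) := by
      simp only [bosonPosition]; rw [← hxs]; ring
    have e2 : x + bosonPosition (v, T) = x * (1 - -s * (Real.cosh v)⁻¹) := by
      simp only [bosonPosition]; rw [← hxs]; ring
    have n1 : |1 - s * (Real.cosh v)⁻¹| ≠ 0 := by
      refine abs_ne_zero.2 (sub_ne_zero.2 fun h => hv ?_)
      rwa [eq_comm, mul_inv_eq_one₀ hcv.ne', eq_comm] at h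
    have n2 : |1 - -s * (Real.cosh v)⁻¹| ≠ 0 := by
      refine abs_ne_zero.2 (ne_of_gt ?_)
      have : 0 < s * (Real.cosh v)⁻¹ := by positivity
      linarith
    rw [e1, e2, abs_mul, abs_mul, Real.log_mul (abs_pos.2 hx.ne').ne' n1,
      Real.log_mul (abs_pos.2 hx.ne').ne' n2, abs_of_pos hx]
    ring
  have i3 : Integrable (fun v : ℝ => 2 * Real.log |1 - s * (Real.cosh v)⁻¹|) mixMeasure := i1.const_mul 2
  have i4 : Integrable (fun v : ℝ => 2 * Real.log |1 - s * (Real.cosh v)⁻¹|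
      + Real.log |1 - -s * (Real.cosh v)⁻¹|) mixMeasure := i3.add i2
  rw [integral_congr_ae hcongr, integral_add (integrable_const _) i4, integral_add i3 i2,
    integral_const_mul 2 (fun v => Real.log |1 - s * (Real.cosh v)⁻¹|), hs', integral_const, probReal_univ,
    one_smul]
  unfold mixPotential at hval
  linarith

/-- The equilibrium condition. -/
theorem bosonPotential {x : ℝ} (hx : 0 < x) :
    ∫ y, (2 * Real.log |x - y| + Real.log |x + y|) ∂bosonMeasure ≤ bosonConst + x ∧
    (x ≤ bosonEdge →
      ∫ y, (2 * Real.log |x - y| + Real.log |x + y|) ∂bosonMeasure = bosonConst + x) := by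
  have hb := bosonEdge_pos
  have hm : Measurable fun y => 2 * Real.log |x - y| + Real.log |x + y| := by fun_prop
  have i1 : Integrable (fun z => Real.log |x - bosonPosition z|) bosonBase := by
    simpa [sub_eq_add_neg] using (integrable_log_bosonPosition x (ε := -1) (by simp)).1
  have i2 : Integrable (fun z => Real.log |x + bosonPosition z|) bosonBase := by
    simpa using (integrable_log_bosonPosition x (ε := 1) (by simp)).1
  have i3 : Integrable (fun z => 2 * Real.log |x - bosonPosition z| + Real.log |x + bosonPosition z|)
      (mixMeasure.prod (volume.restrict (Set.Ioc 0 1))) := (i1.const_mul 2).add i2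
  have hlogT : IntervalIntegrable (fun T : ℝ => 3 * Real.log bosonEdge + mixConst + 3 * Real.log T) volume 0 1 :=
    intervalIntegrable_const.add (intervalIntegral.intervalIntegrable_log'.const_mul 3)
  have hext : IntervalIntegrable (fun T => excessExt (bosonEdge / x * T)) volume 0 1 :=
    (integrable_excessExt.1.comp_mul_left' (div_pos hb hx).ne').intervalIntegrable
  have hval : ∫ y, (2 * Real.log |x - y| + Real.log |x + y|) ∂bosonMeasure =
      bosonConst + ∫ T in (0 : ℝ)..1, excessExt (bosonEdge / x * T) := by
    rw [bosonMeasure, integral_map measurable_bosonPosition.aemeasurable hm.aestronglyMeasurable, bosonBase,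
      integral_prod_symm _ i3, bosonConst, ← intervalIntegral.integral_add hlogT hext,
      intervalIntegral.integral_of_le zero_le_one]
    refine integral_congr_ae ?_
    have hne : ∀ᵐ T : ℝ ∂(volume : Measure ℝ).restrict (Set.Ioc 0 1), T ≠ x / bosonEdge :=
      ae_restrict_of_ae (Measure.ae_ne volume _)
    filter_upwards [hne, ae_restrict_mem measurableSet_Ioc] with T hT1 hT2
    refine integral_mix_section hx hT2.1 fun h => hT1 ?_
    rw [div_eq_one_iff_eq hx.ne'] at h
    rw [← h]; field_simp
  obtain ⟨h1, h2⟩ := integral_excessExt_div hx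
  rw [hval]
  exact ⟨by linarith, fun hxb => by rw [h2 hxb]⟩

end BosonPotential

end Biorthogonal
end

/-! ### Uniqueness of the boson equilibrium measure and the strong law. -/

noncomputable section
namespace Biorthogonal

section BosonEquilibrium

/-- The limiting weight of the boson model. -/
def bosonWeight (t : ℝ) : ℝ := Real.exp (-t)

lemma realInteraction_boson {x y : ℝ} (h : x ^ 2 ≠ y ^ 2) :
    realInteraction 2 1 bosonWeight x y =
      -Real.log |x - y| + 1 / 2 * -Real.log |x + y| + 1 / 2 * (x + y) := by
  have h0 : x ^ 2 - y ^ 2 = (x - y) * (x + y) := by ring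
  have h1 : x ^ 2 - y ^ 2 ≠ 0 := sub_ne_zero.2 h
  rw [h0] at h1
  rw [realInteraction, h0, Real.log_inv, Real.log_inv, abs_mul,
    Real.log_mul (abs_ne_zero.2 (left_ne_zero_of_mul h1)) (abs_ne_zero.2 (right_ne_zero_of_mul h1)),
    bosonWeight, bosonWeight, Real.log_exp, Real.log_exp]
  ring

/-- The factor 8 makes the logarithms, of total weight 3/2, cost 3c/16, well below the linear term
c/2 of the interaction. At u = 0 the convention log 0 = 0 is harmless. -/
lemma log_abs_le {u c : ℝ} (hu : |u| ≤ c) : Real.log |u| ≤ c / 8 + Real.log 8 := by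
  rcases (abs_nonneg u).eq_or_lt with h | h
  · rw [← h, Real.log_zero]
    have := Real.log_nonneg (show (1 : ℝ) ≤ 8 by norm_num)
    have : 0 ≤ c := by rw [h]; exact hu
    positivity
  · have h1 : Real.log |u| = Real.log (|u| / 8) + Real.log 8 := by
      rw [Real.log_div h.ne' (by norm_num)]; ring
    have h2 := Real.log_le_self (x := |u| / 8) (by positivity)
    linarith

/-- The linear term dominates both logarithms from above, so finite energy forces a finite first
moment. Since each logarithm is at most x + y, the integrable interaction then bounds each of them
below as well. -/
lemma integrable_of_integrable_boson {P : Measure ℝ} [IsProbabilityMeasure P] (h0 : ∀ᵐ x ∂P, 0 ≤ x)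
    (hne : ∀ᵐ z ∂P.prod P, z.1 ^ 2 ≠ z.2 ^ 2)
    (hint : Integrable (fun z : ℝ × ℝ => realInteraction 2 1 bosonWeight z.1 z.2) (P.prod P)) :
    Integrable (fun x => x) P ∧ Integrable (fun z : ℝ × ℝ => Real.log |z.1 - z.2|) (P.prod P) ∧
      Integrable (fun z : ℝ × ℝ => Real.log |z.1 + z.2|) (P.prod P) := by
  have hz1 : ∀ᵐ z ∂P.prod P, 0 ≤ z.1 := Measure.quasiMeasurePreserving_fst.ae h0
  have hz2 : ∀ᵐ z ∂P.prod P, 0 ≤ z.2 := Measure.quasiMeasurePreserving_snd.ae h0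
  have hi1 : Integrable (fun z : ℝ × ℝ => z.1) (P.prod P) := by
    refine ((hint.add (integrable_const (3 / 2 * Real.log 8))).const_mul 4).mono'
      measurable_fst.aestronglyMeasurable ?_
    filter_upwards [hne, hz1, hz2] with z hz h1 h2
    have a1 : |z.1 - z.2| ≤ z.1 + z.2 := abs_le.2 ⟨by linarith, by linarith⟩
    have a2 : |z.1 + z.2| ≤ z.1 + z.2 := (abs_of_nonneg (by linarith)).le
    have := log_abs_le a1
    have := log_abs_le a2
    simp only [Pi.add_apply]
    rw [Real.norm_of_nonneg h1, realInteraction_boson hz]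
    linarith
  have hid : Integrable (fun x => x) P :=
    (measurePreserving_fst (μ := P) (ν := P)).integrable_comp measurable_id.aestronglyMeasurable |>.1 hi1
  have hi2 : Integrable (fun z : ℝ × ℝ => z.2) (P.prod P) := hid.comp_snd P
  have hdom := hint.norm.const_mul 2 |>.add (hi1.add hi2)
  have hm1 : Measurable fun z : ℝ × ℝ => Real.log |z.1 - z.2| := by fun_prop
  have hm2 : Measurable fun z : ℝ × ℝ => Real.log |z.1 + z.2| := by fun_prop
  refine ⟨hid, hdom.mono' hm1.aestronglyMeasurable ?_, hdom.mono' hm2.aestronglyMeasurable ?_⟩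
  all_goals
    filter_upwards [hne, hz1, hz2] with z hz h1 h2
    have a1 : |z.1 - z.2| ≤ z.1 + z.2 := abs_le.2 ⟨by linarith, by linarith⟩
    have a2 : |z.1 + z.2| ≤ z.1 + z.2 := (abs_of_nonneg (by linarith)).le
    have b1 := (Real.log_le_self (abs_nonneg (z.1 - z.2))).trans a1
    have b2 := (Real.log_le_self (abs_nonneg (z.1 + z.2))).trans a2
    simp only [Pi.add_apply]
    rw [realInteraction_boson hz]
    have c0 := abs_nonneg (-Real.log |z.1 - z.2| + 1 / 2 * -Real.log |z.1 + z.2| + 1 / 2 * (z.1 + z.2))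
    have c1 := le_abs_self (-Real.log |z.1 - z.2| + 1 / 2 * -Real.log |z.1 + z.2| + 1 / 2 * (z.1 + z.2))
    rw [Real.norm_eq_abs, Real.norm_eq_abs, abs_le]
    constructor <;> linarith

lemma integral_realInteraction_boson {P : Measure ℝ} [IsProbabilityMeasure P]
    (hne : ∀ᵐ z ∂P.prod P, z.1 ^ 2 ≠ z.2 ^ 2) (hid : Integrable (fun x => x) P)
    (i1 : Integrable (fun z : ℝ × ℝ => Real.log |z.1 - z.2|) (P.prod P))
    (i2 : Integrable (fun z : ℝ × ℝ => Real.log |z.1 + z.2|) (P.prod P)) :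
    Integrable (fun z : ℝ × ℝ => realInteraction 2 1 bosonWeight z.1 z.2) (P.prod P) ∧
    ∫ z, realInteraction 2 1 bosonWeight z.1 z.2 ∂P.prod P =
      ∫ z, -Real.log |z.1 - z.2| ∂P.prod P + 1 / 2 * ∫ z, -Real.log |z.1 + z.2| ∂P.prod P
        + ∫ x, x ∂P := by
  have hcongr : (fun z : ℝ × ℝ => realInteraction 2 1 bosonWeight z.1 z.2) =ᵐ[P.prod P]
      fun z => -Real.log |z.1 - z.2| + 1 / 2 * -Real.log |z.1 + z.2| + 1 / 2 * (z.1 + z.2) :=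
    hne.mono fun z hz => realInteraction_boson hz
  have j1 : Integrable (fun z : ℝ × ℝ => -Real.log |z.1 - z.2|) (P.prod P) := i1.neg
  have j2 : Integrable (fun z : ℝ × ℝ => 1 / 2 * -Real.log |z.1 + z.2|) (P.prod P) := i2.neg.const_mul _
  have j3 : Integrable (fun z : ℝ × ℝ => -Real.log |z.1 - z.2| + 1 / 2 * -Real.log |z.1 + z.2|)
      (P.prod P) := j1.add j2
  have k1 : Integrable (fun z : ℝ × ℝ => z.1) (P.prod P) := hid.comp_fst P
  have k2 : Integrable (fun z : ℝ × ℝ => z.2) (P.prod P) := hid.comp_snd P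
  have j4 : Integrable (fun z : ℝ × ℝ => 1 / 2 * (z.1 + z.2)) (P.prod P) := (k1.add k2).const_mul _
  refine ⟨(integrable_congr hcongr).2 (j3.add j4), ?_⟩
  rw [integral_congr_ae hcongr, integral_add j3 j4, integral_add j1 j2,
    integral_const_mul (1 / 2) (fun z : ℝ × ℝ => -Real.log |z.1 + z.2|),
    integral_const_mul (1 / 2) (fun z : ℝ × ℝ => z.1 + z.2), integral_add k1 k2,
    integral_fun_fst (fun x : ℝ => x), integral_fun_snd (fun x : ℝ => x)]
  simp only [probReal_univ, one_smul]
  ring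

/-- Logarithmic energies of the images under squaring. -/
lemma integral_log_map_sq {P Q : Measure ℝ} [IsProbabilityMeasure P] [IsProbabilityMeasure Q]
    (hne : ∀ᵐ z ∂P.prod Q, z.1 ^ 2 ≠ z.2 ^ 2)
    (i1 : Integrable (fun z : ℝ × ℝ => Real.log |z.1 - z.2|) (P.prod Q))
    (i2 : Integrable (fun z : ℝ × ℝ => Real.log |z.1 + z.2|) (P.prod Q)) :
    (∀ᵐ z ∂(P.map (· ^ 2)).prod (Q.map (· ^ 2)), z.1 ≠ z.2) ∧
    Integrable (fun z : ℝ × ℝ => Real.log |z.1 - z.2|) ((P.map (· ^ 2)).prod (Q.map (· ^ 2))) ∧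
    ∫ z, -Real.log |z.1 - z.2| ∂(P.map (· ^ 2)).prod (Q.map (· ^ 2)) =
      ∫ z, -Real.log |z.1 - z.2| ∂P.prod Q + ∫ z, -Real.log |z.1 + z.2| ∂P.prod Q := by
  have hsq : Measurable fun x : ℝ => x ^ 2 := by fun_prop
  have hT : Measurable (Prod.map (fun x : ℝ => x ^ 2) fun x : ℝ => x ^ 2) := hsq.prodMap hsq
  have hmap : (P.map (· ^ 2)).prod (Q.map (· ^ 2)) =
      (P.prod Q).map (Prod.map (fun x : ℝ => x ^ 2) fun x : ℝ => x ^ 2) :=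
    Measure.map_prod_map _ _ hsq hsq
  have hm : Measurable fun z : ℝ × ℝ => Real.log |z.1 - z.2| := by fun_prop
  have hcongr : (fun z : ℝ × ℝ => Real.log |z.1 ^ 2 - z.2 ^ 2|) =ᵐ[P.prod Q]
      fun z => Real.log |z.1 - z.2| + Real.log |z.1 + z.2| := by
    filter_upwards [hne] with z hz
    have h0 : z.1 ^ 2 - z.2 ^ 2 = (z.1 - z.2) * (z.1 + z.2) := by ring
    have h1 : z.1 ^ 2 - z.2 ^ 2 ≠ 0 := sub_ne_zero.2 hz
    rw [h0] at h1
    rw [h0, abs_mul, Real.log_mul (abs_ne_zero.2 (left_ne_zero_of_mul h1))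
      (abs_ne_zero.2 (right_ne_zero_of_mul h1))]
  rw [hmap]
  refine ⟨?_, ?_, ?_⟩
  · have hms : MeasurableSet {z : ℝ × ℝ | z.1 ≠ z.2} :=
      (measurableSet_eq_fun measurable_fst measurable_snd).compl
    rw [ae_map_iff hT.aemeasurable hms]
    exact hne
  · rw [integrable_map_measure hm.aestronglyMeasurable hT.aemeasurable]
    exact (integrable_congr hcongr).2 (i1.add i2)
  · simp only [integral_neg]
    rw [integral_map hT.aemeasurable hm.aestronglyMeasurable]
    simp only [Prod.map_fst, Prod.map_snd]
    rw [integral_congr_ae hcongr, integral_add i1 i2]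
    ring

lemma ae_prod_ne {P Q : Measure ℝ} [SFinite P] [SFinite Q] [NullSingletonClass Q] :
    ∀ᵐ z ∂P.prod Q, z.1 ≠ z.2 := by
  have hms : MeasurableSet {z : ℝ × ℝ | z.1 ≠ z.2} :=
    (measurableSet_eq_fun measurable_fst measurable_snd).compl
  rw [Measure.ae_prod_iff_ae_ae hms]
  exact ae_of_all _ fun x => (Measure.ae_ne Q x).mono fun y hy => hy.symm

instance nullSingletonClass_bosonMeasure : NullSingletonClass bosonMeasure := by
  rw [bosonMeasure_eq_withDensity]
  exact ⟨fun x => withDensity_absolutelyContinuous _ _ (measure_singleton x)⟩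

lemma ae_bosonMeasure : ∀ᵐ x ∂bosonMeasure, 0 < x ∧ x ≤ bosonEdge := by
  rw [bosonMeasure, ae_map_iff measurable_bosonPosition.aemeasurable
    (measurableSet_Ioc (a := (0 : ℝ)) (b := bosonEdge))]
  filter_upwards [ae_bosonBase] with z hz
  have hb := bosonEdge_pos
  have h1 : 0 < (Real.cosh z.1)⁻¹ := inv_pos.2 (Real.cosh_pos z.1)
  have h2 : (Real.cosh z.1)⁻¹ ≤ 1 := inv_le_one_of_one_le₀ (Real.one_le_cosh z.1)
  have h3 : 0 < z.2 := hz.2.1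
  refine ⟨by simp only [bosonPosition]; positivity, ?_⟩
  simp only [bosonPosition]
  rw [mul_assoc]
  refine mul_le_of_le_one_right hb.le ?_
  nlinarith [hz.2.2]

lemma ae_prod_bosonMeasure_sq_ne {P : Measure ℝ} [IsProbabilityMeasure P] (h0 : ∀ᵐ x ∂P, 0 ≤ x) :
    ∀ᵐ z ∂P.prod bosonMeasure, z.1 ^ 2 ≠ z.2 ^ 2 := by
  filter_upwards [ae_prod_ne (P := P) (Q := bosonMeasure),
    Measure.quasiMeasurePreserving_fst.ae h0,
    Measure.quasiMeasurePreserving_snd.ae ae_bosonMeasure] with z hz h1 h2 h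
  exact hz ((sq_eq_sq₀ h1 h2.1.le).1 h)

lemma integrable_log_sub_prod_bosonMeasure {P : Measure ℝ} [IsProbabilityMeasure P]
    (hid : Integrable (fun x => x) P) :
    Integrable (fun z : ℝ × ℝ => Real.log |z.1 - z.2|) (P.prod bosonMeasure) := by
  simpa [sub_eq_add_neg] using integrable_log_prod_bosonMeasure hid (ε := -1) (by simp)

lemma integrable_log_add_prod_bosonMeasure {P : Measure ℝ} [IsProbabilityMeasure P]
    (hid : Integrable (fun x => x) P) :
    Integrable (fun z : ℝ × ℝ => Real.log |z.1 + z.2|) (P.prod bosonMeasure) := by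
  simpa using integrable_log_prod_bosonMeasure hid (ε := 1) (by simp)

/-- The Euler–Lagrange relation integrated against P; it evaluates the cross term when energies are
compared. -/
lemma integral_bosonPotential {P : Measure ℝ} [IsProbabilityMeasure P] (h0 : ∀ᵐ x ∂P, 0 < x)
    (hid : Integrable (fun x => x) P) :
    -2 * ∫ z, -Real.log |z.1 - z.2| ∂P.prod bosonMeasure - ∫ z, -Real.log |z.1 + z.2| ∂P.prod bosonMeasure
      ≤ bosonConst + ∫ x, x ∂P ∧
    ((∀ᵐ x ∂P, x ≤ bosonEdge) →
    -2 * ∫ z, -Real.log |z.1 - z.2| ∂P.prod bosonMeasure - ∫ z, -Real.log |z.1 + z.2| ∂P.prod bosonMeasure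
      = bosonConst + ∫ x, x ∂P) := by
  have i1 := integrable_log_sub_prod_bosonMeasure hid
  have i2 := integrable_log_add_prod_bosonMeasure hid
  have i3 : Integrable (fun z : ℝ × ℝ => 2 * Real.log |z.1 - z.2| + Real.log |z.1 + z.2|)
      (P.prod bosonMeasure) := (i1.const_mul 2).add i2
  have e1 : -2 * ∫ z, -Real.log |z.1 - z.2| ∂P.prod bosonMeasure
      - ∫ z, -Real.log |z.1 + z.2| ∂P.prod bosonMeasure =
      ∫ x, ∫ y, (2 * Real.log |x - y| + Real.log |x + y|) ∂bosonMeasure ∂P := by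
    rw [← integral_prod _ i3, integral_add (i1.const_mul 2) i2, integral_const_mul, integral_neg,
      integral_neg]
    ring
  have e2 : bosonConst + ∫ x, x ∂P = ∫ x, (bosonConst + x) ∂P := by
    rw [integral_add (integrable_const _) hid]; simp
  rw [e1, e2]
  refine ⟨integral_mono_ae i3.integral_prod_left ((integrable_const _).add hid)
    (h0.mono fun x hx => (bosonPotential hx).1), fun hb => integral_congr_ae ?_⟩
  filter_upwards [h0, hb] with x hx hxb using (bosonPotential hx).2 hxb

lemma integrable_boson_bosonMeasure :
    (∀ᵐ z ∂bosonMeasure.prod bosonMeasure, z.1 ^ 2 ≠ z.2 ^ 2) ∧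
    Integrable (fun z : ℝ × ℝ => realInteraction 2 1 bosonWeight z.1 z.2)
      (bosonMeasure.prod bosonMeasure) := by
  have hne := ae_prod_bosonMeasure_sq_ne (ae_bosonMeasure.mono fun x hx => hx.1.le)
  exact ⟨hne, (integral_realInteraction_boson hne integrable_id_bosonMeasure
    (integrable_log_sub_prod_bosonMeasure integrable_id_bosonMeasure)
    (integrable_log_add_prod_bosonMeasure integrable_id_bosonMeasure)).1⟩

/-- Uniqueness of the equilibrium measure of the boson model. -/
theorem eq_bosonMeasure {P : Measure ℝ} [IsProbabilityMeasure P] (h0 : ∀ᵐ x ∂P, 0 ≤ x)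
    (hne : ∀ᵐ z ∂P.prod P, z.1 ^ 2 ≠ z.2 ^ 2)
    (hint : Integrable (fun z : ℝ × ℝ => realInteraction 2 1 bosonWeight z.1 z.2) (P.prod P))
    (hle : ∫ z, realInteraction 2 1 bosonWeight z.1 z.2 ∂P.prod P ≤
      ∫ z, realInteraction 2 1 bosonWeight z.1 z.2 ∂bosonMeasure.prod bosonMeasure) :
    P = bosonMeasure := by
  obtain ⟨hid, i1, i2⟩ := integrable_of_integrable_boson h0 hne hint
  have hP0 : ∀ᵐ x ∂P, 0 < x := by
    have : ∀ᵐ x ∂P, x ≠ 0 := by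
      rw [ae_iff]
      simpa using measure_singleton_eq_zero (f := fun x : ℝ => x ^ 2) hne 0
    filter_upwards [h0, this] with x h1 h2 using lt_of_le_of_ne h1 h2.symm
  have hQid := integrable_id_bosonMeasure
  have hQ0 : ∀ᵐ x ∂bosonMeasure, 0 ≤ x := ae_bosonMeasure.mono fun x hx => hx.1.le
  have n2 := ae_prod_bosonMeasure_sq_ne h0
  have n3 := ae_prod_bosonMeasure_sq_ne hQ0
  have j1 := integrable_log_sub_prod_bosonMeasure hid
  have j2 := integrable_log_add_prod_bosonMeasure hid
  have k1 := integrable_log_sub_prod_bosonMeasure hQid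
  have k2 := integrable_log_add_prod_bosonMeasure hQid
  have hsq : ∀ {z : ℝ × ℝ}, z.1 ^ 2 ≠ z.2 ^ 2 → z.1 ≠ z.2 := fun h h' => h (by rw [h'])
  obtain ⟨d1, d1'⟩ := logEnergy_diff_nonneg (hne.mono fun z => hsq) i1 (n2.mono fun z => hsq) j1
    (n3.mono fun z => hsq) k1
  have hpr : ∀ R : Measure ℝ, IsProbabilityMeasure R → IsProbabilityMeasure (R.map (· ^ 2)) :=
    fun R _ => Measure.isProbabilityMeasure_map (by fun_prop)
  have := hpr P inferInstance
  have := hpr bosonMeasure inferInstance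
  obtain ⟨a1, b1, c1⟩ := integral_log_map_sq hne i1 i2
  obtain ⟨a2, b2, c2⟩ := integral_log_map_sq n2 j1 j2
  obtain ⟨a3, b3, c3⟩ := integral_log_map_sq n3 k1 k2
  -- The kernel -log |x + y| is not treated alone: the images under squaring have kernel -log |x² -
  -- y²|, the sum of both kernels.
  obtain ⟨d2, -⟩ := logEnergy_diff_nonneg a1 b1 a2 b2 a3 b3
  rw [c1, c2, c3] at d2
  rw [(integral_realInteraction_boson hne hid i1 i2).2,
    (integral_realInteraction_boson n3 hQid k1 k2).2] at hle
  have p1 := (integral_bosonPotential hP0 hid).1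
  have p2 := (integral_bosonPotential (ae_bosonMeasure.mono fun x hx => hx.1) hQid).2
    (ae_bosonMeasure.mono fun x hx => hx.2)
  -- By the Euler–Lagrange relations, the energy of P minus that of `bosonMeasure` is at least half
  -- the quadratic form of -log |x - y| plus half that of -log |x² - y²|. Both are nonnegative, so
  -- energy at most minimal forces the first to vanish.
  exact d1' (by linarith)

end BosonEquilibrium

/-- The almost sure convergence of the empirical measures in the boson model. -/
theorem ae_tendsto_bosonLaw (α : ℕ) : ∃ μ : ProbabilityMeasure (Set.Ici (0 : ℝ)),
      (μ : Measure (Set.Ici (0 : ℝ))).map (↑) =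
        (volume : Measure ℝ).withDensity (fun t => ENNReal.ofReal (bosonDensity t)) ∧
      ∀ (Ω : Type*) [MeasurableSpace Ω] (P : Measure Ω) [IsProbabilityMeasure P]
        (X : ∀ n : ℕ, Ω → Fin (n + 1) → Set.Ici (0 : ℝ)),
        (∀ n, HasLaw (X n) (bosonLaw α (n + 1)) P) →
        ∀ᵐ ω ∂P, Tendsto (fun n => empiricalMeasure (X n ω)) atTop (𝓝 μ) := by
  have hSm : MeasurableSet (Set.Ici (0 : ℝ)) := measurableSet_Ici
  have hQ : ∀ᵐ x ∂bosonMeasure, x ∈ Set.Ici (0 : ℝ) := ae_bosonMeasure.mono fun x hx => hx.1.le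
  have hprob := isProbabilityMeasure_comap_coe hSm hQ
  have hmapQ := map_comap_coe hSm hQ
  have h : AdmissibleWeights (Set.Ici 0) 2 1 (fun n => n + 1)
    (fun n t => t ^ α * Real.exp (-((n + 1 : ℕ) * t))) bosonWeight := admissibleWeights_boson α
  refine ⟨⟨bosonMeasure.comap (↑), hprob⟩, ?_, fun Ω _ P _ X hX => ?_⟩
  · exact hmapQ.trans bosonMeasure_eq_withDensity
  -- There are n + 1 particles on the scale n, so the ratio still tends to κ = 1.
  have hp : Tendsto (fun n : ℕ => ((n + 1 : ℕ) : ℝ) / n) atTop (𝓝 1) := by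
    have h1 : Tendsto (fun n : ℕ => 1 + (n : ℝ)⁻¹) atTop (𝓝 (1 + 0)) :=
      tendsto_const_nhds.add tendsto_inv_atTop_nhds_zero_nat
    rw [add_zero] at h1
    refine h1.congr' ?_
    filter_upwards [eventually_gt_atTop 0] with n hn
    have : (n : ℝ) ≠ 0 := by positivity
    push_cast
    field_simp
  refine h.ae_tendsto_empiricalMeasure isClosed_Ici ⟨0, Set.self_mem_Ici⟩
    (fun x hx => ⟨x, x + 1, by linarith, ⟨le_rfl, by linarith⟩, fun y hy => le_trans hx hy.1⟩)
    one_le_two (fun _ => le_rfl) one_pos hp (fun ν hν => ?_) P X (Eventually.of_forall hX)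
  obtain ⟨B, -, hB⟩ := exists_tilted_le isClosed_Ici h.continuousOn h.vanishing
  have hemb := measurableEmbedding_prodMap_coe hSm
  obtain ⟨g1, g2⟩ := integrable_boson_bosonMeasure
  have hQint := energy_le_of_integrable one_le_two one_pos h.continuousOn h.nonneg hB
    (μ := ⟨bosonMeasure.comap (↑), hprob⟩) (by
      rw [← hmapQ, ← map_prodMap_coe, hemb.ae_map_iff] at g1
      exact g1.mono fun z hz => ⟨hz, Real.exp_pos _, Real.exp_pos _⟩) (by
      rw [← hmapQ, ← map_prodMap_coe, hemb.integrable_map_iff] at g2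
      exact g2)
  obtain ⟨m1, m2, m3⟩ := integrable_realInteraction_of_energy_le one_le_two one_pos h.continuousOn
    h.nonneg hB (hν.trans hQint)
  have hν0 : ∀ᵐ x ∂(ν : Measure (Set.Ici (0 : ℝ))).map (↑), (0 : ℝ) ≤ x :=
    (ae_map_iff measurable_subtype_coe.aemeasurable hSm).2 (ae_of_all _ fun x => x.2)
  have hνp : IsProbabilityMeasure ((ν : Measure (Set.Ici (0 : ℝ))).map ((↑) : _ → ℝ)) :=
    Measure.isProbabilityMeasure_map measurable_subtype_coe.aemeasurable
  have key : (ν : Measure (Set.Ici (0 : ℝ))).map ((↑) : _ → ℝ) = bosonMeasure := by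
    refine eq_bosonMeasure hν0 ?_ ?_ ?_
    · rw [← map_prodMap_coe, hemb.ae_map_iff]
      exact m1.mono fun z hz => hz.1
    · rw [← map_prodMap_coe, hemb.integrable_map_iff]
      exact m2
    · rw [← hmapQ, ← map_prodMap_coe, ← map_prodMap_coe, hemb.integral_map, hemb.integral_map]
      exact m3
  refine Subtype.ext (?_ : (ν : Measure (Set.Ici (0 : ℝ))) = bosonMeasure.comap (↑))
  rw [← (MeasurableEmbedding.subtype_coe hSm).comap_map (ν : Measure (Set.Ici (0 : ℝ))), key]

end Biorthogonal
end

theorem corollary2p2 :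
    -- the general ensembles
    (∀ (S : Set ℝ) (θ : ℕ) (κ : ℝ) (p : ℕ → ℕ) [∀ n, NeZero (p n)]
        (wn : ℕ → ℝ → ℝ) (w : ℝ → ℝ),
      S.Nonempty → IsClosed S →
      (∀ x ∈ S, ∃ a b : ℝ, a < b ∧ x ∈ Set.Icc a b ∧ Set.Icc a b ⊆ S) →
      1 ≤ θ → (Even θ → S ⊆ Set.Ici 0) →
      0 < κ → Tendsto (fun n : ℕ => (p n : ℝ) / n) atTop (𝓝 κ) →
      (∀ n, ContinuousOn (wn n) S) → (∀ n, ∀ x ∈ S, 0 ≤ wn n x) →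
      Biorthogonal.ConditionA1 S wn w → Biorthogonal.ConditionA2 S θ κ wn →
      -- `Q_n` is a probability measure for large `n`
      (∀ᶠ n in atTop, IsProbabilityMeasure (Biorthogonal.ensembleLaw S θ p wn n)) ∧
      -- strong law of large numbers
      (∀ μ : ProbabilityMeasure S,
        (∀ ν, Biorthogonal.rate S θ κ w μ ≤ Biorthogonal.rate S θ κ w ν) →
        (∀ μ' : ProbabilityMeasure S,
          (∀ ν, Biorthogonal.rate S θ κ w μ' ≤ Biorthogonal.rate S θ κ w ν) → μ' = μ) →
        ∀ (Ω : Type*) [MeasurableSpace Ω] (P : Measure Ω) [IsProbabilityMeasure P]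
          (X : ∀ n, Ω → Fin (p n) → S),
          (∀ᶠ n in atTop, HasLaw (X n) (Biorthogonal.ensembleLaw S θ p wn n) P) →
          ∀ᵐ ω ∂P, Tendsto (fun n => Biorthogonal.empiricalMeasure (X n ω)) atTop (𝓝 μ)) ∧
      -- exponential bound
      (∀ A : Set (ProbabilityMeasure S), IsClosed A →
        A ∩ {ν | Biorthogonal.rate S θ κ w ν = 0} = ∅ →
        ((⨅ ν ∈ A, Biorthogonal.rate S θ κ w ν) ≠ ⊤ →
          ∀ᶠ n : ℕ in atTop,
            Biorthogonal.ensembleLaw S θ p wn n {x | Biorthogonal.empiricalMeasure x ∈ A} ≤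
              ENNReal.ofReal (Real.exp
                (-((n : ℝ) ^ 2 * (⨅ ν ∈ A, Biorthogonal.rate S θ κ w ν).toReal / 2)))) ∧
        ((⨅ ν ∈ A, Biorthogonal.rate S θ κ w ν) = ⊤ →
          ∀ M : ℝ, ∀ᶠ n : ℕ in atTop,
            Biorthogonal.ensembleLaw S θ p wn n {x | Biorthogonal.empiricalMeasure x ∈ A} ≤
              ENNReal.ofReal (Real.exp (-((n : ℝ) ^ 2 * M)))))) ∧
    -- the strong law for the disordered boson model, with `n + 1` particles
    (∀ α : ℕ, ∃ μ : ProbabilityMeasure (Set.Ici (0 : ℝ)),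
      (μ : Measure (Set.Ici (0 : ℝ))).map (↑) =
        (volume : Measure ℝ).withDensity
          (fun t => ENNReal.ofReal (Biorthogonal.bosonDensity t)) ∧
      ∀ (Ω : Type*) [MeasurableSpace Ω] (P : Measure Ω) [IsProbabilityMeasure P]
        (X : ∀ n : ℕ, Ω → Fin (n + 1) → Set.Ici (0 : ℝ)),
        (∀ n, HasLaw (X n) (Biorthogonal.bosonLaw α (n + 1)) P) →
        ∀ᵐ ω ∂P, Tendsto (fun n => Biorthogonal.empiricalMeasure (X n ω)) atTop (𝓝 μ)) := by
  refine ⟨?_, fun α => Biorthogonal.ae_tendsto_bosonLaw α⟩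
  intro S θ κ p _ wn w hne hS hSint hθ hpar hκ hp _ hwn0 h1 h2
  have h := h1.admissibleWeights h2 hS hκ (fun n => Nat.one_le_iff_ne_zero.2 (NeZero.ne (p n))) hp
    hwn0
  refine ⟨h.eventually_isProbabilityMeasure hS hne hSint hθ hpar hκ hp, ?_, fun A hA _ =>
    ⟨h.eventually_particleLaw_le_half hS hne hSint hθ hpar hκ hp hA,
      h.eventually_particleLaw_le_of_top hS hne hSint hθ hpar hκ hp hA⟩⟩
  intro μ hmin huniq Ω _ P _ X hX
  refine h.ae_tendsto_empiricalMeasure hS hne hSint hθ hpar hκ hp (fun ν hν => ?_) P X hX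
  -- `rate` is `energy` plus a fixed constant, so an energy no larger than that of the minimiser
  -- makes ν a minimiser of the rate too.
  exact huniq ν fun ν' => le_trans (by unfold Biorthogonal.rate; gcongr) (hmin ν')
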